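/- **Setting.** Let $p>2$ be a prime and let $R$ be an integral domain of characteristic zero which is $p$-adically complete (in particular $\bigcap_s p^sR=0$) and admits a $p$-th power Frobenius lift, i.e. a ring endomorphism $\sigma$ with $\sigma(r)\equiv r^p \pmod p$ for all $r\in R$. Let $f\in R[x_1^{\pm1},\dots,x_n^{\pm1}]$ have Newton polytope $\Delta\subset\mathbb R^n$ of dimension $\tilde n$. For $0\le l\le\tilde n$ let $\mu^{(l)}\subseteq\Delta$ be the complement of the union of all faces of $\Delta$ of codimension $>l$. For a face $\eta$ of $\Delta$ (nonempty, $\Delta$ itself allowed) let $f|_\eta$ be the sum of the terms of $f$ with exponent in $\eta$ (its Newton polytope is $\eta$), and let $\eta^\circ$ be the interior of $\eta$, i.e. the complement in $\eta$ of its proper faces (so the interior of a vertex is the vertex itself). *Hasse–Witt matrices.* $\beta_p^{(l)}$ is the matrix, indexed by $u,v\in\mu^{(l)}\cap\mathbb Z^n$, whose $(u,v)$ entry is the coefficient of $x^{pv-u}$ in $f^{p-1}$. The Hasse–Witt matrix of $f|_\eta$ is the corresponding matrix for $f|_\eta$ and $\eta^\circ\cap\mathbb Z^n$. An empty matrix counts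 as invertible. *Unit-root quotients.* Let $g$ be a Laurent polynomial with Newton polytope $\Gamma$, and let $\mu\subseteq\Gamma$ be a complement of a union of faces of $\Gamma$. Let $\Omega_g(\mu)$ be the $R$-module generated by the rational functions $(m-1)!\,x^u/g^m$ with $m\ge1$ and $u\in m\mu\cap\mathbb Z^n$, and let $\widehat\Omega_g(\mu)=\varprojlim_s\Omega_g(\mu)/p^s\Omega_g(\mu)$. If the coefficient of $g$ at a vertex $b$ of $\Gamma$ is a unit, then elements of $\widehat\Omega_g(\mu)$ expand at $b$ as formal Laurent series over $R$ supported in the cone $C(\Gamma-b)$ spanned by $\Gamma-b$. Let $d\Omega_{\rm formal}$ be the $R$-span of all $x_i\,\partial E/\partial x_i$ with $1\le i\le n$ and $E$ a series supported in this cone. Let $U_g(\mu)$ be the submodule of those elements of $\widehat\Omega_g(\mu)$ whose expansion lies in $d\Omega_{\rm formal}$, and put $Q_g(\mu)=\widehat\Omega_g(\mu)/U_g(\mu)$. For $\mu\subseteq\mu'$ one has $Q_g(\mu)\subseteq Q_g(\mu')$. For $u\in\mu\cap\mathbb Z^n$ write $\omega_u$ for the class of $x^u/g$. A derivation $\delta$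 of $R$ acts on $Q_g(\mu)$ by acting on the coefficients of expansions (the connection). For a Frobenius lift $\sigma$, let $g^\sigma$ be $g$ with $\sigma$ applied to its coefficients; the Cartier operator $\mathscr C_p:Q_g(\mu)\to Q_{g^\sigma}(\mu)$ is induced by $\sum_k a_kx^k\mapsto\sum_k a_{pk}x^k$ on expansions. **Theorem.** Assume that the coefficients of $f$ at all vertices of $\Delta$ are units in $R$, and let $1\le l\le\tilde n$. 1. $\beta_p^{(l)}$ is invertible over $R$ if and only if $\beta_p^{(l-1)}$ is invertible and, for every face $\eta$ of $\Delta$ of codimension $l$, the Hasse–Witt matrix of $f|_\eta$ is invertible. 2. Suppose that $\beta_p^{(l)}$ is invertible. For every choice of a vertex $b$ of $\Delta$ and of a vertex of each face of codimension $l$ (at which expansions are taken) there is an isomorphism of $R$-modules $$e_f:\ Q_f(\mu^{(l)})/Q_f(\mu^{(l-1)})\ \xrightarrow{\ \sim\ }\ \bigoplus_{\eta\ \text{face of }\Delta,\ \operatorname{codim}\eta=l}Q_{f|_\eta}(\eta^\circ)$$ which maps the class of $\omega_u$ to $\omega_u\in Q_{f|_\eta}(\eta^\circ)$ for every such $\eta$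 and every $u\in\eta^\circ\cap\mathbb Z^n$, and which is a decomposition of crystals: $e_f$ commutes with the connection maps of all derivations $\delta$ of $R$, and for every $p$-th power Frobenius lift $\sigma$ there is likewise an isomorphism $e_{f^\sigma}$ from $Q_{f^\sigma}(\mu^{(l)})/Q_{f^\sigma}(\mu^{(l-1)})$ to $\bigoplus_\eta Q_{(f|_\eta)^\sigma}(\eta^\circ)$, mapping $\omega_u$ to $\omega_u$ as above, such that $e_{f^\sigma}\circ\mathscr C_p=\bigl(\bigoplus_\eta\mathscr C_p\bigr)\circ e_f$. -/

import Mathlib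

open scoped DirectSum

noncomputable section

namespace UnitRoot

/-! ### Laurent polynomials, Newton polytopes, faces -/

/-- Laurent polynomials in `x₁, …, xₙ` over `R`; the exponent vectors lie in `ℤⁿ`. -/
abbrev Laurent (n : ℕ) (R : Type*) [CommRing R] := AddMonoidAlgebra R (Fin n → ℤ)

/-- The lattice point `u ∈ ℤⁿ` as a point of `ℝⁿ`. -/
def toReal {n : ℕ} (u : Fin n → ℤ) : Fin n → ℝ := fun i => (u i : ℝ)

section Polytopes

variable {n : ℕ}

/-- Faces of a polytope: its nonempty exposed subsets, i.e. the sets of maximizers of a linear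
functional.  The polytope itself is a face, the empty set is not. -/
def IsFace (Δ η : Set (Fin n → ℝ)) : Prop := IsExposed ℝ Δ η ∧ η.Nonempty

/-- The dimension of a polytope: the dimension of its affine span. -/
def polyDim (S : Set (Fin n → ℝ)) : ℕ := Module.finrank ℝ (vectorSpan ℝ S)

/-- The complement in `Δ` of the union of all faces of codimension `> l`. -/
def faceFiltration (Δ : Set (Fin n → ℝ)) (l : ℕ) : Set (Fin n → ℝ) :=
  {x | x ∈ Δ ∧ ∀ η, IsFace Δ η → x ∈ η → polyDim Δ ≤ polyDim η + l}

theorem faceFiltration_mono (Δ : Set (Fin n → ℝ)) {l l' : ℕ} (h : l ≤ l') :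
    faceFiltration Δ l ⊆ faceFiltration Δ l' :=
  fun _ hx => ⟨hx.1, fun η hη hxη => (hx.2 η hη hxη).trans (by omega)⟩

/-- The lattice points of the cone `C(μ)` other than the origin: pairs `(m, u)` with `m ≥ 1` and
`u ∈ m μ`. -/
def IsConePoint (μ : Set (Fin n → ℝ)) (m : ℕ) (u : Fin n → ℤ) : Prop :=
  1 ≤ m ∧ ∃ y ∈ μ, toReal u = (m : ℝ) • y

/-- The lattice points of the cone `C(Δ - b) = {λ (y - b) : y ∈ Δ, λ ≥ 0}`. -/
def vertexCone (Δ : Set (Fin n → ℝ)) (b : Fin n → ℤ) : Set (Fin n → ℤ) :=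
  {k | ∃ c : ℝ, 0 ≤ c ∧ ∃ y ∈ Δ, toReal k = c • (y - toReal b)}

end Polytopes

variable {n : ℕ} {R : Type*} [CommRing R]

/-- The Newton polytope: the convex hull of the support. -/
def newtonPolytope (f : Laurent n R) : Set (Fin n → ℝ) :=
  convexHull ℝ (toReal '' (f.coeff.support : Set (Fin n → ℤ)))

/-- `b` is a vertex of the Newton polytope of `f`. -/
def IsVertex (f : Laurent n R) (b : Fin n → ℤ) : Prop :=
  toReal b ∈ Set.extremePoints ℝ (newtonPolytope f)

open Classical in
/-- The restriction `f|_η`: keep only the terms of `f` whose exponents lie in `η`. -/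
def restrict (f : Laurent n R) (η : Set (Fin n → ℝ)) : Laurent n R :=
  AddMonoidAlgebra.ofCoeff (f.coeff.filter fun a => toReal a ∈ η)

/-- `f^σ`: apply `σ` to the coefficients of `f`. -/
def twist (σ : R →+* R) (f : Laurent n R) : Laurent n R :=
  AddMonoidAlgebra.mapRingHom (Fin n → ℤ) σ f

/-- `μ^{(l)}` for the Newton polytope of `f`. -/
def mu (f : Laurent n R) (l : ℕ) : Set (Fin n → ℝ) := faceFiltration (newtonPolytope f) l

theorem mu_mono (f : Laurent n R) {l l' : ℕ} (h : l ≤ l') : mu f l ⊆ mu f l' :=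
  faceFiltration_mono _ h

/-- The interior of the Newton polytope of `f`: the complement of its proper faces.
(The interior of a point is the point.) -/
abbrev interiorOf (f : Laurent n R) : Set (Fin n → ℝ) := mu f 0

/-- The faces of codimension `l` of the Newton polytope of `f`. -/
abbrev Face (f : Laurent n R) (l : ℕ) : Type :=
  {η : Set (Fin n → ℝ) //
    IsFace (newtonPolytope f) η ∧ polyDim η + l = polyDim (newtonPolytope f)}

/-! ### Hasse–Witt matrices -/

/-- The lattice points of `μ^{(l)}`. -/
abbrev LatticePoints (f : Laurent n R) (l : ℕ) : Type := {u : Fin n → ℤ // toReal u ∈ mu f l}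

instance (f : Laurent n R) (l : ℕ) : Finite (LatticePoints f l) := by
  have hb : Bornology.IsBounded (newtonPolytope f) := by
    rw [newtonPolytope, isBounded_convexHull]
    exact ((Finset.finite_toSet _).image _).isBounded
  obtain ⟨C, hC⟩ := hb.exists_norm_le
  have hfin : (Set.Icc (fun _ => -⌈C⌉) (fun _ => ⌈C⌉) : Set (Fin n → ℤ)).Finite :=
    Set.finite_Icc _ _
  refine (hfin.subset ?_).to_subtype
  intro u hu
  have h1 : ∀ i, |(u i : ℝ)| ≤ C := fun i => by
    have := (norm_le_pi_norm (toReal u) i).trans (hC _ hu.1)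
    simpa [toReal] using this
  constructor
  · intro i
    have h2 := (abs_le.1 (h1 i)).1
    have h3 := Int.le_ceil C
    have : ((-⌈C⌉ : ℤ) : ℝ) ≤ (u i : ℝ) := by push_cast; linarith
    exact_mod_cast this
  · intro i
    have h2 := (abs_le.1 (h1 i)).2
    have h3 := Int.le_ceil C
    have : (u i : ℝ) ≤ (⌈C⌉ : ℝ) := by linarith
    exact_mod_cast this

instance (f : Laurent n R) (l : ℕ) : Fintype (LatticePoints f l) := Fintype.ofFinite _

/-- The Hasse–Witt matrix `β_p^{(l)}` of `f` relative to `μ^{(l)}`.  Its entry at `(u, v)` is the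
coefficient of `x^{p v - u}` in `f^{p-1}`. -/
def hasseWitt (p : ℕ) (f : Laurent n R) (l : ℕ) :
    Matrix (LatticePoints f l) (LatticePoints f l) R :=
  fun u v => (f ^ (p - 1)).coeff ((p : ℤ) • v.1 - u.1)

/-! ### Formal series -/

/-- Arbitrary families of coefficients `∑_{k ∈ ℤⁿ} E k x^k`.  They do not form a ring, but they
can be multiplied by Laurent polynomials. -/
abbrev Series (n : ℕ) (R : Type*) : Type _ := (Fin n → ℤ) → R

/-- Multiplication of series by monomials `x^a`. -/
def shiftHom (n : ℕ) (R : Type*) [CommRing R] :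
    Multiplicative (Fin n → ℤ) →* Module.End R (Series n R) where
  toFun a :=
    { toFun := fun E k => E (k - a.toAdd)
      map_add' := fun _ _ => rfl
      map_smul' := fun _ _ => rfl }
  map_one' := by
    ext E k
    change E (k - 0) = E k
    rw [sub_zero]
  map_mul' a a' := by
    ext E k
    change E (k - (a.toAdd + a'.toAdd)) = E (k - a.toAdd - a'.toAdd)
    rw [sub_sub]

/-- Multiplication of series by Laurent polynomials. -/
instance : Module (Laurent n R) (Series n R) :=
  Module.compHom (Series n R)
    (AddMonoidAlgebra.lift R (Module.End R (Series n R)) (Fin n → ℤ) (shiftHom n R)).toRingHom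

/-- The coefficient of `x^k`. -/
def coeffAt (R : Type*) [CommRing R] (k : Fin n → ℤ) : Series n R →ₗ[R] R where
  toFun E := E k
  map_add' _ _ := rfl
  map_smul' _ _ := rfl

theorem smul_apply (g : Laurent n R) (E : Series n R) (k : Fin n → ℤ) :
    (g • E) k = g.coeff.sum fun a c => c * E (k - a) := by
  change coeffAt R k
    (AddMonoidAlgebra.lift R (Module.End R (Series n R)) (Fin n → ℤ) (shiftHom n R) g E) = _
  rw [AddMonoidAlgebra.lift_apply', Finsupp.sum, LinearMap.sum_apply, map_sum]
  rfl

instance : IsScalarTower R (Laurent n R) (Series n R) where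
  smul_assoc r g E := by
    change AddMonoidAlgebra.lift R (Module.End R (Series n R)) (Fin n → ℤ) (shiftHom n R) (r • g) E
      = r • AddMonoidAlgebra.lift R (Module.End R (Series n R)) (Fin n → ℤ) (shiftHom n R) g E
    rw [map_smul]; rfl

/-- The series `1`. -/
def Series.one : Series n R := fun k => if k = 0 then 1 else 0

/-- `Ω_formal` at `b`: series supported in the cone `C(Δ - b)`. -/
def formalSeries (R : Type*) [CommRing R] (Δ : Set (Fin n → ℝ)) (b : Fin n → ℤ) :
    Submodule R (Series n R) where
  carrier := {E | ∀ k, E k ≠ 0 → k ∈ vertexCone Δ b}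
  add_mem' := by
    intro E F hE hF k hk
    by_cases h : E k = 0
    · refine hF k fun h' => hk ?_
      change E k + F k = 0
      rw [h, h', add_zero]
    · exact hE k h
  zero_mem' := fun _ h => absurd rfl h
  smul_mem' := by
    intro r E hE k hk
    refine hE k fun h => hk ?_
    change r * E k = 0
    rw [h, mul_zero]

/-- The derivation `θ_i = x_i ∂/∂x_i` on series. -/
def theta (R : Type*) [CommRing R] (i : Fin n) : Series n R →ₗ[R] Series n R where
  toFun E := fun k => (k i : R) * E k
  map_add' E F := by funext k; exact mul_add _ _ _
  map_smul' r E := by funext k; exact mul_left_comm _ _ _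

/-- `dΩ_formal`: the `R`-span of all `θ_i E` with `E ∈ Ω_formal`. -/
def formalDerivatives (R : Type*) [CommRing R] (Δ : Set (Fin n → ℝ)) (b : Fin n → ℤ) :
    Submodule R (Series n R) :=
  Submodule.span R {D | ∃ i, ∃ E ∈ formalSeries R Δ b, D = theta R i E}

/-- The Cartier operator on series: `∑ a_k x^k ↦ ∑ a_{p k} x^k`. -/
def cartierSeries (p : ℕ) (E : Series n R) : Series n R := fun k => E ((p : ℤ) • k)

/-- A derivation of `R` acts on series coefficientwise. -/
def derivSeries (δ : Derivation ℤ R R) (E : Series n R) : Series n R := fun k => δ (E k)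

/-! ### Rational functions with powers of `f` in the denominator -/

/-- `ω_{(m,u)} = (m-1)! x^u / f^m`. -/
def omega (f : Laurent n R) (m : ℕ) (u : Fin n → ℤ) : Localization.Away f :=
  ((m - 1).factorial : R) •
    (algebraMap (Laurent n R) (Localization.Away f) (AddMonoidAlgebra.single u 1) *
      (IsLocalization.Away.invSelf f) ^ m)

/-- `Ω_f(μ)`: the `R`-module generated by the `ω_u` with `u` in the cone over `μ`. -/
def Omega (f : Laurent n R) (μ : Set (Fin n → ℝ)) : Submodule R (Localization.Away f) :=
  Submodule.span R {ω | ∃ m u, IsConePoint μ m u ∧ ω = omega f m u}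

theorem Omega_mono (f : Laurent n R) {μ μ' : Set (Fin n → ℝ)} (h : μ ⊆ μ') :
    Omega f μ ≤ Omega f μ' := by
  refine Submodule.span_mono ?_
  rintro _ ⟨m, u, ⟨hm, y, hy, e⟩, rfl⟩
  exact ⟨m, u, ⟨hm, y, h hy, e⟩, rfl⟩

theorem omega_mem (f : Laurent n R) {μ : Set (Fin n → ℝ)} {u : Fin n → ℤ} (h : toReal u ∈ μ) :
    omega f 1 u ∈ Omega f μ :=
  Submodule.subset_span ⟨1, u, ⟨le_rfl, _, h, by simp⟩, rfl⟩

/-! ### Formal expansion at a vertex -/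

/-- `φ` is the formal expansion at `b` of rational functions with a power of `f` in the
denominator: it is compatible with multiplication by Laurent polynomials, it expands `1` to `1`,
and it maps the generators `ω_u` of `Ω_f` into `Ω_formal`, i.e. to series supported in
`C(Δ - b)`. -/
def IsExpansion (f : Laurent n R) (b : Fin n → ℤ)
    (φ : Localization.Away f →ₗ[Laurent n R] Series n R) : Prop :=
  φ 1 = Series.one ∧
    ∀ m u, IsConePoint (newtonPolytope f) m u →
      φ (omega f m u) ∈ formalSeries R (newtonPolytope f) b


theorem exists_of_smul_ne_zero {g : Laurent n R} {E : Series n R} {k : Fin n → ℤ}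
    (h : (g • E) k ≠ 0) : ∃ a, g.coeff a ≠ 0 ∧ E (k - a) ≠ 0 := by
  rw [smul_apply] at h
  obtain ⟨a, ha, h'⟩ := Finset.exists_ne_zero_of_sum_ne_zero h
  exact ⟨a, Finsupp.mem_support_iff.1 ha, right_ne_zero_of_mul h'⟩

theorem smul_apply_congr {g : Laurent n R} {E F : Series n R} {k : Fin n → ℤ}
    (h : ∀ a, g.coeff a ≠ 0 → E (k - a) = F (k - a)) : (g • E) k = (g • F) k := by
  rw [smul_apply, smul_apply]
  exact Finset.sum_congr rfl fun a ha =>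
    congrArg (g.coeff a * ·) (h a (Finsupp.mem_support_iff.1 ha))

/-- Series whose support is bounded below with respect to `ℓ`. -/
def boundedBelow (R : Type*) [CommRing R] (ℓ : (Fin n → ℤ) →+ ℝ) :
    Submodule (Laurent n R) (Series n R) where
  carrier := {E | ∃ r, ∀ k, E k ≠ 0 → r ≤ ℓ k}
  add_mem' := by
    rintro E F ⟨r, hr⟩ ⟨s, hs⟩
    refine ⟨min r s, fun k hk => ?_⟩
    by_cases h : E k = 0
    · exact (min_le_right _ _).trans (hs k fun h' => hk (by rw [Pi.add_apply, h, h', add_zero]))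
    · exact (min_le_left _ _).trans (hr k h)
  zero_mem' := ⟨0, fun _ h => absurd rfl h⟩
  smul_mem' := by
    rintro g E ⟨r, hr⟩
    obtain ⟨s, hs⟩ := ((g.coeff.support.finite_toSet).image ℓ).bddBelow
    refine ⟨s + r, fun k hk => ?_⟩
    obtain ⟨a, ha, hE⟩ := exists_of_smul_ne_zero hk
    have h1 := hs ⟨a, Finsupp.mem_support_iff.2 ha, rfl⟩
    have h2 := hr _ hE
    rw [map_sub] at h2
    linarith

/-- A linear functional which attains its minimum on the support of `f` only at the vertex `b`. -/
theorem exists_functional {f : Laurent n R} {b : Fin n → ℤ} (hb : IsVertex f b) :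
    ∃ (ℓ : (Fin n → ℤ) →+ ℝ) (c : ℝ), 0 < c ∧
      (∀ a, f.coeff a ≠ 0 → a ≠ b → ℓ b + c ≤ ℓ a) ∧
      ∀ k ∈ vertexCone (newtonPolytope f) b, 0 ≤ ℓ k := by
  set T : Set (Fin n → ℝ) := toReal '' {a | f.coeff a ≠ 0 ∧ a ≠ b} with hT
  have hTf : T.Finite :=
    ((f.coeff.support.finite_toSet).subset
      (fun a ha => Finsupp.mem_support_iff.2 ha.1)).image _
  have hinj : ∀ a a' : Fin n → ℤ, toReal a = toReal a' → a = a' := by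
    intro a a' h; funext i
    have := congrFun h i
    simpa [toReal] using this
  have hconv : Convex ℝ (newtonPolytope f) := convex_convexHull ℝ _
  have hnot : toReal b ∉ convexHull ℝ T := by
    have h := (hconv.mem_extremePoints_iff_convex_sdiff.1 hb).2
    refine fun hm => ((convexHull_min ?_ h) hm).2 rfl
    rintro _ ⟨a, ⟨ha, hab⟩, rfl⟩
    exact ⟨subset_convexHull ℝ _ ⟨a, Finsupp.mem_support_iff.2 ha, rfl⟩,
      fun h' => hab (hinj _ _ h')⟩
  obtain ⟨φ, u, h1, h2⟩ := geometric_hahn_banach_point_closed (convex_convexHull ℝ T)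
    (hTf.isCompact_convexHull ℝ).isClosed hnot
  refine ⟨{ toFun := fun a => φ (toReal a)
            map_zero' := ?_
            map_add' := ?_ }, u - φ (toReal b), sub_pos.2 h1, ?_, ?_⟩
  · have : toReal (0 : Fin n → ℤ) = 0 := by funext i; simp [toReal]
    rw [this, map_zero]
  · intro a a'
    have : toReal (a + a') = toReal a + toReal a' := by funext i; simp [toReal]
    rw [this, map_add]
  · intro a ha hab
    have := h2 (toReal a) (subset_convexHull ℝ _ ⟨a, ⟨ha, hab⟩, rfl⟩)
    change φ (toReal b) + (u - φ (toReal b)) ≤ φ (toReal a)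
    linarith
  · rintro k ⟨s, hs, y, hy, hk⟩
    change 0 ≤ φ (toReal k)
    have h3 : φ (toReal b) ≤ φ y := by
      have hsub : newtonPolytope f ⊆ {z | φ (toReal b) ≤ φ z} := by
        refine convexHull_min ?_ (convex_halfSpace_ge φ.toLinearMap.isLinear _)
        rintro _ ⟨a, ha, rfl⟩
        by_cases hab : a = b
        · subst hab; exact le_refl (φ (toReal a))
        · exact (h1.trans (h2 _ (subset_convexHull ℝ _
            ⟨a, ⟨Finsupp.mem_support_iff.1 ha, hab⟩, rfl⟩))).le
      exact hsub hy
    rw [hk, map_smul, map_sub, smul_eq_mul]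
    exact mul_nonneg hs (sub_nonneg.2 h3)

section Expansion

variable {f : Laurent n R} {b : Fin n → ℤ} {ℓ : (Fin n → ℤ) →+ ℝ} {c : ℝ}

/-- If the support of `f • E` lies in `b + S`, where `S` is stable under translation by the
vectors `a - b` with `a` in the support of `f`, then the support of `E` lies in `S`. -/
theorem support_of_smul (hu : IsUnit (f.coeff b)) (hc : 0 < c)
    (hℓ : ∀ a, f.coeff a ≠ 0 → a ≠ b → ℓ b + c ≤ ℓ a) {S : Set (Fin n → ℤ)}
    (hS : ∀ k ∈ S, ∀ a, f.coeff a ≠ 0 → k + (a - b) ∈ S)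
    {E : Series n R} (hE : E ∈ boundedBelow R ℓ) (hF : ∀ k, (f • E) (k + b) ≠ 0 → k ∈ S) :
    ∀ k, E k ≠ 0 → k ∈ S := by
  obtain ⟨r, hr⟩ := hE
  have key : ∀ N : ℕ, ∀ k, ℓ k < r + N * c → E k ≠ 0 → k ∈ S := by
    intro N
    induction N with
    | zero =>
      intro k hk hEk
      have := hr k hEk
      simp at hk; linarith
    | succ N ih =>
      intro k hk hEk
      by_contra hkS
      have h0 : (f • E) (k + b) = 0 := by
        by_contra h; exact hkS (hF k h)
      rw [smul_apply, Finsupp.sum] at h0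
      by_cases hex : ∃ a, f.coeff a ≠ 0 ∧ a ≠ b ∧ E (k + b - a) ≠ 0
      · obtain ⟨a, ha, hab, hEa⟩ := hex
        have h1 := hℓ a ha hab
        have h2 : k + b - a ∈ S := by
          refine ih _ ?_ hEa
          rw [map_sub, map_add]
          push_cast at hk
          linarith
        have h3 := hS _ h2 a ha
        have h4 : k + b - a + (a - b) = k := by abel
        rw [h4] at h3
        exact hkS h3
      · push Not at hex
        rw [Finset.sum_eq_single b] at h0
        · rw [add_sub_cancel_right] at h0
          exact hEk ((hu.mul_right_eq_zero).1 h0)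
        · intro a ha hab
          rw [hex a (Finsupp.mem_support_iff.1 ha) hab, mul_zero]
        · intro hb'
          rw [Finsupp.notMem_support_iff.1 hb', zero_mul]
  intro k
  obtain ⟨N, hN⟩ := exists_nat_gt ((ℓ k - r) / c)
  refine key N k ?_
  rw [div_lt_iff₀ hc] at hN
  linarith

theorem smul_injective (hu : IsUnit (f.coeff b)) (hc : 0 < c)
    (hℓ : ∀ a, f.coeff a ≠ 0 → a ≠ b → ℓ b + c ≤ ℓ a)
    {E : Series n R} (hE : E ∈ boundedBelow R ℓ) (h : f • E = 0) : E = 0 := by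
  funext k
  by_contra hk
  exact support_of_smul hu hc hℓ (S := ∅) (by simp) hE
    (fun k hk => absurd (by rw [h]; rfl) hk) k hk

/-- Geometric series: `1 - w` is surjective when `w` strictly raises `ℓ`. -/
theorem exists_one_sub_smul {w : Laurent n R} (hc : 0 < c) (hw : ∀ a, w.coeff a ≠ 0 → c ≤ ℓ a)
    {F : Series n R} (hF : F ∈ boundedBelow R ℓ) :
    ∃ E ∈ boundedBelow R ℓ, (1 - w) • E = F := by
  obtain ⟨r, hr⟩ := hF
  have hpow : ∀ j : ℕ, ∀ k, (w ^ j • F) k ≠ 0 → r + j * c ≤ ℓ k := by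
    intro j
    induction j with
    | zero => intro k hk; simpa using hr k (by simpa using hk)
    | succ j ih =>
      intro k hk
      rw [pow_succ', mul_smul] at hk
      obtain ⟨a, ha, h'⟩ := exists_of_smul_ne_zero hk
      have h1 := ih _ h'
      have h2 := hw a ha
      rw [map_sub] at h1
      push_cast
      linarith
  set S : ℕ → Series n R := fun N => (∑ j ∈ Finset.range N, w ^ j) • F with hSdef
  have hstep : ∀ (N : ℕ) (k : Fin n → ℤ), ℓ k < r + N * c → S (N + 1) k = S N k := by
    intro N k hk
    simp only [hSdef, Finset.sum_range_succ, add_smul]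
    rw [Pi.add_apply]
    have : (w ^ N • F) k = 0 := by
      by_contra h; linarith [hpow N k h]
    rw [this, add_zero]
  have hstab : ∀ (N M : ℕ) (k : Fin n → ℤ), ℓ k < r + N * c → N ≤ M → S M k = S N k := by
    intro N M k hk hNM
    induction M, hNM using Nat.le_induction with
    | base => rfl
    | succ M hM ih =>
      rw [hstep M k, ih]
      have : (N : ℝ) ≤ M := by exact_mod_cast hM
      nlinarith
  have hstab2 : ∀ (N M : ℕ) (k : Fin n → ℤ), ℓ k < r + N * c → ℓ k < r + M * c → S N k = S M k := by
    intro N M k h1 h2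
    rcases le_total N M with h | h
    · exact (hstab N M k h1 h).symm
    · exact hstab M N k h2 h
  have hN : ∀ k, ∃ N : ℕ, ℓ k < r + N * c := by
    intro k
    obtain ⟨N, hN⟩ := exists_nat_gt ((ℓ k - r) / c)
    rw [div_lt_iff₀ hc] at hN
    exact ⟨N, by linarith⟩
  choose N hN using hN
  have hSr : ∀ M k, S M k ≠ 0 → r ≤ ℓ k := by
    intro M
    induction M with
    | zero => intro k hk; simp only [hSdef, Finset.range_zero, Finset.sum_empty, zero_smul] at hk
              exact absurd rfl hk
    | succ M ih =>
      intro k hk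
      simp only [hSdef, Finset.sum_range_succ, add_smul] at hk
      rw [Pi.add_apply] at hk
      by_cases h : (w ^ M • F) k = 0
      · rw [h, add_zero] at hk; exact ih k hk
      · have := hpow M k h
        have : 0 ≤ (M : ℝ) * c := by positivity
        linarith
  let E : Series n R := fun k => S (N k) k
  have hE : ∀ (M : ℕ) (k : Fin n → ℤ), ℓ k < r + M * c → E k = S M k := fun M k hk => hstab2 _ _ _ (hN k) hk
  refine ⟨E, ⟨r, fun k hk => hSr _ k hk⟩, ?_⟩
  funext k
  have h1 : ((1 - w) • E) k = ((1 - w) • S (N k)) k := by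
    rw [sub_smul, sub_smul, one_smul, one_smul, Pi.sub_apply, Pi.sub_apply]
    congr 1
    refine smul_apply_congr fun a ha => hE _ _ ?_
    have := hw a ha
    rw [map_sub]
    linarith [hN k]
  have h2 : (1 - w) • S (N k) = F - w ^ N k • F := by
    simp only [hSdef]
    rw [smul_smul, mul_neg_geom_sum, sub_smul, one_smul]
  rw [h1, h2, Pi.sub_apply]
  have : (w ^ N k • F) k = 0 := by
    by_contra h; linarith [hpow _ k h, hN k]
  rw [this, sub_zero]

theorem exists_smul_eq (hu : IsUnit (f.coeff b)) (hc : 0 < c)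
    (hℓ : ∀ a, f.coeff a ≠ 0 → a ≠ b → ℓ b + c ≤ ℓ a)
    {F : Series n R} (hF : F ∈ boundedBelow R ℓ) : ∃ E ∈ boundedBelow R ℓ, f • E = F := by
  obtain ⟨v, hv⟩ := hu
  set t : Laurent n R := AddMonoidAlgebra.single (-b) (↑v⁻¹ : R) with ht
  set t' : Laurent n R := AddMonoidAlgebra.single b (v : R) with ht'
  have htt : t' * t = 1 := by
    rw [ht, ht', AddMonoidAlgebra.single_mul_single, add_neg_cancel, Units.mul_inv]; rfl
  have hw : ∀ a, (1 - t * f).coeff a ≠ 0 → c ≤ ℓ a := by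
    intro a ha
    have h1 : (t * f).coeff a = ↑v⁻¹ * f.coeff (b + a) := by
      rw [ht, show a = -b + (b + a) by abel, AddMonoidAlgebra.coeff_single_mul_add]
      congr 2; abel
    rw [AddMonoidAlgebra.coeff_sub, Finsupp.sub_apply, h1] at ha
    by_cases h0 : a = 0
    · subst h0
      rw [add_zero, ← hv, Units.inv_mul] at ha
      exact absurd (by simp [AddMonoidAlgebra.one_def]) ha
    · have h2 : f.coeff (b + a) ≠ 0 := by
        intro h
        rw [h] at ha
        exact absurd (by simp [AddMonoidAlgebra.one_def, Ne.symm h0]) ha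
      have := hℓ _ h2 (by simpa using h0)
      rw [map_add] at this
      linarith
  obtain ⟨E, hE, h⟩ := exists_one_sub_smul hc hw ((boundedBelow R ℓ).smul_mem t hF)
  refine ⟨E, hE, ?_⟩
  rw [sub_sub_cancel] at h
  calc f • E = (t' * t) • f • E := by rw [htt, one_smul]
    _ = t' • (t * f) • E := by rw [mul_smul, mul_smul]
    _ = F := by rw [h, ← mul_smul, htt, one_smul]

theorem support_of_pow_smul (hu : IsUnit (f.coeff b)) (hc : 0 < c)
    (hℓ : ∀ a, f.coeff a ≠ 0 → a ≠ b → ℓ b + c ≤ ℓ a) {S : Set (Fin n → ℤ)}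
    (hS : ∀ k ∈ S, ∀ a, f.coeff a ≠ 0 → k + (a - b) ∈ S) (m : ℕ) :
    ∀ {E : Series n R}, E ∈ boundedBelow R ℓ →
      (∀ k, (f ^ m • E) (k + m • b) ≠ 0 → k ∈ S) → ∀ k, E k ≠ 0 → k ∈ S := by
  induction m with
  | zero => intro E _ h k hk; exact h k (by simpa using hk)
  | succ m ih =>
    intro E hE h
    refine support_of_smul hu hc hℓ hS hE fun k hk => ?_
    have := ih (E := fun k => (f • E) (k + b)) ?_ ?_ k hk
    · exact this
    · obtain ⟨r, hr⟩ := (boundedBelow R ℓ).smul_mem f hE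
      refine ⟨r - ℓ b, fun k hk => ?_⟩
      have := hr _ hk
      rw [map_add] at this
      linarith
    · intro k hk
      refine h k ?_
      have e1 : (fun k => (f • E) (k + b) : Series n R)
          = (AddMonoidAlgebra.single (-b) (1 : R) : Laurent n R) • f • E := by
        funext k
        rw [smul_apply (AddMonoidAlgebra.single (-b) (1 : R)), AddMonoidAlgebra.coeff_single,
          Finsupp.sum_single_index (by simp), one_mul, sub_neg_eq_add]
      rw [e1, smul_comm, ← mul_smul (f ^ m), ← pow_succ, smul_apply,
        AddMonoidAlgebra.coeff_single, Finsupp.sum_single_index (by simp), one_mul,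
        sub_neg_eq_add, add_assoc, ← succ_nsmul] at hk
      exact hk

theorem vertexCone_add {Δ : Set (Fin n → ℝ)} (hΔ : Convex ℝ Δ) {b k a : Fin n → ℤ}
    (hk : k ∈ vertexCone Δ b) (ha : toReal a ∈ Δ) : k + (a - b) ∈ vertexCone Δ b := by
  obtain ⟨s, hs, y, hy, hk⟩ := hk
  have h1 : 0 < s + 1 := by linarith
  refine ⟨s + 1, h1.le, (s / (s + 1)) • y + (1 / (s + 1)) • toReal a,
    hΔ hy ha (by positivity) (by positivity) (by field_simp), ?_⟩
  funext i
  have := congrFun hk i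
  simp only [toReal, Pi.smul_apply, Pi.sub_apply, smul_eq_mul, Pi.add_apply] at this ⊢
  push_cast
  rw [this]
  field_simp
  ring

theorem smul_one_apply (g : Laurent n R) (k : Fin n → ℤ) :
    (g • (Series.one : Series n R)) k = g.coeff k := by
  rw [smul_apply, Finsupp.sum, Finset.sum_eq_single k]
  · simp [Series.one]
  · intro a _ hak
    simp [Series.one, sub_eq_zero, Ne.symm hak]
  · intro h
    rw [Finsupp.notMem_support_iff.1 h, zero_mul]

theorem pow_smul_omega (f : Laurent n R) (m : ℕ) (u : Fin n → ℤ) :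
    f ^ m • omega f m u = ((m - 1).factorial : R) •
      algebraMap (Laurent n R) (Localization.Away f) (AddMonoidAlgebra.single u 1) := by
  rw [omega, smul_comm, Algebra.smul_def (f ^ m), mul_left_comm, map_pow, ← mul_pow,
    IsLocalization.Away.mul_invSelf, one_pow, mul_one]

end Expansion

/-- The formal expansion at a vertex with unit coefficient exists. -/
theorem exists_isExpansion {f : Laurent n R} {b : Fin n → ℤ} (hb : IsVertex f b)
    (hu : IsUnit (f.coeff b)) : ∃ φ, IsExpansion f b φ := by
  obtain ⟨ℓ, c, hc, hℓ, -⟩ := exists_functional hb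
  have hone : (Series.one : Series n R) ∈ boundedBelow R ℓ := by
    refine ⟨0, fun k hk => ?_⟩
    have : k = 0 := by
      by_contra h; exact hk (by simp [Series.one, h])
    rw [this, map_zero]
  have hbij : IsUnit (algebraMap (Laurent n R) (Module.End (Laurent n R) (boundedBelow R ℓ)) f) := by
    rw [Module.End.isUnit_iff]
    constructor
    · refine (injective_iff_map_eq_zero _).2 fun E hE => ?_
      exact Subtype.ext (smul_injective hu hc hℓ E.2 (congrArg Subtype.val hE))
    · intro F
      obtain ⟨E, hE, h⟩ := exists_smul_eq hu hc hℓ F.2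
      exact ⟨⟨E, hE⟩, Subtype.ext h⟩
  let φ := IsLocalizedModule.lift (Submonoid.powers f)
    (Algebra.linearMap (Laurent n R) (Localization.Away f))
    (LinearMap.toSpanSingleton (Laurent n R) (boundedBelow R ℓ) ⟨Series.one, hone⟩)
    (by
      rintro ⟨_, m, rfl⟩
      change IsUnit (algebraMap (Laurent n R) _ (f ^ m))
      rw [map_pow]
      exact hbij.pow m)
  have hφ : ∀ g, φ (algebraMap _ _ g) = g • (⟨Series.one, hone⟩ : boundedBelow R ℓ) := fun g =>
    IsLocalizedModule.lift_apply _ _ _ _ g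
  refine ⟨(boundedBelow R ℓ).subtype ∘ₗ φ, ?_, ?_⟩
  · have := hφ 1
    rw [map_one, one_smul] at this
    change (φ 1 : Series n R) = _
    rw [this]
  · rintro m u ⟨hm, y, hy, hmu⟩
    refine support_of_pow_smul hu hc hℓ (S := vertexCone (newtonPolytope f) b)
      (fun k hk a ha => vertexCone_add (convex_convexHull ℝ _) hk
        (subset_convexHull ℝ _ ⟨a, Finsupp.mem_support_iff.2 ha, rfl⟩)) m
      (φ (omega f m u)).2 ?_
    intro k hk
    have h1 : f ^ m • (φ (omega f m u) : Series n R) =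
        ((m - 1).factorial : R) •
          ((AddMonoidAlgebra.single u 1 : Laurent n R) • (Series.one : Series n R)) := by
      rw [← Submodule.coe_smul, ← map_smul, pow_smul_omega, LinearMap.map_smul_of_tower, hφ]
      rfl
    change (f ^ m • (φ (omega f m u) : Series n R)) _ ≠ 0 at hk
    rw [h1, Pi.smul_apply, smul_one_apply, AddMonoidAlgebra.coeff_single] at hk
    have hku : u = k + m • b := by
      by_contra h
      exact hk (by rw [Finsupp.single_eq_of_ne' h, smul_zero])
    refine ⟨m, Nat.cast_nonneg _, y, hy, ?_⟩
    funext i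
    have h2 := congrFun hmu i
    have h3 := congrFun hku i
    simp only [toReal, Pi.smul_apply, Pi.sub_apply, smul_eq_mul, Pi.add_apply] at h2 h3 ⊢
    rw [h3] at h2
    rw [nsmul_eq_mul] at h2
    push_cast at h2
    linarith

/-- The formal expansion at a vertex with unit coefficient is unique. -/
theorem IsExpansion.unique [IsDomain R] [CharZero R] {f : Laurent n R} {b : Fin n → ℤ}
    (hb : IsVertex f b) (hu : IsUnit (f.coeff b))
    {φ ψ : Localization.Away f →ₗ[Laurent n R] Series n R}
    (hφ : IsExpansion f b φ) (hψ : IsExpansion f b ψ) : φ = ψ := by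
  obtain ⟨ℓ, c, hc, hℓ, hcone⟩ := exists_functional hb
  have hpow : ∀ (m : ℕ) (E : Series n R), E ∈ boundedBelow R ℓ → f ^ m • E = 0 → E = 0 := by
    intro m E hE h
    funext k
    by_contra hk
    exact support_of_pow_smul hu hc hℓ (S := ∅) (by simp) m hE
      (fun k hk => absurd (by rw [h]; rfl) hk) k hk
  have hw : ∀ m, 1 ≤ m → φ (omega f m (m • b)) = ψ (omega f m (m • b)) := by
    intro m hm
    have hcp : IsConePoint (newtonPolytope f) m (m • b) := by
      refine ⟨hm, _, hb.1, ?_⟩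
      funext i; simp [toReal]
    rw [← sub_eq_zero]
    refine hpow m _ ⟨0, fun k hk => hcone k ?_⟩ ?_
    · exact ((formalSeries R (newtonPolytope f) b).sub_mem (hφ.2 _ _ hcp) (hψ.2 _ _ hcp)) k hk
    · rw [smul_sub, ← map_smul, ← map_smul, pow_smul_omega, LinearMap.map_smul_of_tower,
        LinearMap.map_smul_of_tower, Algebra.algebraMap_eq_smul_one, map_smul, map_smul, hφ.1,
        hψ.1, sub_self]
  have hinv : ∀ m, φ (IsLocalization.Away.invSelf f ^ (m + 1)) =
      ψ (IsLocalization.Away.invSelf f ^ (m + 1)) := by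
    intro m
    have h := hw (m + 1) (by omega)
    rw [omega, LinearMap.map_smul_of_tower, LinearMap.map_smul_of_tower, ← Algebra.smul_def,
      map_smul, map_smul] at h
    have hfac : (((m + 1 - 1).factorial : ℕ) : R) ≠ 0 := by
      exact_mod_cast Nat.factorial_ne_zero _
    have h' := smul_right_injective (Series n R) hfac h
    have h2 := congrArg (fun E => (AddMonoidAlgebra.single (-((m + 1) • b)) 1 : Laurent n R) • E) h'
    simp only [← mul_smul, AddMonoidAlgebra.single_mul_single, neg_add_cancel, one_mul] at h2
    rw [← AddMonoidAlgebra.one_def, one_smul, one_smul] at h2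
    exact h2
  ext1 x
  obtain ⟨m, g, hx⟩ := IsLocalization.Away.surj f x
  have hx' : x = (g * f) • IsLocalization.Away.invSelf f ^ (m + 1) := by
    rw [Algebra.smul_def, map_mul, ← hx, mul_assoc x, ← pow_succ, mul_assoc, ← mul_pow,
      IsLocalization.Away.mul_invSelf, one_pow, mul_one]
  rw [hx', map_smul, map_smul, hinv]

/-- The formal expansion at `b` (defined to be `0` when there is none; there is exactly one when
`b` is a vertex at which the coefficient of `f` is a unit). -/
def expansion (f : Laurent n R) (b : Fin n → ℤ) :
    Localization.Away f →ₗ[Laurent n R] Series n R :=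
  open Classical in if h : ∃ φ, IsExpansion f b φ then h.choose else 0

/-! ### Completions, formal derivatives and the quotients `Q_f(μ)` -/

/-- The `p`-adic completion `lim Ω_f(μ) / p^s Ω_f(μ)`. -/
abbrev OmegaHat (p : ℕ) (f : Laurent n R) (μ : Set (Fin n → ℝ)) : Type _ :=
  AdicCompletion (Ideal.span {(p : R)}) (Omega f μ)

/-- The inclusion of completions induced by `μ ⊆ μ'`. -/
def OmegaHat.incl (p : ℕ) (f : Laurent n R) {μ μ' : Set (Fin n → ℝ)} (h : μ ⊆ μ') :
    OmegaHat p f μ →ₗ[R] OmegaHat p f μ' :=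
  (AdicCompletion.map (Ideal.span {(p : R)})
    (Submodule.inclusion (Omega_mono f h))).restrictScalars R

section Complete

variable (p : ℕ) [IsAdicComplete (Ideal.span {(p : R)}) R]

/-- The `p`-adic extension of an `R`-linear functional on a module to the completion of the module,
with values in the `p`-adically complete ring `R`. -/
def extendFunctional {M : Type*} [AddCommGroup M] [Module R M] (τ : M →ₗ[R] R) :
    AdicCompletion (Ideal.span {(p : R)}) M →ₗ[R] R :=
  (AdicCompletion.ofLinearEquiv (Ideal.span {(p : R)}) R).symm.toLinearMap ∘ₗ
    (AdicCompletion.map (Ideal.span {(p : R)}) τ).restrictScalars R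

/-- The formal expansion at `b` of elements of the completion of `Ω_f(μ)`: the coefficients are
the `p`-adic extensions of the coefficients of the expansion of elements of `Ω_f(μ)`. -/
def expansionHat (f : Laurent n R) (b : Fin n → ℤ) (μ : Set (Fin n → ℝ)) :
    OmegaHat p f μ →ₗ[R] Series n R :=
  LinearMap.pi fun k => extendFunctional p
    (coeffAt R k ∘ₗ (expansion f b).restrictScalars R ∘ₗ (Omega f μ).subtype)

/-- `U_f(μ)`: the elements of the completion of `Ω_f(μ)` which are formal derivatives. -/
def U (f : Laurent n R) (b : Fin n → ℤ) (μ : Set (Fin n → ℝ)) : Submodule R (OmegaHat p f μ) :=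
  (formalDerivatives R (newtonPolytope f) b).comap (expansionHat p f b μ)

/-- `Q_f(μ)`: the completion of `Ω_f(μ)` modulo formal derivatives. -/
def Q (f : Laurent n R) (b : Fin n → ℤ) (μ : Set (Fin n → ℝ)) : Type _ :=
  OmegaHat p f μ ⧸ U p f b μ

instance (f : Laurent n R) (b : Fin n → ℤ) (μ : Set (Fin n → ℝ)) : AddCommGroup (Q p f b μ) :=
  inferInstanceAs (AddCommGroup (OmegaHat p f μ ⧸ U p f b μ))

instance (f : Laurent n R) (b : Fin n → ℤ) (μ : Set (Fin n → ℝ)) : Module R (Q p f b μ) :=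
  inferInstanceAs (Module R (OmegaHat p f μ ⧸ U p f b μ))

/-- The projection from the completion of `Ω_f(μ)` to `Q_f(μ)`. -/
def Q.mk (f : Laurent n R) (b : Fin n → ℤ) (μ : Set (Fin n → ℝ)) :
    OmegaHat p f μ →ₗ[R] Q p f b μ :=
  (U p f b μ).mkQ

theorem Q.mk_surjective (f : Laurent n R) (b : Fin n → ℤ) (μ : Set (Fin n → ℝ)) :
    Function.Surjective (Q.mk p f b μ) :=
  (U p f b μ).mkQ_surjective

theorem Q.mk_eq_zero (f : Laurent n R) (b : Fin n → ℤ) (μ : Set (Fin n → ℝ))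
    (x : OmegaHat p f μ) : Q.mk p f b μ x = 0 ↔ x ∈ U p f b μ :=
  Submodule.Quotient.mk_eq_zero _

/-- The class of `ω_u` in `Q_f(μ)`, for a lattice point `u` of `μ`. -/
def omegaClass (f : Laurent n R) (b : Fin n → ℤ) (μ : Set (Fin n → ℝ)) {u : Fin n → ℤ}
    (hu : toReal u ∈ μ) : Q p f b μ :=
  Q.mk p f b μ (AdicCompletion.of _ _ ⟨omega f 1 u, omega_mem f hu⟩)

theorem expansionHat_incl (f : Laurent n R) (b : Fin n → ℤ) {μ μ' : Set (Fin n → ℝ)}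
    (h : μ ⊆ μ') (x : OmegaHat p f μ) :
    expansionHat p f b μ' (OmegaHat.incl p f h x) = expansionHat p f b μ x := by
  funext k
  change (AdicCompletion.ofLinearEquiv _ R).symm (AdicCompletion.map _ _ (AdicCompletion.map _ _ x))
    = (AdicCompletion.ofLinearEquiv _ R).symm (AdicCompletion.map _ _ x)
  rw [AdicCompletion.map_comp_apply]
  rfl

/-- The map `Q_f(μ) → Q_f(μ')` induced by `μ ⊆ μ'`. -/
def Q.incl (f : Laurent n R) (b : Fin n → ℤ) {μ μ' : Set (Fin n → ℝ)} (h : μ ⊆ μ') :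
    Q p f b μ →ₗ[R] Q p f b μ' :=
  Submodule.mapQ (U p f b μ) (U p f b μ') (OmegaHat.incl p f h) fun x hx => by
    change expansionHat p f b μ' (OmegaHat.incl p f h x) ∈
      formalDerivatives R (newtonPolytope f) b
    rw [expansionHat_incl]
    exact hx

/-- `Q_f(μ) → Q_f(μ')` is injective, so `Q_f(μ)` is a submodule of `Q_f(μ')`. -/
theorem Q.incl_injective (f : Laurent n R) (b : Fin n → ℤ) {μ μ' : Set (Fin n → ℝ)}
    (h : μ ⊆ μ') : Function.Injective (Q.incl p f b h) := by
  refine (injective_iff_map_eq_zero _).2 fun x hx => ?_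
  obtain ⟨x, rfl⟩ := Q.mk_surjective p f b μ x
  have h1 : OmegaHat.incl p f h x ∈ U p f b μ' := (Q.mk_eq_zero p f b μ' _).1 hx
  change expansionHat p f b μ' (OmegaHat.incl p f h x) ∈
    formalDerivatives R (newtonPolytope f) b at h1
  rw [expansionHat_incl] at h1
  exact (Q.mk_eq_zero p f b μ x).2 h1

/-- `Q_f(μ') / Q_f(μ)` for `μ ⊆ μ'`. -/
abbrev QQuot (f : Laurent n R) (b : Fin n → ℤ) {μ μ' : Set (Fin n → ℝ)} (h : μ ⊆ μ') : Type _ :=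
  Q p f b μ' ⧸ LinearMap.range (Q.incl p f b h)

/-! ### Cartier operator and connection -/

/-- `T` is the Cartier operator `Q_f(μ) → Q_{f^σ}(μ)`, i.e. it is induced by the Cartier operator
on formal expansions. -/
def IsCartier (σ : R →+* R) (f : Laurent n R) (b : Fin n → ℤ) (μ : Set (Fin n → ℝ))
    (T : Q p f b μ →ₗ[R] Q p (twist σ f) b μ) : Prop :=
  ∀ x : OmegaHat p f μ, ∃ y : OmegaHat p (twist σ f) μ,
    expansionHat p (twist σ f) b μ y = cartierSeries p (expansionHat p f b μ x) ∧
      T (Q.mk p f b μ x) = Q.mk p (twist σ f) b μ y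

/-- `D` is the connection map on `Q_f(μ)` given by the derivation `δ` of `R`, i.e. it is induced by
the coefficientwise action of `δ` on formal expansions. -/
def IsConnection (δ : Derivation ℤ R R) (f : Laurent n R) (b : Fin n → ℤ) (μ : Set (Fin n → ℝ))
    (D : Q p f b μ →+ Q p f b μ) : Prop :=
  ∀ x : OmegaHat p f μ, ∃ y : OmegaHat p f μ,
    expansionHat p f b μ y = derivSeries δ (expansionHat p f b μ x) ∧
      D (Q.mk p f b μ x) = Q.mk p f b μ y

end Complete

/-- `σ` is a `p`-th power Frobenius lift. -/
def IsFrobeniusLift (p : ℕ) (σ : R →+* R) : Prop := ∀ r, (p : R) ∣ σ r - r ^ p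

/-! ### The decomposition -/

section Decomposition

variable (p : ℕ) [IsAdicComplete (Ideal.span {(p : R)}) R] (f : Laurent n R) (l : ℕ)

/-- `R`-linear isomorphisms from `Q_g(μ^{(l)}) / Q_g(μ^{(l-1)})` to the direct sum of the
`Q_{h_η}(η°)` over the faces `η` of codimension `l` of the Newton polytope of `f`.  It is used for
`g = f`, `h_η = f|_η` and for `g = f^σ`, `h_η = (f|_η)^σ`; formal expansions are taken at the vertex
`b` of the polytope and at the vertices `v η` of the faces. -/
abbrev Decomposition (g : Laurent n R) (h : Face f l → Laurent n R) (b : Fin n → ℤ)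
    (v : Face f l → Fin n → ℤ) : Type _ :=
  QQuot p g b (mu_mono f (Nat.sub_le l 1)) ≃ₗ[R]
    ⨁ η : Face f l, Q p (h η) (v η) (interiorOf (restrict f η.1))

variable {p f l} in
/-- The image in the summand of the face `η` of an element of `Q_g(μ^{(l)})`. -/
def Decomposition.component {g : Laurent n R} {h : Face f l → Laurent n R} {b : Fin n → ℤ}
    {v : Face f l → Fin n → ℤ} (e : Decomposition p f l g h b v) (q : Q p g b (mu f l))
    (η : Face f l) : Q p (h η) (v η) (interiorOf (restrict f η.1)) :=
  (e (Submodule.Quotient.mk q)) η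

open Classical in
/-- The isomorphism `e` maps the class of `ω_u` to the class of `ω_u` in the summand of `η`, for
every codimension `l` face `η` and every lattice point `u` of `η°`. -/
def IsStandard {g : Laurent n R} {h : Face f l → Laurent n R} {b : Fin n → ℤ}
    {v : Face f l → Fin n → ℤ} (e : Decomposition p f l g h b v) : Prop :=
  ∀ (η : Face f l) (u : Fin n → ℤ) (hu : toReal u ∈ interiorOf (restrict f η.1))
    (hu' : toReal u ∈ mu f l),
    e (Submodule.Quotient.mk (omegaClass p g b (mu f l) hu')) =
      DirectSum.lof R (Face f l) (fun η => Q p (h η) (v η) (interiorOf (restrict f η.1))) η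
        (omegaClass p (h η) (v η) (interiorOf (restrict f η.1)) hu)

end Decomposition

end UnitRoot

end

noncomputable section

namespace UnitRoot

/-! ### Faces of polytopes -/

section Faces

variable {n : ℕ}

/-! The combinatorial core is that the lattice points of `μ^{(l)}` outside `μ^{(l-1)}` are
partitioned by the interiors of the faces `η` of codimension `l`. If `a ∈ NΔ`, `b ∈ MΔ` and `a + b ∈
(N+M)η`, then `a ∈ Nη` and `b ∈ Mη` (`InDil.left_of_add`). Hence passing to the part supported on
the dilated face is multiplicative (`IsInit.mul`). Applied to `f^(p-1)`, this makes the Hasse–Witt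
matrix block triangular, with the Hasse–Witt matrices of `μ^{(l-1)}` and of the `f|_η` as diagonal
blocks, which is the first assertion.

For the second assertion, rational functions are lifted to chains: finite combinations of symbols
`(m, u)` standing for `(m-1)! x^u / g^m`. From `g^σ(x^p) = g^p + pG` and the binomial series, the
Cartier operator becomes an explicit operator on chains with coefficients `(m-1)!/(⌈m/p⌉-1)! ·
p^r/r!`. These tend to zero because `p > 2`. Modulo `p` its image has pole order one, and there it
acts by the Hasse–Witt matrix.

A series supported in the cone is a formal derivative exactly when its coefficients at `p^s k` are
divisible by `p^s` for all `s` (`mem_formalDerivatives_iff`). Through the Cartier operator this says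
that the `i`-th iterate is divisible by `p^i` on chains (`isFormalUpTo_iff`), a condition in which
the vertex no longer occurs. If the Hasse–Witt matrix is invertible, successive approximation then
shows that the `ω_u`, for lattice points `u` of `μ`, form a basis of `Q_g(μ)` (`latHat_mem_U`,
`exists_latHat_sub_mem_U`).

The map to the summand of `η` discards the symbols lying off the cone over `η`. By multiplicativity
of initial parts it respects the relations between rational functions
(`chainForm_faceChain_eq_zero`) and commutes with the Cartier operator and with derivations. By the
vertex-free criterion it preserves formal derivatives (`IsFaceMap.mem_U`). It kills
`Q_f(μ^{(l-1)})`, and comparing bases shows that the induced map on the quotient is bijective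
(`exists_decomposition`). -/

theorem toReal_add (a b : Fin n → ℤ) : toReal (a + b) = toReal a + toReal b := by
  funext i; simp [toReal]

theorem toReal_zero : toReal (0 : Fin n → ℤ) = 0 := by
  funext i; simp [toReal]

theorem toReal_zsmul (m : ℤ) (a : Fin n → ℤ) : toReal (m • a) = (m : ℝ) • toReal a := by
  funext i; simp [toReal]

theorem toReal_injective : Function.Injective (toReal : (Fin n → ℤ) → Fin n → ℝ) := by
  intro a b h
  funext i
  simpa [toReal] using congrFun h i

/-- A convex combination with positive weights can attain the maximum `K` of `L` only if both of its
endpoints do. -/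
theorem mem_convexHull_of_forall_le {E : Type*} [AddCommGroup E] [Module ℝ E] {S : Set E}
    (L : E →ₗ[ℝ] ℝ) {K : ℝ} (hS : ∀ s ∈ S, L s ≤ K) {x : E} (hx : x ∈ convexHull ℝ S)
    (hK : K ≤ L x) : x ∈ convexHull ℝ {s ∈ S | L s = K} := by
  -- The bound `L x ≤ K` is carried along with the implication, since it is what forces both
  -- endpoints of a maximizing combination to be maximizers.
  have key : convexHull ℝ S ⊆ {x | L x ≤ K ∧ (K ≤ L x → x ∈ convexHull ℝ {s ∈ S | L s = K})} := by
    refine convexHull_min (fun s hs => ⟨hS s hs, fun h =>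
      subset_convexHull ℝ _ ⟨hs, le_antisymm (hS s hs) h⟩⟩) ?_
    rintro x ⟨hx, hx'⟩ y ⟨hy, hy'⟩ a b ha hb hab
    have e : L (a • x + b • y) = a * L x + b * L y := by simp
    have hle : a * L x + b * L y ≤ K := by
      calc a * L x + b * L y ≤ a * K + b * K := by gcongr
        _ = K := by rw [← add_mul, hab, one_mul]
    refine ⟨e ▸ hle, fun h => ?_⟩
    rw [e] at h
    rcases ha.eq_or_lt with rfl | ha
    · rw [zero_add] at hab; subst hab
      simpa using hy' (by simpa using h)
    rcases hb.eq_or_lt with rfl | hb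
    · rw [add_zero] at hab; subst hab
      simpa using hx' (by simpa using h)
    have hKK : K = a * K + b * K := by rw [← add_mul, hab, one_mul]
    have h1 : K ≤ L x := by
      by_contra hlt
      push Not at hlt
      have := mul_lt_mul_of_pos_left hlt ha
      have := mul_le_mul_of_nonneg_left hy hb.le
      linarith
    have h2 : K ≤ L y := by
      by_contra hlt
      push Not at hlt
      have := mul_lt_mul_of_pos_left hlt hb
      have := mul_le_mul_of_nonneg_left hx ha.le
      linarith
    exact (convex_convexHull ℝ _) (hx' h1) (hy' h2) ha.le hb.le hab
  exact (key hx).2 hK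

variable {Δ η ζ : Set (Fin n → ℝ)}

theorem IsFace.subset (h : IsFace Δ η) : η ⊆ Δ := h.1.subset

theorem IsFace.convex (h : IsFace Δ η) (hΔ : Convex ℝ Δ) : Convex ℝ η := h.1.convex hΔ

/-- A face is cut out by a linear functional. -/
theorem IsFace.exists_functional (h : IsFace Δ η) :
    ∃ (L : StrongDual ℝ (Fin n → ℝ)) (c : ℝ), (∀ x ∈ Δ, L x ≤ c) ∧ ∀ x ∈ Δ, x ∈ η ↔ L x = c := by
  obtain ⟨L, hL⟩ := h.1 h.2
  obtain ⟨y, hy⟩ := h.2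
  have hy' : y ∈ Δ ∧ ∀ z ∈ Δ, L z ≤ L y := by rw [hL] at hy; exact hy
  refine ⟨L, L y, hy'.2, fun x hx => ⟨fun hxη => ?_, fun hxy => ?_⟩⟩
  · rw [hL] at hxη
    exact le_antisymm (hy'.2 x hx) (hxη.2 y hy'.1)
  · rw [hL]
    exact ⟨hx, fun z hz => hxy ▸ hy'.2 z hz⟩

theorem isFace_of_functional (hη : η.Nonempty) (hsub : η ⊆ Δ) (L : StrongDual ℝ (Fin n → ℝ))
    (c : ℝ) (hle : ∀ x ∈ Δ, L x ≤ c) (hiff : ∀ x ∈ Δ, x ∈ η ↔ L x = c) : IsFace Δ η := by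
  refine ⟨fun _ => ⟨L, ?_⟩, hη⟩
  obtain ⟨y, hy⟩ := hη
  ext x
  refine ⟨fun hx => ⟨hsub hx, fun z hz => ?_⟩, fun hx => ?_⟩
  · rw [(hiff x (hsub hx)).1 hx]; exact hle z hz
  · refine (hiff x hx.1).2 (le_antisymm (hle x hx.1) ?_)
    rw [← (hiff y (hsub hy)).1 hy]
    exact hx.2 y (hsub hy)

/-- A face of a polytope is the convex hull of the generators which it contains. -/
theorem IsFace.convexHull_inter {S : Set (Fin n → ℝ)} (h : IsFace (convexHull ℝ S) η) :
    convexHull ℝ (S ∩ η) = η := by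
  refine (convexHull_min Set.inter_subset_right (h.convex (convex_convexHull ℝ S))).antisymm ?_
  obtain ⟨L, c, hle, hiff⟩ := h.exists_functional
  intro x hx
  have := mem_convexHull_of_forall_le L.toLinearMap
    (fun s hs => hle s (subset_convexHull ℝ S hs)) (h.subset hx)
    ((hiff x (h.subset hx)).1 hx).ge
  refine convexHull_mono ?_ this
  rintro s ⟨hs, hsc⟩
  exact ⟨hs, (hiff s (subset_convexHull ℝ S hs)).2 hsc⟩

theorem IsFace.inter (h : IsFace Δ η) (h' : IsFace Δ ζ) (hne : (η ∩ ζ).Nonempty) :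
    IsFace Δ (η ∩ ζ) := ⟨h.1.inter h'.1, hne⟩

theorem IsFace.mono {Δ' : Set (Fin n → ℝ)} (h : IsFace Δ η) (h1 : Δ' ⊆ Δ) (h2 : η ⊆ Δ') :
    IsFace Δ' η := ⟨h.1.mono h1 h2, h.2⟩

/-- A face of a face of a polytope is a face. -/
theorem IsFace.trans {S : Set (Fin n → ℝ)} (hS : S.Finite) (h : IsFace (convexHull ℝ S) η)
    (h' : IsFace η ζ) : IsFace (convexHull ℝ S) ζ := by
  obtain ⟨L₁, c₁, hle₁, hiff₁⟩ := h.exists_functional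
  obtain ⟨L₂, c₂, hle₂, hiff₂⟩ := h'.exists_functional
  have hsub := subset_convexHull ℝ S
  -- On the finitely many generators off `η` the functional `L₁` stays strictly below `c₁`, so a
  -- large multiple of it outweighs `L₂` there. Then `t L₁ + L₂` is maximal exactly on `ζ`.
  obtain ⟨t, ht⟩ : ∃ t : ℝ, ∀ s ∈ S, s ∉ η → t * L₁ s + L₂ s < t * c₁ + c₂ := by
    obtain ⟨t, ht⟩ := (hS.image fun s => (L₂ s - c₂) / (c₁ - L₁ s)).bddAbove
    refine ⟨t + 1, fun s hs hsη => ?_⟩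
    have h1 : L₁ s < c₁ :=
      lt_of_le_of_ne (hle₁ s (hsub hs)) fun e => hsη ((hiff₁ s (hsub hs)).2 e)
    have h2 := ht ⟨s, hs, rfl⟩
    have h3 : (L₂ s - c₂) / (c₁ - L₁ s) < t + 1 := by
      change (L₂ s - c₂) / (c₁ - L₁ s) ≤ t at h2
      linarith
    rw [div_lt_iff₀ (sub_pos.2 h1)] at h3
    linarith
  set L : StrongDual ℝ (Fin n → ℝ) := t • L₁ + L₂ with hL
  have hLx : ∀ x, L x = t * L₁ x + L₂ x := fun x => by simp [hL]
  have hS1 : ∀ s ∈ S, L s ≤ t * c₁ + c₂ := by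
    intro s hs
    by_cases hsη : s ∈ η
    · rw [hLx, (hiff₁ s (hsub hs)).1 hsη]
      linarith [hle₂ s hsη]
    · rw [hLx]; exact (ht s hs hsη).le
  have hle : ∀ x ∈ convexHull ℝ S, L x ≤ t * c₁ + c₂ := fun x hx =>
    convexHull_min (t := {x | L x ≤ t * c₁ + c₂}) hS1
      (convex_halfSpace_le L.toLinearMap.isLinear _) hx
  have hsubζ : ζ ⊆ convexHull ℝ S := h'.subset.trans h.subset
  refine isFace_of_functional h'.2 hsubζ L (t * c₁ + c₂) hle fun x hx => ⟨fun hxζ => ?_, fun e => ?_⟩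
  · rw [hLx, (hiff₁ x hx).1 (h'.subset hxζ), (hiff₂ x (h'.subset hxζ)).1 hxζ]
  · have h1 := mem_convexHull_of_forall_le L.toLinearMap hS1 hx e.ge
    refine convexHull_min ?_ (h'.convex (h.convex (convex_convexHull ℝ S))) h1
    rintro s ⟨hs, hse⟩
    have hsη : s ∈ η := by
      by_contra hsη
      have := ht s hs hsη
      rw [← hLx] at this
      exact this.ne hse
    refine (hiff₂ s hsη).2 ?_
    change L s = _ at hse
    rw [hLx, (hiff₁ s (hsub hs)).1 hsη] at hse
    linarith

theorem polyDim_mono (h : η ⊆ ζ) : polyDim η ≤ polyDim ζ :=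
  Submodule.finrank_mono (vectorSpan_mono ℝ h)

/-- A proper face has smaller dimension. -/
theorem IsFace.eq_of_polyDim_le (h : IsFace Δ η) (hd : polyDim Δ ≤ polyDim η) : η = Δ := by
  refine h.subset.antisymm fun y hy => ?_
  obtain ⟨L, c, hle, hiff⟩ := h.exists_functional
  obtain ⟨x, hx⟩ := h.2
  have hspan : vectorSpan ℝ η = vectorSpan ℝ Δ :=
    Submodule.eq_of_le_of_finrank_le (vectorSpan_mono ℝ h.subset) hd
  have h1 : y - x ∈ vectorSpan ℝ η := hspan ▸ vsub_mem_vectorSpan ℝ hy (h.subset hx)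
  -- The functional cutting out `η` is constant on `η`, so it kills the common direction space and
  -- is constant on `Δ` as well.
  have h2 : vectorSpan ℝ η ≤ LinearMap.ker L.toLinearMap := by
    refine Submodule.span_le.2 ?_
    rintro _ ⟨a, ha, b, hb, rfl⟩
    change L (a - b) = 0
    rw [map_sub, (hiff a (h.subset ha)).1 ha, (hiff b (h.subset hb)).1 hb, sub_self]
  have h3 : L (y - x) = 0 := h2 h1
  rw [map_sub, (hiff x (h.subset hx)).1 hx, sub_eq_zero] at h3
  exact (hiff y hy).2 h3

theorem faceFiltration_subset (Δ : Set (Fin n → ℝ)) (l : ℕ) : faceFiltration Δ l ⊆ Δ :=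
  fun _ h => h.1

/-- The points of `μ^{(l)}` on a face of codimension `l` are the interior points of the face. -/
theorem faceFiltration_inter {S : Set (Fin n → ℝ)} (hS : S.Finite) {l : ℕ}
    (h : IsFace (convexHull ℝ S) η) (hd : polyDim η + l = polyDim (convexHull ℝ S)) :
    faceFiltration (convexHull ℝ S) l ∩ η = faceFiltration η 0 := by
  ext x
  constructor
  · rintro ⟨⟨hx, hx'⟩, hxη⟩
    refine ⟨hxη, fun ζ hζ hxζ => ?_⟩
    have := hx' ζ (h.trans hS hζ) hxζ
    omega
  · rintro ⟨hxη, hx'⟩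
    refine ⟨⟨h.subset hxη, fun ζ hζ hxζ => ?_⟩, hxη⟩
    -- A face `ζ` of `Δ` through `x` meets `η` in a face of `η` through `x`. As `x` is interior to
    -- `η`, this intersection has dimension at least that of `η`.
    have h1 := hx' (η ∩ ζ) ((h.inter hζ ⟨x, hxη, hxζ⟩).mono h.subset Set.inter_subset_left)
      ⟨hxη, hxζ⟩
    have h2 := polyDim_mono (Set.inter_subset_right : η ∩ ζ ⊆ ζ)
    omega

theorem faceFiltration_inter_eq_empty {l : ℕ} (h : IsFace Δ η) (hl : 1 ≤ l)
    (hd : polyDim η + l = polyDim Δ) : faceFiltration Δ (l - 1) ∩ η = ∅ := by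
  ext x
  simp only [Set.mem_inter_iff, Set.mem_empty_iff_false, iff_false, not_and]
  intro hx hxη
  have := hx.2 η h hxη
  omega

theorem exists_face_of_mem_faceFiltration {l : ℕ} {x : Fin n → ℝ}
    (hx : x ∈ faceFiltration Δ l) (hx' : x ∉ faceFiltration Δ (l - 1)) :
    ∃ η, IsFace Δ η ∧ polyDim η + l = polyDim Δ ∧ x ∈ η := by
  have : ¬ ∀ η, IsFace Δ η → x ∈ η → polyDim Δ ≤ polyDim η + (l - 1) := fun h => hx' ⟨hx.1, h⟩
  push Not at this
  obtain ⟨η, hη, hxη, hlt⟩ := this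
  have h1 := hx.2 η hη hxη
  have h2 := polyDim_mono hη.subset
  exact ⟨η, hη, by omega, hxη⟩

/-- An interior point of a face does not lie on another face of the same dimension. -/
theorem IsFace.eq_of_mem {x : Fin n → ℝ} (h : IsFace Δ η) (h' : IsFace Δ ζ)
    (hd : polyDim η = polyDim ζ) (hx : x ∈ faceFiltration η 0) (hxζ : x ∈ ζ) : η = ζ := by
  have hi := h.inter h' ⟨x, hx.1, hxζ⟩
  have h1 := hi.mono h.subset Set.inter_subset_left
  have h2 := hi.mono h'.subset Set.inter_subset_right
  have h3 : polyDim η ≤ polyDim (η ∩ ζ) := hx.2 _ h1 ⟨hx.1, hxζ⟩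
  rw [← h1.eq_of_polyDim_le h3, h2.eq_of_polyDim_le (hd ▸ h3)]

/-- `μ` is a subset of `Δ` which is stable under proper convex combinations with points
of `Δ`. -/
def Absorbs (Δ μ : Set (Fin n → ℝ)) : Prop :=
  μ ⊆ Δ ∧ ∀ y ∈ μ, ∀ z ∈ Δ, ∀ s t : ℝ, 0 < s → 0 ≤ t → s + t = 1 → s • y + t • z ∈ μ

/-- A face containing a combination with positive weight at `y` contains `y`, so it is one of the
faces already controlled at `y`. This makes the cone over `μ^{(l)}` stable under adding points of
the cone over `Δ`, so that multiplying numerators by `f` or by its derivatives does not leave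
`μ^{(l)}`. -/
theorem absorbs_faceFiltration (hΔ : Convex ℝ Δ) (l : ℕ) : Absorbs Δ (faceFiltration Δ l) := by
  refine ⟨faceFiltration_subset Δ l, fun y hy z hz s t hs ht hst => ?_⟩
  refine ⟨hΔ hy.1 hz hs.le ht hst, fun η hη hxη => hy.2 η hη ?_⟩
  obtain ⟨L, c, hle, hiff⟩ := hη.exists_functional
  rw [hiff _ (hη.subset hxη)] at hxη
  refine (hiff y hy.1).2 (le_antisymm (hle y hy.1) ?_)
  by_contra hlt
  push Not at hlt
  have h1 := mul_lt_mul_of_pos_left hlt hs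
  have h2 := mul_le_mul_of_nonneg_left (hle z hz) ht
  rw [map_add, map_smul, map_smul, smul_eq_mul, smul_eq_mul] at hxη
  have : c = s * c + t * c := by rw [← add_mul, hst, one_mul]
  linarith

end Faces

/-! ### Newton polytopes of restrictions and twists -/

variable {n : ℕ} {R : Type*} [CommRing R]

theorem finite_toReal_support (f : Laurent n R) :
    (toReal '' (f.coeff.support : Set (Fin n → ℤ))).Finite :=
  (Finset.finite_toSet _).image _

theorem convex_newtonPolytope (f : Laurent n R) : Convex ℝ (newtonPolytope f) :=
  convex_convexHull ℝ _

theorem mem_newtonPolytope {f : Laurent n R} {a : Fin n → ℤ} (h : f.coeff a ≠ 0) :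
    toReal a ∈ newtonPolytope f :=
  subset_convexHull ℝ _ ⟨a, Finsupp.mem_support_iff.2 h, rfl⟩

open Classical in
theorem coeff_restrict (f : Laurent n R) (η : Set (Fin n → ℝ)) (a : Fin n → ℤ) :
    (restrict f η).coeff a = if toReal a ∈ η then f.coeff a else 0 :=
  Finsupp.filter_apply _ _ _

theorem coeff_twist (σ : R →+* R) (f : Laurent n R) (a : Fin n → ℤ) :
    (twist σ f).coeff a = σ (f.coeff a) := by
  simp [twist]

theorem newtonPolytope_restrict {f : Laurent n R} {η : Set (Fin n → ℝ)}
    (h : IsFace (newtonPolytope f) η) : newtonPolytope (restrict f η) = η := by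
  classical
  refine Eq.trans ?_ h.convexHull_inter
  rw [newtonPolytope]
  congr 1
  ext x
  constructor
  · rintro ⟨a, ha, rfl⟩
    have ha' : (restrict f η).coeff a ≠ 0 := Finsupp.mem_support_iff.1 ha
    rw [coeff_restrict] at ha'
    have hη : toReal a ∈ η := by by_contra hn; simp [hn] at ha'
    rw [if_pos hη] at ha'
    exact ⟨⟨a, Finsupp.mem_support_iff.2 ha', rfl⟩, hη⟩
  · rintro ⟨⟨a, ha, rfl⟩, hx⟩
    refine ⟨a, Finsupp.mem_support_iff.2 ?_, rfl⟩
    rw [coeff_restrict, if_pos hx]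
    exact Finsupp.mem_support_iff.1 ha

/-- The coefficients of `f` at the vertices of its Newton polytope are units. -/
def UnitVertices (f : Laurent n R) : Prop := ∀ b, IsVertex f b → IsUnit (f.coeff b)

/-- A ring endomorphism may kill coefficients of `f`, but not the units at the vertices, and by
Krein–Milman the vertices already span the polytope. -/
theorem newtonPolytope_twist [Nontrivial R] {f : Laurent n R} (hf : UnitVertices f)
    (σ : R →+* R) : newtonPolytope (twist σ f) = newtonPolytope f := by
  apply Set.Subset.antisymm
  · refine convexHull_mono (Set.image_mono fun a ha => ?_)
    refine Finsupp.mem_support_iff.2 fun h => Finsupp.mem_support_iff.1 ha ?_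
    rw [coeff_twist, h, map_zero]
  · have h1 := closure_convexHull_extremePoints
      ((finite_toReal_support f).isCompact_convexHull ℝ) (convex_convexHull ℝ _)
    have h2 : IsClosed (newtonPolytope (twist σ f)) :=
      ((finite_toReal_support _).isCompact_convexHull ℝ).isClosed
    change closure (convexHull ℝ (Set.extremePoints ℝ (newtonPolytope f))) = newtonPolytope f at h1
    rw [← h1]
    refine closure_minimal (convexHull_min ?_ (convex_newtonPolytope _)) h2
    intro x hx
    obtain ⟨a, ha, rfl⟩ := extremePoints_convexHull_subset hx
    refine mem_newtonPolytope ?_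
    rw [coeff_twist]
    exact ((hf a hx).map σ).ne_zero

theorem UnitVertices.twist [Nontrivial R] {f : Laurent n R} (hf : UnitVertices f) (σ : R →+* R) :
    UnitVertices (twist σ f) := by
  intro b hb
  rw [IsVertex, newtonPolytope_twist hf] at hb
  rw [coeff_twist]
  exact (hf b hb).map σ

theorem UnitVertices.restrict {f : Laurent n R} (hf : UnitVertices f) {η : Set (Fin n → ℝ)}
    (h : IsFace (newtonPolytope f) η) : UnitVertices (restrict f η) := by
  classical
  intro b hb
  rw [IsVertex, newtonPolytope_restrict h] at hb
  rw [coeff_restrict, if_pos hb.1]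
  exact hf b (h.1.isExtreme.extremePoints_subset_extremePoints hb)

/-- A face is determined by the support points which it contains. -/
instance finite_face (f : Laurent n R) (l : ℕ) : Finite (Face f l) := by
  have := (finite_toReal_support f).powerset.to_subtype
  refine Finite.of_injective (fun η : Face f l =>
    (⟨(toReal '' (f.coeff.support : Set (Fin n → ℤ))) ∩ η.1, Set.inter_subset_left⟩ :
      Set.powerset (toReal '' (f.coeff.support : Set (Fin n → ℤ))))) ?_
  intro η ζ h
  apply Subtype.ext
  rw [← η.2.1.convexHull_inter, ← ζ.2.1.convexHull_inter]
  exact congrArg (convexHull ℝ) (congrArg Subtype.val h)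

end UnitRoot

namespace UnitRoot

/-! ### Dilated supports and initial parts of Laurent polynomials -/

section Dilation

variable {n : ℕ} {Δ η : Set (Fin n → ℝ)}

/-- `a` is a lattice point of the dilation `N S`. -/
def InDil (N : ℕ) (S : Set (Fin n → ℝ)) (a : Fin n → ℤ) : Prop :=
  ∃ y ∈ S, toReal a = (N : ℝ) • y

theorem InDil.mono {N : ℕ} {S T : Set (Fin n → ℝ)} {a : Fin n → ℤ} (h : InDil N S a)
    (hST : S ⊆ T) : InDil N T a := by
  obtain ⟨y, hy, e⟩ := h
  exact ⟨y, hST hy, e⟩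

theorem inDil_one {S : Set (Fin n → ℝ)} {a : Fin n → ℤ} : InDil 1 S a ↔ toReal a ∈ S := by
  constructor
  · rintro ⟨y, hy, e⟩
    rw [Nat.cast_one, one_smul] at e
    rwa [e]
  · exact fun h => ⟨_, h, by simp⟩

theorem inDil_zero (hS : Δ.Nonempty) : InDil 0 Δ (0 : Fin n → ℤ) := by
  obtain ⟨y, hy⟩ := hS
  exact ⟨y, hy, by simp [toReal_zero]⟩

theorem InDil.eq_zero {a : Fin n → ℤ} (h : InDil 0 Δ a) : a = 0 := by
  obtain ⟨y, -, e⟩ := h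
  apply toReal_injective
  rw [e, toReal_zero]; simp

/-- The sum `N y + M z` is `N + M` times a weighted average of `y` and `z`. The weight of `y` must
be positive, whence `1 ≤ N`. -/
theorem InDil.add_of_absorbs {μ : Set (Fin n → ℝ)} (hμ : Absorbs Δ μ) {N M : ℕ} (hN : 1 ≤ N)
    {a b : Fin n → ℤ} (ha : InDil N μ a) (hb : InDil M Δ b) : InDil (N + M) μ (a + b) := by
  obtain ⟨y, hy, ha⟩ := ha
  obtain ⟨z, hz, hb⟩ := hb
  have hN' : (0 : ℝ) < N := by exact_mod_cast hN
  have hM' : (0 : ℝ) ≤ M := Nat.cast_nonneg M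
  refine ⟨_, hμ.2 y hy z hz ((N : ℝ) / (N + M)) ((M : ℝ) / (N + M)) (by positivity) (by positivity)
    (by field_simp), ?_⟩
  rw [toReal_add, ha, hb, smul_add, smul_smul, smul_smul]
  push_cast
  rw [mul_div_cancel₀ _ (by positivity), mul_div_cancel₀ _ (by positivity)]

theorem absorbs_self (hΔ : Convex ℝ Δ) : Absorbs Δ Δ :=
  ⟨subset_rfl, fun _ hy _ hz _ _ hs ht hst => hΔ hy hz hs.le ht hst⟩

theorem InDil.add (hΔ : Convex ℝ Δ) {N M : ℕ} {a b : Fin n → ℤ} (ha : InDil N Δ a)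
    (hb : InDil M Δ b) : InDil (N + M) Δ (a + b) := by
  rcases Nat.eq_zero_or_pos N with rfl | hN
  · rw [ha.eq_zero]; simpa using hb
  · exact ha.add_of_absorbs (absorbs_self hΔ) hN hb

theorem InDil.zsmul_iff {p : ℕ} (hp : p ≠ 0) {N : ℕ} {S : Set (Fin n → ℝ)} {a : Fin n → ℤ} :
    InDil (p * N) S ((p : ℤ) • a) ↔ InDil N S a := by
  have hp' : (p : ℝ) ≠ 0 := by exact_mod_cast hp
  refine exists_congr fun y => and_congr_right fun _ => ?_
  rw [toReal_zsmul]
  push_cast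
  rw [mul_smul]
  exact ⟨fun h => smul_right_injective _ hp' h, fun h => by rw [h]⟩

/-- The point `(a + b)/(N + M)` lies on the open segment from `a/N` to `b/M`, and `η` is extreme. If
`N` or `M` is zero there is no such segment, and the corresponding summand is the origin. -/
theorem InDil.left_of_add (hη : IsExtreme ℝ Δ η) {N M : ℕ} {a b : Fin n → ℤ} (ha : InDil N Δ a)
    (hb : InDil M Δ b) (h : InDil (N + M) η (a + b)) : InDil N η a := by
  rcases Nat.eq_zero_or_pos N with rfl | hN
  · obtain ⟨y, hy, -⟩ := h
    rw [ha.eq_zero]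
    exact inDil_zero ⟨y, hy⟩
  rcases Nat.eq_zero_or_pos M with rfl | hM
  · rw [hb.eq_zero, add_zero, add_zero] at h
    exact h
  obtain ⟨y, hy, ha⟩ := ha
  obtain ⟨z, hz, hb⟩ := hb
  obtain ⟨w, hw, h⟩ := h
  refine ⟨y, hη.left_mem_of_mem_openSegment hy hz hw ?_, ha⟩
  have hN' : (0 : ℝ) < N := by exact_mod_cast hN
  have hM' : (0 : ℝ) < M := by exact_mod_cast hM
  refine ⟨(N : ℝ) / (N + M), (M : ℝ) / (N + M), by positivity, by positivity, by field_simp, ?_⟩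
  have h0 : ((N : ℝ) + M) ≠ 0 := by positivity
  apply smul_right_injective _ h0
  change ((N : ℝ) + M) • _ = ((N : ℝ) + M) • w
  rw [toReal_add, ha, hb] at h
  push_cast at h
  rw [← h, smul_add, smul_smul, smul_smul, mul_div_cancel₀ _ h0, mul_div_cancel₀ _ h0]

end Dilation

variable {n : ℕ} {R : Type*} [CommRing R] {Δ η : Set (Fin n → ℝ)}

/-- The support of `P` is contained in `N Δ`. -/
def SuppIn (N : ℕ) (Δ : Set (Fin n → ℝ)) (P : Laurent n R) : Prop :=
  ∀ a, P.coeff a ≠ 0 → InDil N Δ a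

theorem exists_of_coeff_mul_ne_zero {P Q : Laurent n R} {k : Fin n → ℤ}
    (h : (P * Q).coeff k ≠ 0) : ∃ a b, a + b = k ∧ P.coeff a ≠ 0 ∧ Q.coeff b ≠ 0 := by
  classical
  rw [AddMonoidAlgebra.coeff_mul] at h
  obtain ⟨a, ha, h⟩ := Finset.exists_ne_zero_of_sum_ne_zero h
  obtain ⟨b, hb, h⟩ := Finset.exists_ne_zero_of_sum_ne_zero h
  refine ⟨a, b, ?_, Finsupp.mem_support_iff.1 ha, Finsupp.mem_support_iff.1 hb⟩
  by_contra hab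
  exact h (if_neg hab)

theorem SuppIn.mul (hΔ : Convex ℝ Δ) {N M : ℕ} {P Q : Laurent n R} (hP : SuppIn N Δ P)
    (hQ : SuppIn M Δ Q) : SuppIn (N + M) Δ (P * Q) := by
  intro k hk
  obtain ⟨a, b, rfl, ha, hb⟩ := exists_of_coeff_mul_ne_zero hk
  exact (hP a ha).add hΔ (hQ b hb)

theorem SuppIn.mul_absorbs {μ : Set (Fin n → ℝ)} (hμ : Absorbs Δ μ) {N M : ℕ} (hN : 1 ≤ N)
    {P Q : Laurent n R} (hP : SuppIn N μ P) (hQ : SuppIn M Δ Q) : SuppIn (N + M) μ (P * Q) := by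
  intro k hk
  obtain ⟨a, b, rfl, ha, hb⟩ := exists_of_coeff_mul_ne_zero hk
  exact (hP a ha).add_of_absorbs hμ hN (hQ b hb)

theorem suppIn_single {N : ℕ} {u : Fin n → ℤ} (hu : InDil N Δ u) (c : R) :
    SuppIn N Δ (AddMonoidAlgebra.single u c : Laurent n R) := by
  intro a ha
  rw [AddMonoidAlgebra.coeff_single] at ha
  have : a = u := by
    by_contra h
    exact ha (Finsupp.single_eq_of_ne h)
  rwa [this]

theorem suppIn_one (hΔ : Δ.Nonempty) : SuppIn 0 Δ (1 : Laurent n R) :=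
  suppIn_single (inDil_zero hΔ) 1

theorem SuppIn.pow (hΔ : Convex ℝ Δ) (hne : Δ.Nonempty) {N : ℕ} {P : Laurent n R}
    (hP : SuppIn N Δ P) (j : ℕ) : SuppIn (j * N) Δ (P ^ j) := by
  induction j with
  | zero => simpa using suppIn_one hne
  | succ j ih => rw [pow_succ, Nat.add_one_mul]; exact ih.mul hΔ hP

theorem suppIn_newtonPolytope (f : Laurent n R) : SuppIn 1 (newtonPolytope f) f := fun _ ha =>
  inDil_one.2 (mem_newtonPolytope ha)

theorem SuppIn.add {N : ℕ} {P Q : Laurent n R} (hP : SuppIn N Δ P) (hQ : SuppIn N Δ Q) :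
    SuppIn N Δ (P + Q) := by
  intro a ha
  by_cases h : P.coeff a = 0
  · refine hQ a fun h' => ha ?_
    rw [AddMonoidAlgebra.coeff_add, Finsupp.add_apply, h, h', add_zero]
  · exact hP a h

theorem SuppIn.twist {N : ℕ} {P : Laurent n R} (hP : SuppIn N Δ P) (σ : R →+* R) :
    SuppIn N Δ (twist σ P) := by
  intro a ha
  rw [coeff_twist] at ha
  exact hP a fun h => ha (by rw [h, map_zero])

/-- `P` is supported in `N Δ`, and `P'` is its part on `N η`. -/
structure IsInit (Δ η : Set (Fin n → ℝ)) (N : ℕ) (P P' : Laurent n R) : Prop where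
  supp : SuppIn N Δ P
  supp' : SuppIn N η P'
  coeff_eq : ∀ a, InDil N η a → P.coeff a = P'.coeff a

/-- A pair of exponents with sum in `(N+M)η` has its members in `Nη` and `Mη` separately, so on
`(N+M)η` the product only sees the parts of the factors on the face. -/
theorem IsInit.mul (hΔ : Convex ℝ Δ) (hη : IsExtreme ℝ Δ η) (hη' : Convex ℝ η) {N M : ℕ}
    {P P' Q Q' : Laurent n R} (hP : IsInit Δ η N P P') (hQ : IsInit Δ η M Q Q') :
    IsInit Δ η (N + M) (P * Q) (P' * Q') := by
  refine ⟨hP.supp.mul hΔ hQ.supp, hP.supp'.mul hη' hQ.supp', fun a ha => ?_⟩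
  have key : ∀ {N M : ℕ} {P P' Q : Laurent n R}, IsInit Δ η N P P' → SuppIn M Δ Q →
      InDil (N + M) η a → ((P - P') * Q).coeff a = 0 := by
    intro N M P P' Q hP hQ ha
    by_contra h
    obtain ⟨c, d, rfl, hc, hd⟩ := exists_of_coeff_mul_ne_zero h
    rw [AddMonoidAlgebra.coeff_sub, Finsupp.sub_apply] at hc
    have h1 : InDil N Δ c := by
      by_cases h0 : P.coeff c = 0
      · exact (hP.supp' c fun h' => hc (by rw [h0, h', sub_zero])).mono hη.1
      · exact hP.supp c h0
    exact hc (sub_eq_zero.2 (hP.coeff_eq c (h1.left_of_add hη (hQ d hd) ha)))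
  have h1 := key hP hQ.supp ha
  have h2 := key hQ (M := N) (Q := P') (fun c hc => (hP.supp' c hc).mono hη.1)
    (by rwa [add_comm])
  have e : P * Q = P' * Q' + ((P - P') * Q + (Q - Q') * P') := by ring
  rw [e, AddMonoidAlgebra.coeff_add, AddMonoidAlgebra.coeff_add, Finsupp.add_apply,
    Finsupp.add_apply, h1, h2, add_zero, add_zero]

theorem IsInit.single {N : ℕ} {u : Fin n → ℤ} (hηΔ : η ⊆ Δ) (hu : InDil N η u) (c : R) :
    IsInit Δ η N (AddMonoidAlgebra.single u c : Laurent n R) (AddMonoidAlgebra.single u c) :=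
  ⟨suppIn_single (hu.mono hηΔ) c, suppIn_single hu c, fun _ _ => rfl⟩

theorem IsInit.single_zero {N : ℕ} {u : Fin n → ℤ} (hu : InDil N Δ u) (hu' : ¬ InDil N η u)
    (c : R) : IsInit Δ η N (AddMonoidAlgebra.single u c : Laurent n R) 0 := by
  refine ⟨suppIn_single hu c, fun a ha => absurd rfl ha, fun a ha => ?_⟩
  have : a ≠ u := fun h => hu' (h ▸ ha)
  rw [AddMonoidAlgebra.coeff_single, Finsupp.single_eq_of_ne this]
  rfl

theorem IsInit.pow (hΔ : Convex ℝ Δ) (hη : IsExtreme ℝ Δ η) (hη' : Convex ℝ η)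
    (hne : η.Nonempty) {N : ℕ} {P P' : Laurent n R} (hP : IsInit Δ η N P P') (j : ℕ) :
    IsInit Δ η (j * N) (P ^ j) (P' ^ j) := by
  induction j with
  | zero =>
    rw [zero_mul, pow_zero, pow_zero, AddMonoidAlgebra.one_def]
    exact IsInit.single hη.1 (inDil_zero hne) 1
  | succ j ih => rw [pow_succ, pow_succ, Nat.add_one_mul]; exact ih.mul hΔ hη hη' hP

theorem IsInit.add {N : ℕ} {P P' Q Q' : Laurent n R} (hP : IsInit Δ η N P P')
    (hQ : IsInit Δ η N Q Q') : IsInit Δ η N (P + Q) (P' + Q') :=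
  ⟨hP.supp.add hQ.supp, hP.supp'.add hQ.supp', fun a ha => by
    rw [AddMonoidAlgebra.coeff_add, AddMonoidAlgebra.coeff_add, Finsupp.add_apply,
      Finsupp.add_apply, hP.coeff_eq a ha, hQ.coeff_eq a ha]⟩

theorem IsInit.zero {N : ℕ} : IsInit Δ η N (0 : Laurent n R) 0 :=
  ⟨fun _ h => absurd rfl h, fun _ h => absurd rfl h, fun _ _ => rfl⟩

theorem IsInit.smul {N : ℕ} {P P' : Laurent n R} (hP : IsInit Δ η N P P') (r : R) :
    IsInit Δ η N (r • P) (r • P') := by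
  refine ⟨fun a ha => hP.supp a fun h => ha ?_, fun a ha => hP.supp' a fun h => ha ?_, fun a ha => ?_⟩
  · rw [AddMonoidAlgebra.coeff_smul, Finsupp.smul_apply, h, smul_zero]
  · rw [AddMonoidAlgebra.coeff_smul, Finsupp.smul_apply, h, smul_zero]
  · rw [AddMonoidAlgebra.coeff_smul, AddMonoidAlgebra.coeff_smul, Finsupp.smul_apply,
      Finsupp.smul_apply, hP.coeff_eq a ha]

theorem IsInit.eq_zero {N : ℕ} {P' : Laurent n R} (hP : IsInit Δ η N 0 P') : P' = 0 := by
  ext a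
  by_contra h
  exact h (hP.coeff_eq a (hP.supp' a h)).symm

theorem IsInit.twist {N : ℕ} {P P' : Laurent n R} (hP : IsInit Δ η N P P') (σ : R →+* R) :
    IsInit Δ η N (twist σ P) (twist σ P') :=
  ⟨hP.supp.twist σ, hP.supp'.twist σ, fun a ha => by
    rw [coeff_twist, coeff_twist, hP.coeff_eq a ha]⟩

theorem isInit_restrict {f : Laurent n R} (h : IsFace (newtonPolytope f) η) :
    IsInit (newtonPolytope f) η 1 f (restrict f η) := by
  classical
  refine ⟨suppIn_newtonPolytope f, fun a ha => ?_, fun a ha => ?_⟩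
  · have := suppIn_newtonPolytope _ a ha
    rwa [newtonPolytope_restrict h] at this
  · rw [coeff_restrict, if_pos (inDil_one.1 ha)]

/-! ### Hasse–Witt matrices of general sets -/

/-- The Hasse–Witt matrix relative to the lattice points of a set `μ`. -/
def hasseWittOn (p : ℕ) (f : Laurent n R) (μ : Set (Fin n → ℝ)) :
    Matrix {u : Fin n → ℤ // toReal u ∈ μ} {u : Fin n → ℤ // toReal u ∈ μ} R :=
  fun u v => (f ^ (p - 1)).coeff ((p : ℤ) • v.1 - u.1)

/-- Entries of the Hasse–Witt matrix in the columns of a face. -/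
theorem coeff_pow_sub_one {p : ℕ} (hp : 1 ≤ p) (hΔ : Convex ℝ Δ) (hη : IsExtreme ℝ Δ η)
    (hη' : Convex ℝ η) {f h : Laurent n R} (hf : IsInit Δ η 1 f h)
    {u v : Fin n → ℤ} (hu : toReal u ∈ Δ) (hv : toReal v ∈ η) :
    (toReal u ∈ η → (f ^ (p - 1)).coeff ((p : ℤ) • v - u) = (h ^ (p - 1)).coeff ((p : ℤ) • v - u)) ∧
      (toReal u ∉ η → (f ^ (p - 1)).coeff ((p : ℤ) • v - u) = 0) := by
  have hinit := hf.pow hΔ hη hη' ⟨_, hv⟩ (p - 1)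
  rw [mul_one] at hinit
  have hpv : InDil p η ((p : ℤ) • v) := ⟨_, hv, by rw [toReal_zsmul]; simp⟩
  have hu1 : InDil 1 Δ u := inDil_one.2 hu
  -- The exponents `u ∈ Δ` and `pv - u ∈ (p-1)Δ` add up to the point `pv` of `pη`, which pushes both
  -- of them onto the face.
  have key : (f ^ (p - 1)).coeff ((p : ℤ) • v - u) ≠ 0 →
      InDil 1 η u ∧ InDil (p - 1) η ((p : ℤ) • v - u) := by
    intro h0
    have h1 := hinit.supp _ h0
    constructor
    · refine hu1.left_of_add hη h1 ?_
      rw [add_sub_cancel, Nat.add_sub_cancel' hp]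
      exact hpv
    · refine h1.left_of_add hη hu1 ?_
      rw [sub_add_cancel, Nat.sub_add_cancel hp]
      exact hpv
  constructor
  · intro _
    by_cases hd : InDil (p - 1) η ((p : ℤ) • v - u)
    · exact hinit.coeff_eq _ hd
    · have h1 : (f ^ (p - 1)).coeff ((p : ℤ) • v - u) = 0 := by
        by_contra h0; exact hd (key h0).2
      have h2 : (h ^ (p - 1)).coeff ((p : ℤ) • v - u) = 0 := by
        by_contra h0; exact hd (hinit.supp' _ h0)
      rw [h1, h2]
  · intro hn
    by_contra h0
    exact hn (inDil_one.1 (key h0).1)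

end UnitRoot

namespace UnitRoot

/-! ### Block triangular shape of the Hasse–Witt matrix -/

variable {n : ℕ} {R : Type*} [CommRing R]

theorem interiorOf_restrict {f : Laurent n R} {l : ℕ} (η : Face f l) :
    interiorOf (restrict f η.1) = mu f l ∩ η.1 := by
  rw [interiorOf, mu, newtonPolytope_restrict η.2.1]
  exact (faceFiltration_inter (finite_toReal_support f) η.2.1 η.2.2).symm

theorem mu_inter_face {f : Laurent n R} {l : ℕ} (hl : 1 ≤ l) (η : Face f l) :
    mu f (l - 1) ∩ η.1 = ∅ :=
  faceFiltration_inter_eq_empty η.2.1 hl η.2.2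

theorem exists_face {f : Laurent n R} {l : ℕ} {x : Fin n → ℝ} (hx : x ∈ mu f l)
    (hx' : x ∉ mu f (l - 1)) : ∃ η : Face f l, x ∈ η.1 := by
  obtain ⟨η, h1, h2, h3⟩ := exists_face_of_mem_faceFiltration hx hx'
  exact ⟨⟨η, h1, h2⟩, h3⟩

theorem Face.eq_of_mem {f : Laurent n R} {l : ℕ} {η ζ : Face f l} {x : Fin n → ℝ}
    (hμ : x ∈ mu f l) (hx : x ∈ η.1) (hx' : x ∈ ζ.1) : η = ζ := by
  have h1 := η.2.2
  have h2 := ζ.2.2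
  refine Subtype.ext (η.2.1.eq_of_mem ζ.2.1 (by omega) (x := x) ?_ hx')
  rw [← faceFiltration_inter (finite_toReal_support f) η.2.1 η.2.2]
  exact ⟨hμ, hx⟩

theorem isUnit_det_iff_of_equiv {A B : Type*} [Fintype A] [DecidableEq A] [Fintype B]
    [DecidableEq B] {M : Matrix A A R} {N : Matrix B B R} (e : A ≃ B)
    (h : ∀ i j, M i j = N (e i) (e j)) : IsUnit M.det ↔ IsUnit N.det := by
  have : M = N.submatrix e e := by ext i j; exact h i j
  rw [this, Matrix.det_submatrix_equiv_self]

/-- The columns of a face `η` vanish outside the rows of `η`. The faces can therefore be numbered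
arbitrarily, while the columns of `μ^{(l-1)}`, on which there is no such restriction, form the last
block `⊤`. The determinant is the product of those of the diagonal blocks. -/
theorem isUnit_hasseWitt_iff {p : ℕ} (hp : 1 ≤ p) (f : Laurent n R) {l : ℕ} (hl : 1 ≤ l) :
    IsUnit (hasseWitt p f l) ↔
      IsUnit (hasseWitt p f (l - 1)) ∧
        ∀ η : Face f l, IsUnit (hasseWitt p (restrict f η.1) 0) := by
  classical
  simp only [Matrix.isUnit_iff_isUnit_det]
  obtain ⟨N, ⟨eN⟩⟩ := Finite.exists_equiv_fin (Face f l)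
  have hface : ∀ u : LatticePoints f l, toReal u.1 ∉ mu f (l - 1) → ∃ η : Face f l,
      toReal u.1 ∈ η.1 := fun u hu => exists_face u.2 hu
  let b : LatticePoints f l → WithTop (Fin N) := fun u =>
    if hu : toReal u.1 ∈ mu f (l - 1) then ⊤ else (eN (hface u hu).choose : WithTop (Fin N))
  have hb_top : ∀ u, b u = ⊤ ↔ toReal u.1 ∈ mu f (l - 1) := by
    intro u
    by_cases hu : toReal u.1 ∈ mu f (l - 1) <;> simp [b, hu]
  have hb_face : ∀ u (η : Face f l), b u = (eN η : WithTop (Fin N)) ↔ toReal u.1 ∈ η.1 := by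
    intro u η
    by_cases hu : toReal u.1 ∈ mu f (l - 1)
    · rw [(hb_top u).2 hu]
      refine ⟨fun h => absurd h (by simp), fun h => ?_⟩
      have : toReal u.1 ∈ mu f (l - 1) ∩ η.1 := ⟨hu, h⟩
      rw [mu_inter_face hl] at this
      exact this.elim
    · have hspec := (hface u hu).choose_spec
      have : b u = (eN (hface u hu).choose : WithTop (Fin N)) := dif_neg hu
      rw [this, WithTop.coe_inj, eN.apply_eq_iff_eq]
      exact ⟨fun h => h ▸ hspec, fun h => Face.eq_of_mem u.2 hspec h⟩
  have hentry : ∀ (η : Face f l) (u v : LatticePoints f l), toReal v.1 ∈ η.1 →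
      (toReal u.1 ∈ η.1 → hasseWitt p f l u v =
        ((restrict f η.1) ^ (p - 1)).coeff ((p : ℤ) • v.1 - u.1)) ∧
      (toReal u.1 ∉ η.1 → hasseWitt p f l u v = 0) := fun η u v hv =>
    coeff_pow_sub_one hp (convex_newtonPolytope f) η.2.1.1.isExtreme
      (η.2.1.convex (convex_newtonPolytope f)) (isInit_restrict η.2.1) u.2.1 hv
  have htri : (hasseWitt p f l).BlockTriangular b := by
    intro u v huv
    have hv : toReal v.1 ∉ mu f (l - 1) := fun h => by
      rw [(hb_top v).2 h] at huv; exact not_top_lt huv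
    obtain ⟨η, hη⟩ := hface v hv
    refine (hentry η u v hη).2 fun h => ?_
    rw [(hb_face u η).2 h, (hb_face v η).2 hη] at huv
    exact lt_irrefl _ huv
  rw [htri.det_fintype, IsUnit.prod_univ_iff]
  have htop : IsUnit ((hasseWitt p f l).toSquareBlock b ⊤).det ↔
      IsUnit (hasseWitt p f (l - 1)).det := by
    refine isUnit_det_iff_of_equiv
      ⟨fun u => ⟨u.1.1, (hb_top _).1 u.2⟩,
        fun u => ⟨⟨u.1, mu_mono f (Nat.sub_le l 1) u.2⟩, (hb_top _).2 u.2⟩,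
        fun _ => rfl, fun _ => rfl⟩ fun _ _ => rfl
  have hbl : ∀ η : Face f l, IsUnit ((hasseWitt p f l).toSquareBlock b (eN η)).det ↔
      IsUnit (hasseWitt p (restrict f η.1) 0).det := by
    intro η
    have hη := interiorOf_restrict η
    refine isUnit_det_iff_of_equiv
      ⟨fun u => ⟨u.1.1, (Set.ext_iff.1 hη _).2 ⟨u.1.2, (hb_face _ η).1 u.2⟩⟩,
        fun u => ⟨⟨u.1, ((Set.ext_iff.1 hη _).1 u.2).1⟩,
          (hb_face _ η).2 ((Set.ext_iff.1 hη _).1 u.2).2⟩,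
        fun _ => rfl, fun _ => rfl⟩ fun u v =>
          (hentry η u.1 v.1 ((hb_face _ η).1 v.2)).1 ((hb_face _ η).1 u.2)
  constructor
  · exact fun h => ⟨htop.1 (h ⊤), fun η => (hbl η).1 (h _)⟩
  · rintro ⟨h1, h2⟩ k
    induction k using WithTop.recTopCoe with
    | top => exact htop.2 h1
    | coe k =>
      obtain ⟨η, rfl⟩ := eN.surjective k
      exact (hbl η).2 (h2 η)

end UnitRoot

namespace UnitRoot

/-! ### Arithmetic in `p`-adically complete rings -/

section Arithmetic

variable {R : Type*} [CommRing R] (p : ℕ)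

theorem mem_span_pow {s : ℕ} {x : R} :
    x ∈ (Ideal.span {(p : R)} ^ s • ⊤ : Submodule R R) ↔ (p : R) ^ s ∣ x := by
  rw [smul_eq_mul, Ideal.mul_top, Ideal.span_singleton_pow, Ideal.mem_span_singleton]

theorem mem_span_pow_smul_top {M : Type*} [AddCommGroup M] [Module R M] {s : ℕ} {x : M} :
    x ∈ (Ideal.span {(p : R)} ^ s • ⊤ : Submodule R M) ↔ ∃ y, x = (p : R) ^ s • y := by
  rw [Ideal.span_singleton_pow, Submodule.ideal_span_singleton_smul,
    Submodule.mem_smul_pointwise_iff_exists]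
  exact ⟨fun ⟨y, _, h⟩ => ⟨y, h.symm⟩, fun ⟨y, h⟩ => ⟨y, trivial, h.symm⟩⟩

variable [IsAdicComplete (Ideal.span {(p : R)}) R]

theorem eq_zero_of_forall_pow_dvd {x : R} (h : ∀ s : ℕ, (p : R) ^ s ∣ x) : x = 0 := by
  refine IsHausdorff.haus (I := Ideal.span {(p : R)}) inferInstance x fun s => ?_
  rw [SModEq.zero, mem_span_pow]
  exact h s

theorem exists_limit {a : ℕ → R} (h : ∀ s, (p : R) ^ s ∣ a (s + 1) - a s) :
    ∃ L, ∀ s, (p : R) ^ s ∣ L - a s := by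
  have key : ∀ m k, (p : R) ^ m ∣ a (m + k) - a m := by
    intro m k
    induction k with
    | zero => simp
    | succ k ih =>
      have := (pow_dvd_pow (p : R) (Nat.le_add_right m k)).trans (h (m + k))
      have e : a (m + (k + 1)) - a m = (a (m + k + 1) - a (m + k)) + (a (m + k) - a m) := by
        rw [sub_add_sub_cancel, add_assoc]
      rw [e]
      exact dvd_add this ih
  obtain ⟨L, hL⟩ := IsPrecomplete.prec (I := Ideal.span {(p : R)}) inferInstance (f := a) (by
    intro m n hmn
    obtain ⟨k, rfl⟩ := Nat.exists_eq_add_of_le hmn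
    refine SModEq.symm ?_
    rw [SModEq.sub_mem, mem_span_pow]
    exact key m k)
  refine ⟨L, fun s => ?_⟩
  rw [← mem_span_pow, ← SModEq.sub_mem]
  exact (hL s).symm

/-- In a `p`-adically complete ring `p` lies in the Jacobson radical, so a Bézout relation exhibits
a multiple of `t` as `1` plus a radical element. -/
theorem isUnit_natCast {t : ℕ} (h : Nat.Coprime t p) : IsUnit (t : R) := by
  have h1 : (p : R) ∈ (⊥ : Ideal R).jacobson :=
    IsAdicComplete.le_jacobson_bot (Ideal.span {(p : R)}) (Ideal.mem_span_singleton_self _)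
  have h2 := Nat.gcd_eq_gcd_ab t p
  rw [h] at h2
  have h3 : (t : R) * (Nat.gcdA t p : R) = (p : R) * (-(Nat.gcdB t p : R)) + 1 := by
    have := congrArg (Int.cast : ℤ → R) h2
    push_cast at this
    linear_combination -this
  have h4 := Ideal.mem_jacobson_bot.1 h1 (-(Nat.gcdB t p : R))
  rw [← h3] at h4
  exact isUnit_of_mul_isUnit_left h4

theorem isUnit_intCast (hp : p.Prime) {t : ℤ} (h : ¬ (p : ℤ) ∣ t) : IsUnit (t : R) := by
  have h1 : Nat.Coprime t.natAbs p :=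
    ((Nat.Prime.coprime_iff_not_dvd hp).2 fun h' => h (Int.natCast_dvd.2 h')).symm
  have h2 := isUnit_natCast (R := R) p h1
  rcases Int.natAbs_eq t with e | e
  · rw [e, Int.cast_natCast]; exact h2
  · rw [e, Int.cast_neg, Int.cast_natCast]; exact h2.neg

/-- The divided powers of `p`. -/
theorem exists_dividedPower (hp : p.Prime) (hp2 : 2 < p) (r : ℕ) :
    ∃ d : R, d * (r.factorial : R) = (p : R) ^ r ∧ (p : R) ^ ((r + 1) / 2) ∣ d := by
  have := Fact.mk hp
  set j := padicValNat p r.factorial with hj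
  have h1 := sub_one_mul_padicValNat_factorial (p := p) r
  rw [← hj] at h1
  -- Legendre's formula bounds `(p-1) v_p(r!)` by `r`, and `p > 2` gives `p - 1 ≥ 2`. Consequently
  -- at least `⌈r/2⌉` factors `p` survive in `p^r/r!`.
  have h2 : 2 * j ≤ r := by
    have : 2 * j ≤ (p - 1) * j := Nat.mul_le_mul_right _ (by omega)
    omega
  obtain ⟨t, ht⟩ : p ^ j ∣ r.factorial := pow_padicValNat_dvd
  have htp : Nat.Coprime t p := by
    refine ((Nat.Prime.coprime_iff_not_dvd hp).2 fun h => ?_).symm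
    obtain ⟨t', rfl⟩ := h
    refine pow_succ_padicValNat_not_dvd (p := p) (Nat.factorial_ne_zero r) ⟨t', ?_⟩
    rw [← hj, ht]; ring
  obtain ⟨w, hw⟩ := isUnit_natCast (R := R) p htp
  refine ⟨(p : R) ^ (r - j) * ↑w⁻¹, ?_, ?_⟩
  · have e : (r.factorial : R) = (p : R) ^ j * w := by
      rw [hw, ht]; push_cast; ring
    have e2 : (p : R) ^ r = (p : R) ^ (r - j) * (p : R) ^ j := by
      rw [← pow_add, Nat.sub_add_cancel (by omega)]
    rw [e, e2]
    calc (p : R) ^ (r - j) * ↑w⁻¹ * ((p : R) ^ j * ↑w)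
        = (p : R) ^ (r - j) * (p : R) ^ j * (↑w⁻¹ * ↑w) := by ring
      _ = _ := by rw [Units.inv_mul, mul_one]
  · exact (pow_dvd_pow _ (by omega)).mul_right _

/-- `p ^ r / r!`. -/
def dividedPower (p : ℕ) (R : Type*) [CommRing R] (r : ℕ) : R :=
  open Classical in
  if h : ∃ d : R, d * (r.factorial : R) = (p : R) ^ r ∧ (p : R) ^ ((r + 1) / 2) ∣ d
  then h.choose else 0

theorem dividedPower_mul_factorial (hp : p.Prime) (hp2 : 2 < p) (r : ℕ) :
    dividedPower p R r * (r.factorial : R) = (p : R) ^ r := by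
  have h := exists_dividedPower (R := R) p hp hp2 r
  rw [dividedPower, dif_pos h]
  exact h.choose_spec.1

theorem pow_dvd_dividedPower (hp : p.Prime) (hp2 : 2 < p) {r s : ℕ} (hs : s ≤ (r + 1) / 2) :
    (p : R) ^ s ∣ dividedPower p R r := by
  have h := exists_dividedPower (R := R) p hp hp2 r
  rw [dividedPower, dif_pos h]
  exact (pow_dvd_pow _ hs).trans h.choose_spec.2

theorem dividedPower_zero (hp : p.Prime) (hp2 : 2 < p) : dividedPower p R 0 = 1 := by
  simpa using dividedPower_mul_factorial (R := R) p hp hp2 0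

end Arithmetic

theorem exists_smul_of_forall_dvd {ι R : Type*} [CommRing R] {r : R} {w : ι →₀ R}
    (h : ∀ i, r ∣ w i) : ∃ w' : ι →₀ R, w = r • w' ∧ w'.support ⊆ w.support := by
  classical
  choose c hc using h
  refine ⟨Finsupp.onFinset w.support (fun i => if w i = 0 then 0 else c i) (by
    intro i hi
    rw [Finsupp.mem_support_iff]
    intro h0
    exact hi (if_pos h0)), ?_, Finsupp.support_onFinset_subset⟩
  ext i
  rw [Finsupp.smul_apply, Finsupp.onFinset_apply, smul_eq_mul]
  by_cases h0 : w i = 0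
  · rw [if_pos h0, h0, mul_zero]
  · rw [if_neg h0]; exact hc i

theorem exists_smul_of_forall_dvd_coeff {n : ℕ} {R : Type*} [CommRing R] {r : R} {P : Laurent n R}
    (h : ∀ a, r ∣ P.coeff a) : ∃ Q, P = r • Q := by
  obtain ⟨w, hw, -⟩ := exists_smul_of_forall_dvd h
  refine ⟨AddMonoidAlgebra.ofCoeff w, ?_⟩
  ext a
  exact DFunLike.congr_fun hw a

/-! ### Dilation and contraction of exponents -/

section Dilate

variable {n : ℕ} {R : Type*} [CommRing R] (p : ℕ)

/-- Substitution of `x^p` for `x`. -/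
def dilate : Laurent n R →+* Laurent n R :=
  AddMonoidAlgebra.mapDomainRingHom R (zsmulAddGroupHom (p : ℤ) : (Fin n → ℤ) →+ (Fin n → ℤ))

theorem zsmul_injective {p : ℕ} (hp : p ≠ 0) :
    Function.Injective fun a : Fin n → ℤ => (p : ℤ) • a :=
  smul_right_injective _ (by exact_mod_cast hp)

/-- `∑ a_k x^k ↦ ∑ a_{pk} x^k` on Laurent polynomials. -/
def contract {p : ℕ} (hp : p ≠ 0) (P : Laurent n R) : Laurent n R :=
  P.comapDomain (fun a : Fin n → ℤ => (p : ℤ) • a) (zsmul_injective hp)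

theorem coeff_contract {p : ℕ} (hp : p ≠ 0) (P : Laurent n R) (v : Fin n → ℤ) :
    (contract hp P).coeff v = P.coeff ((p : ℤ) • v) := rfl

theorem dilate_single (a : Fin n → ℤ) (c : R) :
    dilate p (AddMonoidAlgebra.single a c) = AddMonoidAlgebra.single ((p : ℤ) • a) c := by
  simp [dilate]

theorem single_smul_apply (a : Fin n → ℤ) (c : R) (E : Series n R) (k : Fin n → ℤ) :
    ((AddMonoidAlgebra.single a c : Laurent n R) • E) k = c * E (k - a) := by
  rw [smul_apply, AddMonoidAlgebra.coeff_single, Finsupp.sum_single_index (by simp)]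

theorem cartierSeries_dilate_smul (g : Laurent n R) (E : Series n R) :
    cartierSeries p (dilate p g • E) = g • cartierSeries p E := by
  induction g using AddMonoidAlgebra.induction_linear with
  | zero => rw [map_zero, zero_smul, zero_smul]; rfl
  | add P Q hP hQ => rw [map_add, add_smul, add_smul, ← hP, ← hQ]; rfl
  | single a c =>
    funext k
    rw [dilate_single, cartierSeries, single_smul_apply, single_smul_apply, cartierSeries, smul_sub]

theorem cartierSeries_smul_one {p : ℕ} (hp : p ≠ 0) (P : Laurent n R) :
    cartierSeries p (P • (Series.one : Series n R)) = contract hp P • Series.one := by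
  funext k
  rw [cartierSeries, smul_one_apply, smul_one_apply, coeff_contract]

theorem cartierSeries_add (E F : Series n R) :
    cartierSeries p (E + F) = cartierSeries p E + cartierSeries p F := rfl

theorem cartierSeries_smul (r : R) (E : Series n R) :
    cartierSeries p (r • E) = r • cartierSeries p E := rfl

theorem SuppIn.dilate {N : ℕ} {S : Set (Fin n → ℝ)} {P : Laurent n R} {p : ℕ} (hp : p ≠ 0)
    (hP : SuppIn N S P) : SuppIn (p * N) S (dilate p P) := by
  intro a ha
  have h1 := Finsupp.mapDomain_support (Finsupp.mem_support_iff.2 ha)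
  obtain ⟨b, hb, rfl⟩ := Finset.mem_image.1 h1
  exact (InDil.zsmul_iff hp).2 (hP b (Finsupp.mem_support_iff.1 hb))

theorem coeff_dilate_zsmul {p : ℕ} (hp : p ≠ 0) (P : Laurent n R) (a : Fin n → ℤ) :
    (dilate p P).coeff ((p : ℤ) • a) = P.coeff a :=
  Finsupp.mapDomain_apply (zsmul_injective hp) _ _

theorem coeff_dilate_of_notMem {p : ℕ} (P : Laurent n R) {a : Fin n → ℤ}
    (ha : ∀ b, (p : ℤ) • b ≠ a) : (dilate p P).coeff a = 0 :=
  Finsupp.mapDomain_of_notMem_range _ _ (by rintro ⟨b, hb⟩; exact ha b hb)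

theorem IsInit.dilate {N : ℕ} {Δ η : Set (Fin n → ℝ)} {P P' : Laurent n R} {p : ℕ} (hp : p ≠ 0)
    (h : IsInit Δ η N P P') : IsInit Δ η (p * N) (dilate p P) (dilate p P') := by
  refine ⟨h.supp.dilate hp, h.supp'.dilate hp, fun a ha => ?_⟩
  by_cases hex : ∃ b, (p : ℤ) • b = a
  · obtain ⟨b, rfl⟩ := hex
    rw [coeff_dilate_zsmul hp, coeff_dilate_zsmul hp, h.coeff_eq b ((InDil.zsmul_iff hp).1 ha)]
  · push Not at hex
    rw [coeff_dilate_of_notMem P hex, coeff_dilate_of_notMem P' hex]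

theorem SuppIn.contract {N : ℕ} {S : Set (Fin n → ℝ)} {P : Laurent n R} {p : ℕ} (hp : p ≠ 0)
    (hP : SuppIn (p * N) S P) : SuppIn N S (contract hp P) := fun _ ha =>
  (InDil.zsmul_iff hp).1 (hP _ ha)

theorem IsInit.contract {N : ℕ} {Δ η : Set (Fin n → ℝ)} {P P' : Laurent n R} {p : ℕ} (hp : p ≠ 0)
    (h : IsInit Δ η (p * N) P P') : IsInit Δ η N (contract hp P) (contract hp P') :=
  ⟨h.supp.contract hp, h.supp'.contract hp, fun _ ha => by
    rw [coeff_contract, coeff_contract, h.coeff_eq _ ((InDil.zsmul_iff hp).2 ha)]⟩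

variable {p}

/-- Both `f ↦ f^σ(x^p)` and `f ↦ f^p` are additive modulo `p`, so the congruence reduces to
monomials, where it is the Frobenius lift property. -/
theorem exists_frobDiff (hp : p.Prime) {σ : R →+* R} (hσ : IsFrobeniusLift p σ)
    (f : Laurent n R) : ∃ G, dilate p (twist σ f) = f ^ p + (p : R) • G := by
  induction f using AddMonoidAlgebra.induction_linear with
  | zero => exact ⟨0, by simp [twist, zero_pow hp.ne_zero]⟩
  | add P Q hP hQ =>
    obtain ⟨G, hG⟩ := hP
    obtain ⟨H, hH⟩ := hQ
    obtain ⟨r, hr⟩ := exists_add_pow_prime_eq hp P Q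
    refine ⟨G + H - P * Q * r, ?_⟩
    have e : ∀ x : Laurent n R, (p : R) • x = (p : Laurent n R) * x := fun x => by
      rw [Nat.cast_smul_eq_nsmul, nsmul_eq_mul]
    rw [e] at hG hH ⊢
    simp only [twist] at hG hH ⊢
    rw [map_add, map_add, hr, hG, hH]
    ring
  | single a c =>
    obtain ⟨t, ht⟩ := hσ c
    refine ⟨AddMonoidAlgebra.single ((p : ℤ) • a) t, ?_⟩
    have h1 : σ c = c ^ p + p * t := by rw [← ht]; ring
    rw [twist, AddMonoidAlgebra.mapRingHom_single, dilate_single, h1, AddMonoidAlgebra.single_pow,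
      AddMonoidAlgebra.smul_single, smul_eq_mul, natCast_zsmul, AddMonoidAlgebra.single_add]

/-- `(f^σ(x^p) - f^p) / p`. -/
def frobDiff (p : ℕ) (σ : R →+* R) (f : Laurent n R) : Laurent n R :=
  open Classical in
  if h : ∃ G, dilate p (twist σ f) = f ^ p + (p : R) • G then h.choose else 0

theorem dilate_twist (hp : p.Prime) {σ : R →+* R} (hσ : IsFrobeniusLift p σ)
    (f : Laurent n R) : dilate p (twist σ f) = f ^ p + (p : R) • frobDiff p σ f := by
  have h := exists_frobDiff hp hσ f
  rw [frobDiff, dif_pos h]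
  exact h.choose_spec

theorem IsInit.of_smul [IsDomain R] {N : ℕ} {Δ η : Set (Fin n → ℝ)} {P P' : Laurent n R} {r : R}
    (hr : r ≠ 0) (h : IsInit Δ η N (r • P) (r • P')) : IsInit Δ η N P P' := by
  have e : ∀ (P : Laurent n R) a, (r • P).coeff a = r * P.coeff a := fun P a => rfl
  refine ⟨fun a ha => h.supp a (by rw [e]; exact mul_ne_zero hr ha),
    fun a ha => h.supp' a (by rw [e]; exact mul_ne_zero hr ha), fun a ha => ?_⟩
  have := h.coeff_eq a ha
  rw [e, e] at this
  exact mul_left_cancel₀ hr this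

/-- The quotient `frobDiff` is obtained by choice, but its `p`-fold is the explicit difference
`f^σ(x^p) - f^p`. The initial part is computed there and `p` is then cancelled. -/
theorem IsInit.frobDiff [IsDomain R] [CharZero R] (hp : p.Prime) {σ : R →+* R}
    (hσ : IsFrobeniusLift p σ) {Δ η : Set (Fin n → ℝ)} (hΔ : Convex ℝ Δ) (hη : IsExtreme ℝ Δ η)
    (hη' : Convex ℝ η) (hne : η.Nonempty) {f h : Laurent n R} (hf : IsInit Δ η 1 f h) :
    IsInit Δ η p (frobDiff p σ f) (frobDiff p σ h) := by
  refine IsInit.of_smul (r := (p : R)) (by exact_mod_cast hp.ne_zero) ?_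
  have e : ∀ f : Laurent n R,
      (p : R) • UnitRoot.frobDiff p σ f = UnitRoot.dilate p (UnitRoot.twist σ f) + (-1 : R) • f ^ p := by
    intro f
    rw [dilate_twist hp hσ, neg_one_smul]; abel
  rw [e, e]
  have h1 := (hf.twist σ).dilate hp.ne_zero
  have h2 := (hf.pow hΔ hη hη' hne p).smul (-1 : R)
  rw [mul_one] at h1 h2
  exact h1.add h2

theorem SuppIn.isInit {N : ℕ} {Δ : Set (Fin n → ℝ)} {P : Laurent n R} (h : SuppIn N Δ P) :
    IsInit Δ Δ N P P := ⟨h, h, fun _ _ => rfl⟩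

theorem SuppIn.frobDiff [IsDomain R] [CharZero R] (hp : p.Prime) {σ : R →+* R}
    (hσ : IsFrobeniusLift p σ) {Δ : Set (Fin n → ℝ)} (hΔ : Convex ℝ Δ) (hne : Δ.Nonempty)
    {f : Laurent n R} (hf : SuppIn 1 Δ f) : SuppIn p Δ (frobDiff p σ f) :=
  (hf.isInit.frobDiff hp hσ hΔ (IsExtreme.refl ℝ Δ) hΔ hne).supp

end Dilate

end UnitRoot

namespace UnitRoot

variable {n : ℕ} {R : Type*} [CommRing R]

/-! ### Divisibility of formal expansions -/

theorem expansion_spec {g : Laurent n R} {b : Fin n → ℤ} (hb : IsVertex g b)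
    (hu : IsUnit (g.coeff b)) : IsExpansion g b (expansion g b) := by
  have h := exists_isExpansion hb hu
  rw [expansion, dif_pos h]
  exact h.choose_spec

theorem expansion_algebraMap {g : Laurent n R} {b : Fin n → ℤ} (hb : IsVertex g b)
    (hu : IsUnit (g.coeff b)) (P : Laurent n R) :
    expansion g b (algebraMap _ _ P) = P • (Series.one : Series n R) := by
  rw [Algebra.algebraMap_eq_smul_one, map_smul, (expansion_spec hb hu).1]

theorem map_smul_series {S : Type*} [CommRing S] (φ : R →+* S) (g : Laurent n R)
    (E : Series n R) (k : Fin n → ℤ) :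
    φ ((g • E) k) = ((AddMonoidAlgebra.mapRingHom (Fin n → ℤ) φ g) • (fun k => φ (E k)) :
      Series n S) k := by
  induction g using AddMonoidAlgebra.induction_linear with
  | zero => rw [map_zero, zero_smul, zero_smul]; exact map_zero φ
  | add P Q hP hQ => rw [map_add, add_smul, add_smul, Pi.add_apply, Pi.add_apply, map_add, hP, hQ]
  | single a c => rw [AddMonoidAlgebra.mapRingHom_single, single_smul_apply, single_smul_apply,
      map_mul]

/-- Divisibility of a series can be tested after multiplication by a power of `g`. -/
theorem dvd_of_dvd_pow_smul {g : Laurent n R} {b : Fin n → ℤ} (hb : IsVertex g b)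
    (hu : IsUnit (g.coeff b)) {E : Series n R} (hE : E ∈ formalSeries R (newtonPolytope g) b)
    {r : R} (m : ℕ) (h : ∀ k, r ∣ (g ^ m • E) k) (k : Fin n → ℤ) : r ∣ E k := by
  obtain ⟨ℓ, c, hc, hℓ, hcone⟩ := exists_functional hb
  -- Divisibility by `r` is vanishing over `R/(r)`. The coefficient of `g` at `b` remains a unit
  -- there, so multiplication by powers of `g` is still injective on series bounded below; this is
  -- the support lemma with `S = ∅`.
  set φ := Ideal.Quotient.mk (Ideal.span {r}) with hφ
  set g' := AddMonoidAlgebra.mapRingHom (Fin n → ℤ) φ g with hg'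
  have hcoeff : ∀ a, g'.coeff a = φ (g.coeff a) := fun a => by
    rw [hg', AddMonoidAlgebra.coeff_mapRingHom]
  have h0 : ∀ x, φ x = 0 ↔ r ∣ x := fun x => by
    rw [hφ, Ideal.Quotient.eq_zero_iff_mem, Ideal.mem_span_singleton]
  rw [← h0]
  by_contra hk
  refine support_of_pow_smul (f := g') (b := b) (S := ∅) (by rw [hcoeff]; exact hu.map φ) hc
    (fun a ha => hℓ a fun h => ha (by rw [hcoeff, h, map_zero])) (by simp) m
    (E := fun k => φ (E k)) ⟨0, fun k hk => hcone k (hE k fun h => hk ?_)⟩ ?_ k hk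
  · exact (congrArg φ h).trans (map_zero φ)
  · intro k hk
    refine absurd ?_ hk
    rw [hg', ← map_pow, ← map_smul_series, h0]
    exact h _

/-! ### Chains: linear combinations of the symbols `ω_{(m,u)}` -/

/-- Linear combinations of the symbols `(m, u)`. -/
abbrev Chain (n : ℕ) (R : Type*) [CommRing R] : Type _ := (ℕ × (Fin n → ℤ)) →₀ R

/-- Chains supported on the cone over `μ`. -/
def chains (R : Type*) [CommRing R] (μ : Set (Fin n → ℝ)) : Submodule R (Chain n R) :=
  Finsupp.supported R R {i | IsConePoint μ i.1 i.2}

theorem mem_chains {μ : Set (Fin n → ℝ)} {w : Chain n R} :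
    w ∈ chains R μ ↔ ∀ i, w i ≠ 0 → 1 ≤ i.1 ∧ InDil i.1 μ i.2 := by
  rw [chains, Finsupp.mem_supported]
  exact ⟨fun h i hi => h (Finsupp.mem_support_iff.2 hi),
    fun h i hi => h i (Finsupp.mem_support_iff.1 hi)⟩

theorem chains_mono {μ μ' : Set (Fin n → ℝ)} (h : μ ⊆ μ') : chains R μ ≤ chains R μ' :=
  fun _ hw => mem_chains.2 fun i hi => ⟨(mem_chains.1 hw i hi).1, (mem_chains.1 hw i hi).2.mono h⟩

theorem single_mem_chains {μ : Set (Fin n → ℝ)} {m : ℕ} {u : Fin n → ℤ} (hm : 1 ≤ m)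
    (hu : InDil m μ u) (c : R) : Finsupp.single (m, u) c ∈ chains R μ :=
  Finsupp.single_mem_supported R c ⟨hm, hu⟩

/-- Induction principle for chains. -/
theorem chains_induction {μ : Set (Fin n → ℝ)} {C : Chain n R → Prop} (h0 : C 0)
    (hadd : ∀ w w', C w → C w' → C (w + w'))
    (hsingle : ∀ m u c, 1 ≤ m → InDil m μ u → C (Finsupp.single (m, u) c))
    {w : Chain n R} (hw : w ∈ chains R μ) : C w := by
  rw [← Finsupp.sum_single w]
  refine Finset.sum_induction _ C hadd h0 fun i hi => ?_
  have := mem_chains.1 hw i (Finsupp.mem_support_iff.1 hi)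
  exact hsingle i.1 i.2 _ this.1 this.2

theorem linearMap_mem_of_chains {M : Type*} [AddCommGroup M] [Module R M] {μ : Set (Fin n → ℝ)}
    (T : Chain n R →ₗ[R] M) (N : Submodule R M)
    (h : ∀ m u, 1 ≤ m → InDil m μ u → T (Finsupp.single (m, u) 1) ∈ N) {w : Chain n R}
    (hw : w ∈ chains R μ) : T w ∈ N := by
  refine chains_induction (C := fun w => T w ∈ N) ?_ ?_ ?_ hw
  · rw [map_zero]; exact N.zero_mem
  · intro w w' h1 h2
    rw [map_add]; exact N.add_mem h1 h2
  · intro m u c hm hu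
    rw [show (Finsupp.single (m, u) c : Chain n R) = c • Finsupp.single (m, u) 1 by simp, map_smul]
    exact N.smul_mem _ (h m u hm hu)

/-- The chain `∑ P_v (k, v)` of pole order `k`. -/
def level (k : ℕ) : Laurent n R →ₗ[R] Chain n R :=
  Finsupp.lmapDomain R R (Prod.mk k) ∘ₗ (AddMonoidAlgebra.coeffLinearEquiv R).toLinearMap

theorem level_single (k : ℕ) (u : Fin n → ℤ) (c : R) :
    level k (AddMonoidAlgebra.single u c) = Finsupp.single (k, u) c :=
  Finsupp.mapDomain_single

theorem level_apply_self (k : ℕ) (P : Laurent n R) (v : Fin n → ℤ) :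
    level k P (k, v) = P.coeff v :=
  Finsupp.mapDomain_apply (Prod.mk_right_injective k) _ _

theorem level_apply_of_ne {k j : ℕ} (h : j ≠ k) (P : Laurent n R) (v : Fin n → ℤ) :
    level k P (j, v) = 0 :=
  Finsupp.mapDomain_of_notMem_range _ _ (by rintro ⟨a, ha⟩; exact h (congrArg Prod.fst ha).symm)

theorem level_mem {k : ℕ} (hk : 1 ≤ k) {μ : Set (Fin n → ℝ)} {P : Laurent n R}
    (hP : SuppIn k μ P) : level k P ∈ chains R μ := by
  rw [mem_chains]
  rintro ⟨j, v⟩ hi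
  by_cases h : j = k
  · subst h
    rw [level_apply_self] at hi
    exact ⟨hk, hP v hi⟩
  · exact absurd (level_apply_of_ne h P v) hi

/-- The rational function represented by a chain. -/
def chainForm (g : Laurent n R) : Chain n R →ₗ[R] Localization.Away g :=
  Finsupp.linearCombination R fun i => omega g i.1 i.2

theorem chainForm_single (g : Laurent n R) (m : ℕ) (u : Fin n → ℤ) (c : R) :
    chainForm g (Finsupp.single (m, u) c) = c • omega g m u :=
  Finsupp.linearCombination_single R c (m, u)

theorem pow_smul_chainForm_level (g : Laurent n R) (k : ℕ) (P : Laurent n R) :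
    g ^ k • chainForm g (level k P) = ((k - 1).factorial : R) • algebraMap _ _ P := by
  induction P using AddMonoidAlgebra.induction_linear with
  | zero => simp
  | add P Q hP hQ => rw [map_add, map_add, smul_add, hP, hQ, map_add, smul_add]
  | single a c =>
    rw [level_single, chainForm_single, smul_comm, pow_smul_omega, smul_comm]
    congr 1
    rw [show (AddMonoidAlgebra.single a c : Laurent n R) = c • AddMonoidAlgebra.single a 1 by simp,
      Algebra.algebraMap_eq_smul_one, Algebra.algebraMap_eq_smul_one, smul_assoc]

theorem chainForm_mem (g : Laurent n R) {μ : Set (Fin n → ℝ)} {w : Chain n R}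
    (hw : w ∈ chains R μ) : chainForm g w ∈ Omega g μ :=
  linearMap_mem_of_chains _ _ (fun m u hm hu => by
    rw [chainForm_single, one_smul]
    exact Submodule.subset_span ⟨m, u, ⟨hm, hu⟩, rfl⟩) hw

theorem exists_chainForm_eq (g : Laurent n R) {μ : Set (Fin n → ℝ)} {ω : Localization.Away g}
    (hω : ω ∈ Omega g μ) : ∃ w ∈ chains R μ, chainForm g w = ω := by
  have : (Omega g μ) ≤ (chains R μ).map (chainForm g) := by
    refine Submodule.span_le.2 ?_
    rintro _ ⟨m, u, hmu, rfl⟩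
    exact ⟨_, single_mem_chains hmu.1 hmu.2 1, by rw [chainForm_single, one_smul]⟩
  exact this hω

/-- The formal expansion of a chain. -/
def chainSeries (g : Laurent n R) (b : Fin n → ℤ) : Chain n R →ₗ[R] Series n R :=
  (expansion g b).restrictScalars R ∘ₗ chainForm g

theorem chainSeries_mem {g : Laurent n R} {b : Fin n → ℤ} (hb : IsVertex g b)
    (hu : IsUnit (g.coeff b)) {w : Chain n R} (hw : w ∈ chains R (newtonPolytope g)) :
    chainSeries g b w ∈ formalSeries R (newtonPolytope g) b :=
  linearMap_mem_of_chains _ _ (fun m u hm hu' => by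
    change expansion g b (chainForm g _) ∈ _
    rw [chainForm_single, one_smul]
    exact (expansion_spec hb hu).2 m u ⟨hm, hu'⟩) hw

theorem pow_smul_chainSeries_level {g : Laurent n R} {b : Fin n → ℤ} (hb : IsVertex g b)
    (hu : IsUnit (g.coeff b)) (k : ℕ) (P : Laurent n R) :
    g ^ k • chainSeries g b (level k P) =
      ((k - 1).factorial : R) • (P • (Series.one : Series n R)) := by
  change g ^ k • expansion g b (chainForm g _) = _
  rw [← map_smul, pow_smul_chainForm_level, LinearMap.map_smul_of_tower,
    expansion_algebraMap hb hu]

/-! ### The Cartier operator on chains -/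

/-- Partial sums of the binomial series of `A^{M+1+K} / (A-t)^{M+1}`. -/
theorem exists_binomial_eq {A : Type*} [CommRing A] (a t : A) (M K : ℕ) :
    ∃ H, a ^ (M + 1 + K) = (a - t) ^ (M + 1) *
      (∑ r ∈ Finset.range (K + 1), ((M + r).choose r : A) * t ^ r * a ^ (K - r)) +
        t ^ (K + 1) * H := by
  have hrec : ∀ M K : ℕ,
      ∑ r ∈ Finset.range (K + 2), ((M + r).choose r : A) * t ^ r * a ^ (K + 1 - r) =
        a * (∑ r ∈ Finset.range (K + 1), ((M + r).choose r : A) * t ^ r * a ^ (K - r)) +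
          ((M + (K + 1)).choose (K + 1) : A) * t ^ (K + 1) := by
    intro M K
    rw [Finset.sum_range_succ, Nat.sub_self, pow_zero, mul_one, Finset.mul_sum]
    congr 1
    refine Finset.sum_congr rfl fun r hr => ?_
    have : K + 1 - r = (K - r) + 1 := by
      have := Finset.mem_range.1 hr; omega
    rw [this, pow_succ]; ring
  have hzero : ∀ K : ℕ, (a - t) *
      ∑ r ∈ Finset.range (K + 1), ((0 + r).choose r : A) * t ^ r * a ^ (K - r) =
        a ^ (K + 1) - t ^ (K + 1) := by
    intro K
    induction K with
    | zero => simp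
    | succ K ih =>
      rw [hrec, mul_add, mul_left_comm, ih]
      simp only [Nat.zero_add, Nat.choose_self, Nat.cast_one]
      ring
  -- By Pascal's rule a factor `a - t` lowers the order of the truncated negative binomial series by
  -- one, at the cost of a multiple of `t^(K+1)`.
  have hsucc : ∀ M K : ℕ, (a - t) *
      ∑ r ∈ Finset.range (K + 1), ((M + 1 + r).choose r : A) * t ^ r * a ^ (K - r) =
        a * (∑ r ∈ Finset.range (K + 1), ((M + r).choose r : A) * t ^ r * a ^ (K - r)) -
          ((M + 1 + K).choose K : A) * t ^ (K + 1) := by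
    intro M K
    induction K with
    | zero => simp
    | succ K ih =>
      rw [hrec, hrec, mul_add, mul_left_comm, ih]
      have hP : ((M + 1 + (K + 1)).choose (K + 1) : A) =
          ((M + 1 + K).choose K : A) + ((M + (K + 1)).choose (K + 1) : A) := by
        rw [show M + 1 + (K + 1) = (M + 1 + K) + 1 by ring, Nat.choose_succ_succ,
          show M + (K + 1) = M + 1 + K by ring]
        push_cast; rfl
      rw [hP]
      ring
  induction M with
  | zero =>
    refine ⟨1, ?_⟩
    rw [zero_add, pow_one, hzero]
    ring
  | succ M ih =>
    obtain ⟨H, hH⟩ := ih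
    refine ⟨a * H + (a - t) ^ (M + 1) * ((M + 1 + K).choose K : A), ?_⟩
    rw [pow_succ (a - t), mul_assoc, hsucc]
    linear_combination a * hH

theorem cartierSeries_sum {ι : Type*} (p : ℕ) (s : Finset ι) (E : ι → Series n R) :
    cartierSeries p (∑ i ∈ s, E i) = ∑ i ∈ s, cartierSeries p (E i) := by
  funext k
  simp only [cartierSeries, Finset.sum_apply]

section Cartier

variable {p : ℕ} (hp : p.Prime) (σ : R →+* R)

/-- The numerators in the Cartier operator. -/
def cartierNumerator (g : Laurent n R) (m : ℕ) (u : Fin n → ℤ) (r : ℕ) : Laurent n R :=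
  contract hp.ne_zero
    (AddMonoidAlgebra.single u 1 * g ^ (p * ((m + p - 1) / p) - m) * frobDiff p σ g ^ r)

/-- The coefficients in the Cartier operator. -/
def cartierCoeff (p : ℕ) (R : Type*) [CommRing R] (m r : ℕ) : R :=
  (((m - 1).factorial / ((m + p - 1) / p - 1).factorial : ℕ) : R) * dividedPower p R r

/-- A truncation of the Cartier operator on chains. -/
def cartierChain (g : Laurent n R) (K : ℕ) : Chain n R →ₗ[R] Chain n R :=
  Finsupp.linearCombination R fun i => ∑ r ∈ Finset.range (K + 1),
    cartierCoeff p R i.1 r • level ((i.1 + p - 1) / p + r) (cartierNumerator hp σ g i.1 i.2 r)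

theorem cartierChain_single (g : Laurent n R) (K m : ℕ) (u : Fin n → ℤ) (c : R) :
    cartierChain hp σ g K (Finsupp.single (m, u) c) = c • ∑ r ∈ Finset.range (K + 1),
      cartierCoeff p R m r • level ((m + p - 1) / p + r) (cartierNumerator hp σ g m u r) :=
  Finsupp.linearCombination_single R c (m, u)

/-- The second bound makes the exponent `p⌈m/p⌉ - m` an honest difference. The third shows that
`(⌈m/p⌉ - 1)!` divides `(m-1)!`, usually with factors `p` to spare. -/
theorem ceil_bounds (hp : p.Prime) {m : ℕ} (hm : 1 ≤ m) :
    1 ≤ (m + p - 1) / p ∧ m ≤ p * ((m + p - 1) / p) ∧ p * ((m + p - 1) / p - 1) ≤ m - 1 := by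
  have hp0 := hp.pos
  have h1 := Nat.div_add_mod (m + p - 1) p
  have h2 := Nat.mod_lt (m + p - 1) hp0
  have h3 : 1 ≤ (m + p - 1) / p := (Nat.one_le_div_iff hp0).2 (by omega)
  refine ⟨h3, by omega, ?_⟩
  rw [Nat.mul_sub, mul_one]
  omega

/-- Write `A = g^σ(x^p)`, `G = frobDiff p σ g` and `M + 1 = ⌈m/p⌉`. Since `g^p = A - pG`, the
function `(m-1)! x^u/g^m` equals `(m-1)! x^u g^(p(M+1)-m)` times the sum of the `binom(M+r, r)
(pG)^r / A^(M+1+r)`. The symbol of pole order `M+1+r` already contains the factorial `(M+r)!`, and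
what remains is `(m-1)!/M! · p^r/r!`. -/
theorem cartierCoeff_mul_factorial [IsAdicComplete (Ideal.span {(p : R)}) R] (hp : p.Prime) (hp2 : 2 < p)
    {m M : ℕ} (hm : 1 ≤ m) (hM : (m + p - 1) / p = M + 1) (r : ℕ) :
    cartierCoeff p R m r * ((M + r).factorial : R) =
      ((m - 1).factorial : R) * ((M + r).choose r : R) * (p : R) ^ r := by
  have h1 := (ceil_bounds hp hm).2.2
  rw [hM, Nat.add_sub_cancel] at h1
  have hdvd : M.factorial ∣ (m - 1).factorial :=
    Nat.factorial_dvd_factorial ((Nat.le_mul_of_pos_left M hp.pos).trans h1)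
  have h2 : ((m - 1).factorial : R) =
      (((m - 1).factorial / M.factorial : ℕ) : R) * (M.factorial : R) := by
    rw [← Nat.cast_mul, Nat.div_mul_cancel hdvd]
  have h3 : ((M + r).factorial : R) =
      ((M + r).choose r : R) * (M.factorial : R) * (r.factorial : R) := by
    rw [← Nat.add_choose_mul_factorial_mul_factorial M r]
    push_cast; ring
  rw [cartierCoeff, hM, Nat.add_sub_cancel, h3, h2, ← dividedPower_mul_factorial p hp hp2 r]
  ring

variable [IsDomain R] [CharZero R] {σ}

/-- The degrees add up to `m + (p⌈m/p⌉ - m) + rp = p(⌈m/p⌉ + r)`, a multiple of `p` which the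
contraction divides out. Only the factor `x^u` lies over `μ`; absorption carries this over to the
product. -/
theorem cartierNumerator_suppIn (hσ : IsFrobeniusLift p σ) {Δ μ : Set (Fin n → ℝ)}
    (hΔ : Convex ℝ Δ) (hμ : Absorbs Δ μ) {g : Laurent n R} (hg : SuppIn 1 Δ g) {m : ℕ}
    (hm : 1 ≤ m) {u : Fin n → ℤ} (hu : InDil m μ u) (r : ℕ) :
    SuppIn ((m + p - 1) / p + r) μ (cartierNumerator hp σ g m u r) := by
  have hne : Δ.Nonempty := by
    obtain ⟨y, hy, -⟩ := hu
    exact ⟨y, hμ.1 hy⟩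
  refine SuppIn.contract hp.ne_zero ?_
  have h1 := (suppIn_single hu (1 : R)).mul_absorbs hμ hm
    (hg.pow hΔ hne (p * ((m + p - 1) / p) - m))
  have h2 := h1.mul_absorbs hμ (by omega) ((hg.frobDiff hp hσ hΔ hne).pow hΔ hne r)
  have e : m + (p * ((m + p - 1) / p) - m) * 1 + r * p = p * ((m + p - 1) / p + r) := by
    rw [mul_one, Nat.add_sub_cancel' (ceil_bounds hp hm).2.1]; ring
  rwa [e] at h2

theorem cartierChain_mem (hσ : IsFrobeniusLift p σ) {Δ μ : Set (Fin n → ℝ)}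
    (hΔ : Convex ℝ Δ) (hμ : Absorbs Δ μ) {g : Laurent n R} (hg : SuppIn 1 Δ g) (K : ℕ)
    {w : Chain n R} (hw : w ∈ chains R μ) : cartierChain hp σ g K w ∈ chains R μ := by
  refine linearMap_mem_of_chains _ _ (fun m u hm hu => ?_) hw
  rw [cartierChain_single, one_smul]
  refine Submodule.sum_mem _ fun r _ => Submodule.smul_mem _ _ (level_mem ?_ ?_)
  · have := (ceil_bounds hp hm).1; omega
  · exact cartierNumerator_suppIn hp hσ hΔ hμ hg hm hu r

variable [IsAdicComplete (Ideal.span {(p : R)}) R]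

/-- The truncated Cartier operator on chains induces the Cartier operator on formal expansions
up to multiples of a power of `p`. -/
theorem chainSeries_cartierChain_single (hp2 : 2 < p) (hσ : IsFrobeniusLift p σ) {g : Laurent n R}
    (hg : UnitVertices g) {b : Fin n → ℤ} (hb : IsVertex g b) (K : ℕ) {m : ℕ} (hm : 1 ≤ m)
    {u : Fin n → ℤ} (hu : InDil m (newtonPolytope g) u) (k : Fin n → ℤ) :
    (p : R) ^ (K + 1) ∣ (cartierSeries p (chainSeries g b (Finsupp.single (m, u) 1)) -
      chainSeries (twist σ g) b (cartierChain hp σ g K (Finsupp.single (m, u) 1))) k := by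
  have hNP := newtonPolytope_twist hg σ
  have hb' : IsVertex (twist σ g) b := by rw [IsVertex, hNP]; exact hb
  have hub := hg b hb
  have hub' := hg.twist σ b hb'
  obtain ⟨hM1, hM2, hM3⟩ := ceil_bounds hp hm
  obtain ⟨M, hM⟩ : ∃ M, (m + p - 1) / p = M + 1 := ⟨_, (Nat.sub_add_cancel hM1).symm⟩
  rw [hM] at hM2
  set X := chainSeries g b (Finsupp.single (m, u) 1) with hX
  set g' := twist σ g with hg'
  set Y := chainSeries g' b (cartierChain hp σ g K (Finsupp.single (m, u) 1)) with hY
  set G := frobDiff p σ g with hG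
  set A := dilate p g' with hA
  have hX1 : g ^ m • X =
      ((m - 1).factorial : R) • ((AddMonoidAlgebra.single u 1 : Laurent n R) • Series.one) := by
    rw [hX, ← level_single]
    exact pow_smul_chainSeries_level hb hub m _
  have hXm : X ∈ formalSeries R (newtonPolytope g) b :=
    chainSeries_mem hb hub (single_mem_chains hm hu 1)
  have hYm : Y ∈ formalSeries R (newtonPolytope g') b := by
    refine chainSeries_mem hb' hub' ?_
    rw [hNP]
    exact cartierChain_mem hp hσ (convex_newtonPolytope g) (absorbs_self (convex_newtonPolytope g))
      (suppIn_newtonPolytope g) K (single_mem_chains hm hu 1)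
  have hcm : cartierSeries p X ∈ formalSeries R (newtonPolytope g') b := by
    intro k hk
    obtain ⟨c, hc, y, hy, e⟩ := hXm _ hk
    have hp' : (p : ℝ) ≠ 0 := by exact_mod_cast hp.ne_zero
    refine ⟨c / p, by positivity, y, hNP ▸ hy, ?_⟩
    apply smul_right_injective _ hp'
    change (p : ℝ) • toReal k = (p : ℝ) • _
    rw [smul_smul, mul_div_cancel₀ _ hp', ← e, toReal_zsmul]
    norm_num
  -- Both series are supported in the cone, so the congruence may be tested after multiplying by
  -- `g'^(M+1+K)`, which clears every denominator of the truncated sum.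
  refine dvd_of_dvd_pow_smul hb' hub' (Submodule.sub_mem _ hcm hYm) (M + 1 + K) ?_ k
  set x : Laurent n R := AddMonoidAlgebra.single u 1 with hx
  set h := g ^ (p * (M + 1) - m) with hh
  have hAt : A - (p : R) • G = g ^ p := by
    rw [hA, hg', dilate_twist hp hσ, hG]; abel
  -- With `t = pG` the remainder of the truncated binomial series carries the factor `p^(K+1)`.
  obtain ⟨H, hH⟩ := exists_binomial_eq A ((p : R) • G) M K
  rw [hAt] at hH
  set S := ∑ r ∈ Finset.range (K + 1), ((M + r).choose r : Laurent n R) * ((p : R) • G) ^ r * A ^ (K - r)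
    with hS
  -- Multiplication by `g'` before taking the Cartier image of `X` becomes multiplication by `A =
  -- g'(x^p)` inside it, and the binomial identity splits the power of `A` into main term and
  -- remainder.
  have hL : g' ^ (M + 1 + K) • cartierSeries p X =
      cartierSeries p (((m - 1).factorial : R) • ((S * h * x) • Series.one)) +
        (p : R) ^ (K + 1) • cartierSeries p ((G ^ (K + 1) * H) • X) := by
    rw [← cartierSeries_dilate_smul, map_pow, ← hA, hH, ← cartierSeries_smul, ← cartierSeries_add]
    congr 1
    rw [add_smul]
    congr 1
    · have e : (g ^ p) ^ (M + 1) * S = (S * h) * g ^ m := by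
        rw [← pow_mul, hh, mul_assoc, ← pow_add, Nat.sub_add_cancel hM2, mul_comm]
      rw [e, mul_smul, hX1, smul_comm, mul_smul (S * h)]
    · rw [smul_pow, smul_mul_assoc, smul_assoc]
  -- The truncated operator reproduces precisely the main term, so only the remainder is left in the
  -- difference.
  have hR : g' ^ (M + 1 + K) • Y =
      cartierSeries p (((m - 1).factorial : R) • ((S * h * x) • Series.one)) := by
    rw [hY, cartierChain_single, one_smul, map_sum, Finset.smul_sum]
    have hterm : ∀ r ∈ Finset.range (K + 1),
        g' ^ (M + 1 + K) • chainSeries g' b (cartierCoeff p R m r •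
          level ((m + p - 1) / p + r) (cartierNumerator hp σ g m u r)) =
        cartierSeries p ((((m - 1).factorial : R) •
          (((M + r).choose r : Laurent n R) * ((p : R) • G) ^ r * A ^ (K - r) * h * x)) •
            Series.one) := by
      intro r hr
      have hrK : r ≤ K := Nat.lt_succ_iff.1 (Finset.mem_range.1 hr)
      have e1 : g' ^ (M + 1 + K) = g' ^ (K - r) * g' ^ (M + 1 + r) := by
        rw [← pow_add]; congr 1; omega
      rw [map_smul, smul_comm, e1, mul_smul, hM, pow_smul_chainSeries_level hb' hub',
        cartierNumerator, ← cartierSeries_smul_one hp.ne_zero, ← cartierSeries_smul,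
        ← cartierSeries_dilate_smul, ← cartierSeries_smul, map_pow, ← hA]
      congr 1
      rw [show M + 1 + r - 1 = M + r by omega, smul_comm (A ^ (K - r)), smul_smul,
        cartierCoeff_mul_factorial hp hp2 hm hM, ← mul_smul, ← hG, hM, ← hx, ← hh,
        mul_assoc, mul_smul, ← smul_assoc ((M + r).choose r * (p : R) ^ r),
        smul_assoc (((m - 1).factorial : R))]
      congr 2
      rw [mul_smul, Nat.cast_smul_eq_nsmul, nsmul_eq_mul]
      simp only [Algebra.smul_def, mul_pow, map_pow]
      ring
    rw [Finset.sum_congr rfl hterm, ← cartierSeries_sum, ← Finset.sum_smul, ← Finset.smul_sum,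
      smul_assoc, hS, Finset.sum_mul, Finset.sum_mul]
  intro k
  rw [smul_sub, hL, hR, add_sub_cancel_left]
  exact Dvd.intro _ rfl

end Cartier

end UnitRoot

namespace UnitRoot

variable {n : ℕ} {R : Type*} [CommRing R]

/-! ### Congruences for the Cartier operator on chains -/

theorem exists_smul_chain {μ : Set (Fin n → ℝ)} {r : R} {w : Chain n R} (hw : w ∈ chains R μ)
    (h : ∀ i, r ∣ w i) : ∃ w' ∈ chains R μ, w = r • w' := by
  obtain ⟨w', e, hs⟩ := exists_smul_of_forall_dvd h
  exact ⟨w', fun i hi => hw (hs hi), e⟩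

theorem exists_level_one_add {μ : Set (Fin n → ℝ)} {r : R} {w : Chain n R} (hw : w ∈ chains R μ)
    (h : ∀ i : ℕ × (Fin n → ℤ), i.1 ≠ 1 → r ∣ w i) :
    ∃ P : Laurent n R, SuppIn 1 μ P ∧ ∃ w' ∈ chains R μ, w = level 1 P + r • w' := by
  set P : Laurent n R := AddMonoidAlgebra.ofCoeff
    (w.comapDomain (Prod.mk 1) (Prod.mk_right_injective 1).injOn) with hP
  have hPc : ∀ v, P.coeff v = w (1, v) := fun v => rfl
  have hPs : SuppIn 1 μ P := fun v hv => (mem_chains.1 hw (1, v) hv).2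
  obtain ⟨w', hw', e⟩ := exists_smul_chain
    (Submodule.sub_mem _ hw (level_mem le_rfl hPs)) (r := r) (by
      rintro ⟨j, v⟩
      rw [Finsupp.sub_apply]
      by_cases hj : j = 1
      · subst hj
        rw [level_apply_self, hPc, sub_self]
        exact dvd_zero r
      · rw [level_apply_of_ne hj, sub_zero]
        exact h (j, v) hj)
  exact ⟨P, hPs, w', hw', by rw [← e]; abel⟩

/-- Chains whose coefficients satisfying a condition are divisible by `r`. -/
def dvdChains (r : R) (s : Set (ℕ × (Fin n → ℤ))) : Submodule R (Chain n R) where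
  carrier := {w | ∀ i ∈ s, r ∣ w i}
  add_mem' h h' i hi := dvd_add (h i hi) (h' i hi)
  zero_mem' _ _ := dvd_zero r
  smul_mem' c _ h i hi := (h i hi).mul_left c

theorem map_mem_dvdChains {r : R} {w : Chain n R} (T : Chain n R →ₗ[R] Chain n R)
    (h : ∀ i, r ∣ w i) (i : ℕ × (Fin n → ℤ)) : r ∣ T w i := by
  obtain ⟨w', rfl, -⟩ := exists_smul_of_forall_dvd h
  rw [map_smul, Finsupp.smul_apply]
  exact Dvd.intro _ rfl

section Cartier

variable {p : ℕ} (hp : p.Prime) {σ : R →+* R} [IsAdicComplete (Ideal.span {(p : R)}) R]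

/-- Pole order one arises only from `⌈m/p⌉ = 1` and `r = 0`. For `r ≥ 1` the factor `p^r/r!` is
divisible by `p`; for `r = 0` and `⌈m/p⌉ > 1` the quotient of factorials is. Hence modulo `p` the
Cartier operator maps into pole order one. -/
theorem dvd_cartierCoeff {m r : ℕ} (hp : p.Prime) (hp2 : 2 < p) (hm : 1 ≤ m)
    (h : (m + p - 1) / p + r ≠ 1) : (p : R) ∣ cartierCoeff p R m r := by
  obtain ⟨h1, h2, h3⟩ := ceil_bounds hp hm
  rcases Nat.eq_zero_or_pos r with rfl | hr
  · refine Dvd.dvd.mul_right ?_ _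
    refine Nat.cast_dvd_cast ?_
    set k := (m + p - 1) / p - 1 with hk
    have hk1 : 1 ≤ k := by omega
    -- Here `(pk)!` divides `(m-1)!`, and `(pk)! = pk · (pk-1)!` with `k!` dividing `(pk-1)!`.
    refine Nat.dvd_div_of_mul_dvd (dvd_trans ?_ (Nat.factorial_dvd_factorial h3))
    have hpk : k ≤ p * k - 1 := by
      have : 2 * k ≤ p * k := Nat.mul_le_mul_right _ (by omega)
      omega
    have e : p * k = (p * k - 1) + 1 := by
      have : 1 ≤ p * k := Nat.mul_pos hp.pos hk1
      omega
    rw [e, Nat.factorial_succ, ← e, mul_comm]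
    exact Nat.mul_dvd_mul (Dvd.intro _ rfl) (Nat.factorial_dvd_factorial hpk)
  · refine Dvd.dvd.mul_left ?_ _
    simpa using pow_dvd_dividedPower (R := R) p hp hp2 (r := r) (s := 1) (by omega)

theorem dvd_cartierChain_of_ne (hp2 : 2 < p) (g : Laurent n R) (K : ℕ) {μ : Set (Fin n → ℝ)}
    {w : Chain n R} (hw : w ∈ chains R μ) (i : ℕ × (Fin n → ℤ)) (hi : i.1 ≠ 1) :
    (p : R) ∣ cartierChain hp σ g K w i := by
  refine linearMap_mem_of_chains _ (dvdChains (p : R) {i | i.1 ≠ 1}) (fun m u hm _ => ?_) hw i hi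
  rw [cartierChain_single, one_smul]
  refine Submodule.sum_mem _ fun r _ => ?_
  rintro ⟨j, v⟩ hj
  rw [Finsupp.smul_apply, smul_eq_mul]
  by_cases h : j = (m + p - 1) / p + r
  · exact (dvd_cartierCoeff hp hp2 hm (h ▸ hj)).mul_right _
  · rw [level_apply_of_ne h, mul_zero]
    exact dvd_zero _

/-- Only the term `r = 0` has pole order one; its coefficient is `1` and its numerator is the
contraction of `x^u g^(p-1)`. So the Hasse–Witt matrix describes the Cartier operator in pole order
one. -/
theorem cartierChain_single_one_apply (hp2 : 2 < p) (g : Laurent n R) (K : ℕ) (u v : Fin n → ℤ) :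
    cartierChain hp σ g K (Finsupp.single (1, u) 1) (1, v) =
      (g ^ (p - 1)).coeff ((p : ℤ) • v - u) := by
  have hM : (1 + p - 1) / p = 1 := by rw [Nat.add_sub_cancel_left, Nat.div_self hp.pos]
  rw [cartierChain_single, one_smul, Finsupp.finsetSum_apply, Finset.sum_eq_single 0]
  · rw [Finsupp.smul_apply, hM, add_zero, level_apply_self, cartierNumerator, coeff_contract, hM,
      cartierCoeff, hM, dividedPower_zero p hp hp2, pow_zero, mul_one, mul_one]
    rw [show (p : ℤ) • v = u + ((p : ℤ) • v - u) by abel, AddMonoidAlgebra.coeff_single_mul_add]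
    simp
  · intro r _ hr
    rw [Finsupp.smul_apply, hM, level_apply_of_ne (by omega), smul_zero]
  · intro h
    exact absurd (Finset.mem_range.2 (Nat.succ_pos K)) h

/-- The omitted terms have `r ≥ K + 1` and carry `p^r/r!`, which is divisible by `p^⌈r/2⌉`. On
chains the truncations thus converge at half the rate seen on expansions, because the factorials are
part of the symbols. -/
theorem pow_dvd_cartierChain_sub (hp2 : 2 < p) (g : Laurent n R) {s K K' : ℕ} (hK : K ≤ K')
    (hs : 2 * s ≤ K + 2) (w : Chain n R) (i : ℕ × (Fin n → ℤ)) :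
    (p : R) ^ s ∣ (cartierChain hp σ g K' w - cartierChain hp σ g K w) i := by
  have h : ∀ w, cartierChain hp σ g K' w - cartierChain hp σ g K w ∈
      dvdChains ((p : R) ^ s) (Set.univ : Set (ℕ × (Fin n → ℤ))) := by
    intro w
    induction w using Finsupp.induction_linear with
    | zero => rw [map_zero, map_zero, sub_zero]; exact Submodule.zero_mem _
    | add w w' h1 h2 =>
      rw [map_add, map_add, add_sub_add_comm]
      exact Submodule.add_mem _ h1 h2
    | single j c =>
      rw [cartierChain_single, cartierChain_single, ← smul_sub,
        ← Finset.sum_sdiff_eq_sub (Finset.range_mono (by omega))]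
      refine Submodule.smul_mem _ _ (Submodule.sum_mem _ fun r hr i _ => ?_)
      rw [Finset.mem_sdiff, Finset.mem_range, Finset.mem_range] at hr
      rw [Finsupp.smul_apply, smul_eq_mul]
      refine Dvd.dvd.mul_right (Dvd.dvd.mul_left ?_ _) _
      exact pow_dvd_dividedPower p hp hp2 (by omega)
  exact h w i trivial

variable [IsDomain R] [CharZero R]

theorem pow_dvd_cartierSeries_sub (hp2 : 2 < p) (hσ : IsFrobeniusLift p σ) {g : Laurent n R}
    (hg : UnitVertices g) {b : Fin n → ℤ} (hb : IsVertex g b) (K : ℕ) {w : Chain n R}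
    (hw : w ∈ chains R (newtonPolytope g)) (k : Fin n → ℤ) :
    (p : R) ^ (K + 1) ∣ (cartierSeries p (chainSeries g b w) -
      chainSeries (twist σ g) b (cartierChain hp σ g K w)) k := by
  refine chains_induction (C := fun w => (p : R) ^ (K + 1) ∣ (cartierSeries p (chainSeries g b w) -
      chainSeries (twist σ g) b (cartierChain hp σ g K w)) k) ?_ ?_ ?_ hw
  · rw [map_zero, map_zero, map_zero, sub_zero]; exact dvd_zero _
  · intro w w' h1 h2
    rw [map_add, map_add, map_add, cartierSeries_add, add_sub_add_comm]
    exact dvd_add h1 h2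
  · intro m u c hm hu
    rw [show (Finsupp.single (m, u) c : Chain n R) = c • Finsupp.single (m, u) 1 by simp, map_smul,
      map_smul, map_smul, cartierSeries_smul, ← smul_sub]
    exact (chainSeries_cartierChain_single hp hp2 hσ hg hb K hm hu k).mul_left c

end Cartier

/-! ### Restriction of chains to a face -/

open Classical in
/-- The part of a chain over the face `η`. -/
def faceChain (η : Set (Fin n → ℝ)) : Chain n R →ₗ[R] Chain n R where
  toFun w := w.filter fun i => InDil i.1 η i.2
  map_add' _ _ := Finsupp.filter_add
  map_smul' _ _ := Finsupp.filter_smul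

open Classical in
theorem faceChain_apply (η : Set (Fin n → ℝ)) (w : Chain n R) (i : ℕ × (Fin n → ℤ)) :
    faceChain η w i = if InDil i.1 η i.2 then w i else 0 :=
  Finsupp.filter_apply _ _ _

theorem faceChain_mem {μ η : Set (Fin n → ℝ)} {w : Chain n R} (hw : w ∈ chains R μ) :
    faceChain η w ∈ chains R (μ ∩ η) := by
  classical
  rw [mem_chains]
  intro i hi
  rw [faceChain_apply] at hi
  have h1 : InDil i.1 η i.2 := by by_contra h; exact hi (if_neg h)
  rw [if_pos h1] at hi
  obtain ⟨hm, y, hy, e⟩ := mem_chains.1 hw i hi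
  obtain ⟨z, hz, e'⟩ := h1
  have hm' : (i.1 : ℝ) ≠ 0 := by exact_mod_cast (show i.1 ≠ 0 by omega)
  have hyz : y = z := smul_right_injective _ hm' (e.symm.trans e')
  exact ⟨hm, y, ⟨hy, hyz ▸ hz⟩, e⟩

theorem faceChain_level {Δ η : Set (Fin n → ℝ)} {k : ℕ} {P P' : Laurent n R}
    (h : IsInit Δ η k P P') : faceChain η (level k P) = level k P' := by
  classical
  ext ⟨j, v⟩
  rw [faceChain_apply]
  by_cases hj : j = k
  · subst hj
    rw [level_apply_self, level_apply_self]
    split_ifs with hv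
    · exact h.coeff_eq v hv
    · by_contra h0
      exact hv (h.supp' v (Ne.symm h0))
  · rw [level_apply_of_ne hj, level_apply_of_ne hj, ite_self]

theorem faceChain_single_of_mem {η : Set (Fin n → ℝ)} {m : ℕ} {u : Fin n → ℤ} (hu : InDil m η u)
    (c : R) : faceChain η (Finsupp.single (m, u) c) = Finsupp.single (m, u) c := by
  classical exact Finsupp.filter_single_of_pos _ hu

theorem faceChain_single_of_notMem {η : Set (Fin n → ℝ)} {m : ℕ} {u : Fin n → ℤ}
    (hu : ¬ InDil m η u) (c : R) : faceChain η (Finsupp.single (m, u) c) = 0 := by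
  classical exact Finsupp.filter_single_of_neg _ hu

theorem faceChain_comm {Δ η : Set (Fin n → ℝ)} (S T : Chain n R →ₗ[R] Chain n R)
    (h1 : ∀ m u, 1 ≤ m → InDil m η u → faceChain η (S (Finsupp.single (m, u) 1)) =
      T (Finsupp.single (m, u) 1))
    (h2 : ∀ m u, 1 ≤ m → InDil m Δ u → ¬ InDil m η u →
      faceChain η (S (Finsupp.single (m, u) 1)) = 0)
    {w : Chain n R} (hw : w ∈ chains R Δ) : faceChain η (S w) = T (faceChain η w) := by
  rw [← sub_eq_zero]
  have := linearMap_mem_of_chains (faceChain η ∘ₗ S - T ∘ₗ faceChain η) ⊥ (fun m u hm hu => by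
    rw [Submodule.mem_bot, LinearMap.sub_apply, LinearMap.comp_apply, LinearMap.comp_apply]
    by_cases hu' : InDil m η u
    · rw [faceChain_single_of_mem hu', h1 m u hm hu', sub_self]
    · rw [faceChain_single_of_notMem hu', map_zero, h2 m u hm hu hu', sub_self]) hw
  exact (Submodule.mem_bot R).1 this

section CartierFace

variable {p : ℕ} (hp : p.Prime) {σ : R →+* R} [IsDomain R] [CharZero R]

/-- The polynomial `x` is the initial part of `x^u`: the monomial itself if `u` lies on the dilated
face, and zero otherwise. One statement serves both cases. -/
theorem isInit_cartierNumerator (hσ : IsFrobeniusLift p σ) {Δ η : Set (Fin n → ℝ)}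
    (hΔ : Convex ℝ Δ) (hη : IsExtreme ℝ Δ η) (hη' : Convex ℝ η) (hne : η.Nonempty)
    {f h : Laurent n R} (hf : IsInit Δ η 1 f h) {m : ℕ} (hm : 1 ≤ m) (u : Fin n → ℤ) (r : ℕ)
    {x : Laurent n R} (hx : IsInit Δ η m (AddMonoidAlgebra.single u 1) x) :
    IsInit Δ η ((m + p - 1) / p + r) (cartierNumerator hp σ f m u r)
      (contract hp.ne_zero (x * h ^ (p * ((m + p - 1) / p) - m) * frobDiff p σ h ^ r)) := by
  refine IsInit.contract hp.ne_zero ?_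
  have h1 := (hx.mul hΔ hη hη' (hf.pow hΔ hη hη' hne (p * ((m + p - 1) / p) - m))).mul hΔ hη hη'
    ((hf.frobDiff hp hσ hΔ hη hη' hne).pow hΔ hη hη' hne r)
  have e : m + (p * ((m + p - 1) / p) - m) * 1 + r * p = p * ((m + p - 1) / p + r) := by
    rw [mul_one, Nat.add_sub_cancel' (ceil_bounds hp hm).2.1]; ring
  rwa [e] at h1

/-- Every ingredient of the numerators (monomials, powers of `f`, `frobDiff`, contraction) is
compatible with initial parts, and the coefficients depend only on `m` and `r`. A symbol off the
face gives numerators with initial part zero. -/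
theorem faceChain_cartierChain (hσ : IsFrobeniusLift p σ) {Δ η : Set (Fin n → ℝ)}
    (hΔ : Convex ℝ Δ) (hη : IsExtreme ℝ Δ η) (hη' : Convex ℝ η) (hne : η.Nonempty)
    {f h : Laurent n R} (hf : IsInit Δ η 1 f h) (K : ℕ) {w : Chain n R} (hw : w ∈ chains R Δ) :
    faceChain η (cartierChain hp σ f K w) = cartierChain hp σ h K (faceChain η w) := by
  refine faceChain_comm (cartierChain hp σ f K) (cartierChain hp σ h K) (fun m u hm hu => ?_)
    (fun m u hm hu hu' => ?_) hw
  · rw [cartierChain_single, cartierChain_single, one_smul, one_smul, map_sum]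
    refine Finset.sum_congr rfl fun r _ => ?_
    rw [map_smul, faceChain_level (isInit_cartierNumerator hp hσ hΔ hη hη' hne hf hm u r
      (IsInit.single hη.1 hu 1))]
    rfl
  · rw [cartierChain_single, one_smul, map_sum]
    refine Finset.sum_eq_zero fun r _ => ?_
    rw [map_smul, faceChain_level (isInit_cartierNumerator hp hσ hΔ hη hη' hne hf hm u r
      (IsInit.single_zero hu hu' 1)), zero_mul, zero_mul]
    have : contract hp.ne_zero (0 : Laurent n R) = 0 := by ext; rfl
    rw [this, map_zero, smul_zero]

end CartierFace

end UnitRoot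

namespace UnitRoot

variable {n : ℕ} {R : Type*} [CommRing R]

/-! ### Iterates of the Cartier operator -/

theorem UnitVertices.iterate [Nontrivial R] {g : Laurent n R} (hg : UnitVertices g) (σ : R →+* R)
    (i : ℕ) : UnitVertices ((UnitRoot.twist σ)^[i] g) := by
  induction i with
  | zero => exact hg
  | succ i ih => rw [Function.iterate_succ_apply']; exact ih.twist σ

theorem newtonPolytope_iterate [Nontrivial R] {g : Laurent n R} (hg : UnitVertices g)
    (σ : R →+* R) (i : ℕ) : newtonPolytope ((twist σ)^[i] g) = newtonPolytope g := by
  induction i with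
  | zero => rfl
  | succ i ih =>
    rw [Function.iterate_succ_apply', newtonPolytope_twist (hg.iterate σ i), ih]

theorem IsVertex.iterate [Nontrivial R] {g : Laurent n R} (hg : UnitVertices g) {b : Fin n → ℤ}
    (hb : IsVertex g b) (σ : R →+* R) (i : ℕ) : IsVertex ((twist σ)^[i] g) b := by
  rw [IsVertex, newtonPolytope_iterate hg]
  exact hb

theorem suppIn_iterate [Nontrivial R] {g : Laurent n R} (hg : UnitVertices g) (σ : R →+* R)
    (i : ℕ) : SuppIn 1 (newtonPolytope g) ((twist σ)^[i] g) := by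
  rw [← newtonPolytope_iterate hg σ i]
  exact suppIn_newtonPolytope _

theorem IsInit.iterate {Δ η : Set (Fin n → ℝ)} {N : ℕ} {f h : Laurent n R}
    (hf : IsInit Δ η N f h) (σ : R →+* R) (i : ℕ) :
    IsInit Δ η N ((UnitRoot.twist σ)^[i] f) ((UnitRoot.twist σ)^[i] h) := by
  induction i with
  | zero => exact hf
  | succ i ih =>
    rw [Function.iterate_succ_apply', Function.iterate_succ_apply']
    exact ih.twist σ

/-! ### Divisibility conditions and chains of pole order one -/

theorem dvd_smul_series {r : R} (g : Laurent n R) {E : Series n R} (h : ∀ k, r ∣ E k)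
    (k : Fin n → ℤ) : r ∣ (g • E) k := by
  rw [smul_apply]
  exact Finset.dvd_sum fun a _ => (h _).mul_left _

/-- A series whose coefficients have the divisibility of those of a formal derivative, up to
`p ^ s`. -/
def IsFormalUpTo (p s : ℕ) (E : Series n R) : Prop :=
  ∀ i ≤ s, ∀ k, (p : R) ^ i ∣ E ((p : ℤ) ^ i • k)

/-- The lattice points of `μ`. -/
abbrev Lat (μ : Set (Fin n → ℝ)) : Type := {u : Fin n → ℤ // toReal u ∈ μ}

section Lattice

variable {μ : Set (Fin n → ℝ)} [Fintype (Lat μ)]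

/-- The chain `∑ a_u (1, u)` over the lattice points of `μ`. -/
def latChain : (Lat μ → R) →ₗ[R] Chain n R :=
  Fintype.linearCombination R fun u : Lat μ => Finsupp.single (1, u.1) 1

theorem latChain_apply (a : Lat μ → R) :
    latChain a = ∑ u, a u • (Finsupp.single (1, u.1) 1 : Chain n R) :=
  Fintype.linearCombination_apply _ _ _

theorem latChain_mem (a : Lat μ → R) : latChain a ∈ chains R μ := by
  rw [latChain_apply]
  exact Submodule.sum_mem _ fun u _ =>
    Submodule.smul_mem _ _ (single_mem_chains le_rfl (inDil_one.2 u.2) 1)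

theorem latChain_apply_mk (a : Lat μ → R) (u : Lat μ) : latChain a (1, u.1) = a u := by
  classical
  rw [latChain_apply, Finsupp.finsetSum_apply, Finset.sum_eq_single u]
  · simp
  · intro v _ hv
    rw [Finsupp.smul_apply, Finsupp.single_eq_of_ne, smul_zero]
    exact fun h => hv (Subtype.ext (congrArg Prod.snd h).symm)
  · exact fun h => absurd (Finset.mem_univ u) h

theorem latChain_apply_of_ne (a : Lat μ → R) {i : ℕ × (Fin n → ℤ)} (hi : i.1 ≠ 1) :
    latChain a i = 0 := by
  rw [latChain_apply, Finsupp.finsetSum_apply]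
  refine Finset.sum_eq_zero fun v _ => ?_
  rw [Finsupp.smul_apply, Finsupp.single_eq_of_ne, smul_zero]
  exact fun h => hi (congrArg Prod.fst h)

end Lattice

theorem hasseWittOn_twist (p : ℕ) (σ : R →+* R) (g : Laurent n R) (μ : Set (Fin n → ℝ)) :
    hasseWittOn p (twist σ g) μ = (hasseWittOn p g μ).map σ := by
  ext u v
  rw [Matrix.map_apply, hasseWittOn, hasseWittOn, ← coeff_twist]
  simp only [twist, map_pow]

theorem isUnit_hasseWittOn_iterate {p : ℕ} {σ : R →+* R} {μ : Set (Fin n → ℝ)} [Fintype (Lat μ)]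
    [DecidableEq (Lat μ)] {g : Laurent n R} (h : IsUnit (hasseWittOn p g μ)) (i : ℕ) :
    IsUnit (hasseWittOn p ((twist σ)^[i] g) μ) := by
  induction i with
  | zero => exact h
  | succ i ih =>
    rw [Function.iterate_succ_apply', hasseWittOn_twist]
    exact ih.map σ.mapMatrix

section Iterates

variable {p : ℕ} (hp : p.Prime) (σ : R →+* R)

/-- Iterates of the (truncated) Cartier operator. -/
def cartierPow (g : Laurent n R) (K : ℕ) : ℕ → (Chain n R →ₗ[R] Chain n R)
  | 0 => LinearMap.id
  | i + 1 => cartierChain hp σ ((twist σ)^[i] g) K ∘ₗ cartierPow g K i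

theorem cartierPow_succ_apply (g : Laurent n R) (K i : ℕ) (w : Chain n R) :
    cartierPow hp σ g K (i + 1) w =
      cartierChain hp σ ((twist σ)^[i] g) K (cartierPow hp σ g K i w) := rfl

variable {σ} [IsDomain R] [CharZero R]

theorem cartierPow_mem (hσ : IsFrobeniusLift p σ) {g : Laurent n R} (hg : UnitVertices g)
    {μ : Set (Fin n → ℝ)} (hμ : Absorbs (newtonPolytope g) μ) (K i : ℕ) {w : Chain n R}
    (hw : w ∈ chains R μ) : cartierPow hp σ g K i w ∈ chains R μ := by
  induction i with
  | zero => exact hw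
  | succ i ih =>
    exact cartierChain_mem hp hσ (convex_newtonPolytope g) hμ (suppIn_iterate hg σ i) K ih

theorem faceChain_cartierPow (hσ : IsFrobeniusLift p σ) {f h : Laurent n R}
    {η : Set (Fin n → ℝ)} (hf : UnitVertices f) (hη : IsFace (newtonPolytope f) η)
    (hfh : IsInit (newtonPolytope f) η 1 f h) (K i : ℕ) {w : Chain n R}
    (hw : w ∈ chains R (newtonPolytope f)) :
    faceChain η (cartierPow hp σ f K i w) = cartierPow hp σ h K i (faceChain η w) := by
  have hc := convex_newtonPolytope f
  induction i with
  | zero => rfl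
  | succ i ih =>
    rw [cartierPow_succ_apply, cartierPow_succ_apply, ← ih]
    exact faceChain_cartierChain hp hσ hc hη.1.isExtreme (hη.convex hc) hη.2 (hfh.iterate σ i) K
      (cartierPow_mem hp hσ hf (absorbs_self hc) K i hw)

variable [IsAdicComplete (Ideal.span {(p : R)}) R]

/-- The coefficient at `p^i k` of a series is the coefficient at `k` of its `i`-fold Cartier image.
Each application contributes an error divisible by the same `p^(K+1)`, so iterating loses no
precision. -/
theorem pow_dvd_chainSeries_cartierPow (hp2 : 2 < p) (hσ : IsFrobeniusLift p σ) {g : Laurent n R}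
    (hg : UnitVertices g) {b : Fin n → ℤ} (hb : IsVertex g b) (K i : ℕ) {w : Chain n R}
    (hw : w ∈ chains R (newtonPolytope g)) (k : Fin n → ℤ) :
    (p : R) ^ (K + 1) ∣ chainSeries g b w ((p : ℤ) ^ i • k) -
      chainSeries ((twist σ)^[i] g) b (cartierPow hp σ g K i w) k := by
  induction i generalizing k with
  | zero => rw [pow_zero, one_smul]; exact (sub_self (chainSeries g b w k)).symm ▸ dvd_zero _
  | succ i ih =>
    have h1 := ih ((p : ℤ) • k)
    have h2 := pow_dvd_cartierSeries_sub hp hp2 hσ (hg.iterate σ i) (hb.iterate hg σ i) K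
      (w := cartierPow hp σ g K i w) (by
        rw [newtonPolytope_iterate hg]
        exact cartierPow_mem hp hσ hg (absorbs_self (convex_newtonPolytope g)) K i hw) k
    rw [cartierPow_succ_apply, Function.iterate_succ_apply']
    rw [smul_smul, ← pow_succ] at h1
    have h3 := dvd_add h1 h2
    rw [Pi.sub_apply, cartierSeries, sub_add_sub_cancel] at h3
    exact h3

/-- Chains whose expansion at a vertex is divisible like a formal derivative are characterized by
the divisibility of their images under the Cartier operators.  This does not depend on the
vertex. -/
theorem isFormalUpTo_iff (hp2 : 2 < p) (hσ : IsFrobeniusLift p σ) {g : Laurent n R}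
    (hg : UnitVertices g) {b : Fin n → ℤ} (hb : IsVertex g b) {s K : ℕ} (hK : s ≤ K + 1)
    {w : Chain n R} (hw : w ∈ chains R (newtonPolytope g)) :
    IsFormalUpTo p s (chainSeries g b w) ↔
      ∀ i ≤ s, ∀ j, (p : R) ^ i ∣ cartierPow hp σ g K i w j := by
  have habs := absorbs_self (convex_newtonPolytope g)
  have hcong : ∀ i ≤ s, ∀ k, (p : R) ^ i ∣ chainSeries g b w ((p : ℤ) ^ i • k) -
      chainSeries ((twist σ)^[i] g) b (cartierPow hp σ g K i w) k := fun i hi k =>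
    (pow_dvd_pow _ (hi.trans hK)).trans
      (pow_dvd_chainSeries_cartierPow hp hp2 hσ hg hb K i hw k)
  constructor
  · intro h i
    induction i with
    | zero => intro _ j; rw [pow_zero]; exact one_dvd _
    | succ i ih =>
      intro hi
      -- After division by `p^i` one more Cartier step gives, modulo `p`, a chain `level 1 P`. The
      -- hypothesis on coefficients at `p^(i+1) k` says that its expansion is divisible by `p`.
      obtain ⟨w', hw', e⟩ := exists_smul_chain (cartierPow_mem hp hσ hg habs K i hw)
        (ih (by omega))
      have hCw' := cartierChain_mem hp hσ (convex_newtonPolytope g) habs (suppIn_iterate hg σ i) K hw'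
      obtain ⟨P, hP, w'', hw'', e'⟩ := exists_level_one_add hCw'
        (dvd_cartierChain_of_ne hp hp2 ((twist σ)^[i] g) K hw')
      have e2 : cartierPow hp σ g K (i + 1) w = (p : R) ^ i • (level 1 P + (p : R) • w'') := by
        rw [cartierPow_succ_apply, e, map_smul, e']
      set g' := (twist σ)^[i + 1] g with hg'
      have hb' : IsVertex g' b := hb.iterate hg σ (i + 1)
      have hpi : (p : R) ^ i ≠ 0 := pow_ne_zero _ (by exact_mod_cast hp.ne_zero)
      have h1 : ∀ k, (p : R) ∣ chainSeries g' b (level 1 P) k := by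
        intro k
        have h2 := (dvd_sub_right (h (i + 1) hi k)).1 (hcong (i + 1) hi k)
        rw [e2, map_smul, map_add, map_smul, Pi.smul_apply, smul_eq_mul, pow_succ,
          mul_dvd_mul_iff_left hpi] at h2
        exact (dvd_add_left (Dvd.intro _ rfl)).1 h2
      -- One multiplication by `g'` clears the simple pole and turns the expansion into `P` itself.
      -- Higher poles would leave a factorial here, which is why pole order one matters.
      have h3 : ∀ v, (p : R) ∣ P.coeff v := by
        intro v
        have h4 := dvd_smul_series (g' ^ 1) h1 v
        rw [pow_smul_chainSeries_level hb' (hg.iterate σ (i + 1) b hb'), Nat.sub_self,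
          Nat.factorial_zero, Nat.cast_one, one_smul, smul_one_apply] at h4
        exact h4
      obtain ⟨Q, rfl⟩ := exists_smul_of_forall_dvd_coeff h3
      intro j
      rw [e2, map_smul, ← smul_add, smul_smul, ← pow_succ]
      exact Dvd.intro _ rfl
  · intro h i hi k
    obtain ⟨w', e, -⟩ := exists_smul_of_forall_dvd (h i hi)
    have h1 := hcong i hi k
    rw [e, map_smul] at h1
    exact (dvd_sub_left (Dvd.intro _ rfl)).1 h1

/-! ### The lattice points as a basis -/

section Basis

variable {μ : Set (Fin n → ℝ)} [Fintype (Lat μ)]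

/-- In pole order one the two chains agree exactly, by the computation of the Hasse–Witt entries; in
higher pole order the Cartier image is divisible by `p`. -/
theorem cartierChain_latChain (hp2 : 2 < p) (hσ : IsFrobeniusLift p σ) {Δ : Set (Fin n → ℝ)}
    (hΔ : Convex ℝ Δ) (hμ : Absorbs Δ μ) {g : Laurent n R} (hg : SuppIn 1 Δ g) (K : ℕ)
    (a : Lat μ → R) (j : ℕ × (Fin n → ℤ)) :
    (p : R) ∣ (cartierChain hp σ g K (latChain a) -
      latChain (Matrix.vecMul a (hasseWittOn p g μ))) j := by
  have hm := latChain_mem a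
  have hCm := cartierChain_mem hp hσ hΔ hμ hg K hm
  obtain ⟨m, v⟩ := j
  rw [Finsupp.sub_apply]
  by_cases h1 : m = 1
  · subst h1
    by_cases hv : toReal v ∈ μ
    · have e1 := latChain_apply_mk (Matrix.vecMul a (hasseWittOn p g μ)) ⟨v, hv⟩
      have e2 : cartierChain hp σ g K (latChain a) (1, v) =
          Matrix.vecMul a (hasseWittOn p g μ) ⟨v, hv⟩ := by
        rw [latChain_apply, map_sum, Finsupp.finsetSum_apply]
        refine Finset.sum_congr rfl fun u _ => ?_
        rw [map_smul, Finsupp.smul_apply, cartierChain_single_one_apply hp hp2]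
        rfl
      rw [e1, e2, sub_self]
      exact dvd_zero _
    · have e0 : ∀ w ∈ chains R μ, w (1, v) = 0 := fun w hw => by
        by_contra h
        exact hv (inDil_one.1 (mem_chains.1 hw _ h).2)
      rw [e0 _ hCm, e0 _ (latChain_mem _), sub_self]
      exact dvd_zero _
  · rw [latChain_apply_of_ne _ h1, sub_zero]
    exact dvd_cartierChain_of_ne hp hp2 g K hm _ h1

variable [DecidableEq (Lat μ)]

/-- `B` is the product of the Hasse–Witt matrices of `g` and its successive twists. The later ones
are images of the first under powers of `σ`, hence invertible. -/
theorem exists_matrix_cartierPow (hp2 : 2 < p) (hσ : IsFrobeniusLift p σ) {g : Laurent n R}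
    (hg : UnitVertices g) (hμ : Absorbs (newtonPolytope g) μ) (h : IsUnit (hasseWittOn p g μ))
    (K i : ℕ) : ∃ B : Matrix (Lat μ) (Lat μ) R, IsUnit B ∧ ∀ a j,
      (p : R) ∣ (cartierPow hp σ g K i (latChain a) - latChain (Matrix.vecMul a B)) j := by
  induction i with
  | zero =>
    refine ⟨1, isUnit_one, fun a j => ?_⟩
    rw [Matrix.vecMul_one]
    exact (sub_self (latChain a)).symm ▸ dvd_zero _
  | succ i ih =>
    obtain ⟨B, hB, hBi⟩ := ih
    refine ⟨B * hasseWittOn p ((twist σ)^[i] g) μ, hB.mul (isUnit_hasseWittOn_iterate h i),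
      fun a j => ?_⟩
    have h1 := map_mem_dvdChains (cartierChain hp σ ((twist σ)^[i] g) K) (hBi a) j
    have h2 := cartierChain_latChain hp hp2 hσ (convex_newtonPolytope g) hμ
      (suppIn_iterate hg σ i) K (Matrix.vecMul a B) j
    rw [Matrix.vecMul_vecMul] at h2
    have h3 := dvd_add h1 h2
    rw [map_sub, ← Finsupp.add_apply, sub_add_sub_cancel] at h3
    exact h3

/-- Successive approximation: once the `s`-th Cartier image of `w - latChain a` is `p^s w'`, the
next image is `p^s` times a chain `c` of pole order one, modulo `p^(s+1)`. Solving `a' B = c` gives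
the next correction `p^s a'` of `a`. -/
theorem exists_latChain_sub (hp2 : 2 < p) (hσ : IsFrobeniusLift p σ) {g : Laurent n R}
    (hg : UnitVertices g) (hμ : Absorbs (newtonPolytope g) μ) (h : IsUnit (hasseWittOn p g μ))
    (K s : ℕ) {w : Chain n R} (hw : w ∈ chains R μ) : ∃ a : Lat μ → R, ∀ i ≤ s, ∀ j,
      (p : R) ^ i ∣ cartierPow hp σ g K i (w - latChain a) j := by
  induction s with
  | zero =>
    refine ⟨0, fun i hi j => ?_⟩
    obtain rfl : i = 0 := by omega
    rw [pow_zero]; exact one_dvd _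
  | succ s ih =>
    obtain ⟨a, ha⟩ := ih
    obtain ⟨w', hw', e⟩ := exists_smul_chain
      (cartierPow_mem hp hσ hg hμ K s (Submodule.sub_mem _ hw (latChain_mem a))) (ha s le_rfl)
    obtain ⟨P, hP, w'', -, e'⟩ := exists_level_one_add
      (cartierChain_mem hp hσ (convex_newtonPolytope g) hμ (suppIn_iterate hg σ s) K hw')
      (dvd_cartierChain_of_ne hp hp2 ((twist σ)^[s] g) K hw')
    obtain ⟨B, ⟨B', rfl⟩, hB⟩ := exists_matrix_cartierPow hp hp2 hσ hg hμ h K (s + 1)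
    set c : Lat μ → R := fun u => P.coeff u.1 with hc
    have hPc : level 1 P = latChain c := by
      ext ⟨m, v⟩
      by_cases hm : m = 1
      · subst hm
        rw [level_apply_self]
        by_cases hv : toReal v ∈ μ
        · exact (latChain_apply_mk c ⟨v, hv⟩).symm
        · have h1 : P.coeff v = 0 := by
            by_contra h; exact hv (inDil_one.1 (hP v h))
          have h2 : latChain c (1, v) = 0 := by
            by_contra h; exact hv (inDil_one.1 (mem_chains.1 (latChain_mem c) _ h).2)
          rw [h1, h2]
      · rw [level_apply_of_ne hm, latChain_apply_of_ne c hm]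
    set a' := Matrix.vecMul c (↑B'⁻¹ : Matrix (Lat μ) (Lat μ) R) with ha'
    have hac : Matrix.vecMul a' (B' : Matrix (Lat μ) (Lat μ) R) = c := by
      rw [ha', Matrix.vecMul_vecMul, Units.inv_mul, Matrix.vecMul_one]
    refine ⟨a + (p : R) ^ s • a', fun i hi j => ?_⟩
    rw [map_add, map_smul, ← sub_sub, map_sub, map_smul, Finsupp.sub_apply, Finsupp.smul_apply,
      smul_eq_mul]
    rcases Nat.lt_or_ge s i with hsi | hsi
    · obtain rfl : i = s + 1 := by omega
      have h1 := hB a' j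
      rw [hac] at h1
      rw [cartierPow_succ_apply, e, map_smul, e', hPc, Finsupp.smul_apply, smul_eq_mul, ← mul_sub,
        pow_succ]
      refine mul_dvd_mul_left _ ?_
      rw [Finsupp.sub_apply, ← dvd_neg, neg_sub] at h1
      have h2 : (p : R) ∣ (p : R) * w'' j := Dvd.intro _ rfl
      convert dvd_add h1 h2 using 1
      rw [Finsupp.add_apply, Finsupp.smul_apply, smul_eq_mul]
      ring
    -- The correction is a multiple of `p^s`, so the divisibilities already obtained for `i ≤ s`
    -- persist.
    · exact dvd_sub (ha i hsi j) ((pow_dvd_pow _ hsi).mul_right _)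

/-- If `a = p^t a'`, divisibility of the `(t+1)`-st Cartier image by `p^(t+1)` says that `a' B`
vanishes modulo `p`. Invertibility of `B` then gives one more factor `p` in `a`. -/
theorem pow_dvd_of_latChain (hp2 : 2 < p) (hσ : IsFrobeniusLift p σ) {g : Laurent n R}
    (hg : UnitVertices g) (hμ : Absorbs (newtonPolytope g) μ) (h : IsUnit (hasseWittOn p g μ))
    {K s : ℕ} {a : Lat μ → R}
    (ha : ∀ i ≤ s, ∀ j, (p : R) ^ i ∣ cartierPow hp σ g K i (latChain a) j) (u : Lat μ) :
    (p : R) ^ s ∣ a u := by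
  suffices H : ∀ t ≤ s, ∀ u, (p : R) ^ t ∣ a u from H s le_rfl u
  intro t
  induction t with
  | zero => intro _ u; rw [pow_zero]; exact one_dvd _
  | succ t ih =>
    intro ht
    choose a' ha' using ih (by omega)
    obtain rfl : a = (p : R) ^ t • a' := funext ha'
    obtain ⟨B, ⟨B', rfl⟩, hB⟩ := exists_matrix_cartierPow hp hp2 hσ hg hμ h K (t + 1)
    have hpt : (p : R) ^ t ≠ 0 := pow_ne_zero _ (by exact_mod_cast hp.ne_zero)
    have h1 : ∀ v, (p : R) ∣ Matrix.vecMul a' (B' : Matrix (Lat μ) (Lat μ) R) v := by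
      intro v
      have h2 := ha (t + 1) ht (1, v.1)
      rw [map_smul, map_smul, Finsupp.smul_apply, smul_eq_mul, pow_succ,
        mul_dvd_mul_iff_left hpt] at h2
      have h3 := (dvd_sub_right h2).1 (hB a' (1, v.1))
      rwa [latChain_apply_mk] at h3
    have h4 : a' = Matrix.vecMul (Matrix.vecMul a' (B' : Matrix (Lat μ) (Lat μ) R)) (↑B'⁻¹ : Matrix (Lat μ) (Lat μ) R) := by
      rw [Matrix.vecMul_vecMul, Units.mul_inv, Matrix.vecMul_one]
    intro u
    rw [Pi.smul_apply, smul_eq_mul, pow_succ]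
    refine mul_dvd_mul_left _ ?_
    rw [h4]
    exact Finset.dvd_sum fun v _ => (h1 v).mul_right _

end Basis

end Iterates

end UnitRoot

namespace UnitRoot

variable {n : ℕ} {R : Type*} [CommRing R]

/-! ### Formal derivatives -/

/-- Common factors `p` of all coordinates can be removed only finitely often, as the absolute value
of a fixed nonzero coordinate decreases each time. -/
theorem exists_eq_pow_smul {p : ℕ} (hp : p.Prime) {k : Fin n → ℤ} (hk : k ≠ 0) :
    ∃ (s : ℕ) (k' : Fin n → ℤ) (i : Fin n), k = (p : ℤ) ^ s • k' ∧ ¬ (p : ℤ) ∣ k' i := by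
  obtain ⟨i, hi⟩ := Function.ne_iff.1 hk
  rw [Pi.zero_apply] at hi
  obtain ⟨N, hN⟩ : ∃ N, (k i).natAbs = N := ⟨_, rfl⟩
  induction N using Nat.strong_induction_on generalizing k with
  | _ N ih =>
    by_cases h : ∃ j, ¬ (p : ℤ) ∣ k j
    · obtain ⟨j, hj⟩ := h
      exact ⟨0, k, j, by simp, hj⟩
    · push Not at h
      choose k' hk' using h
      have hk2 : k = (p : ℤ) • k' := funext hk'
      have hi' : k' i ≠ 0 := fun h0 => hi (by rw [hk' i, h0, mul_zero])
      have hlt : (k' i).natAbs < N := by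
        rw [← hN, hk' i, Int.natAbs_mul, Int.natAbs_natCast]
        have h1 := Int.natAbs_pos.2 hi'
        have h2 := hp.two_le
        nlinarith
      obtain ⟨s, k'', j, e, hj⟩ := ih _ hlt (fun h0 => hi' (by rw [h0]; rfl)) hi' rfl
      refine ⟨s + 1, k'', j, ?_, hj⟩
      rw [hk2, e, smul_smul, pow_succ']

/-- A series with support in the cone is a formal derivative if and only if its coefficients at
multiples of `p ^ s` are divisible by `p ^ s`, for all `s`. -/
theorem mem_formalDerivatives_iff {p : ℕ} (hp : p.Prime) [IsAdicComplete (Ideal.span {(p : R)}) R]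
    {Δ : Set (Fin n → ℝ)} {b : Fin n → ℤ} {E : Series n R} (hE : E ∈ formalSeries R Δ b) :
    E ∈ formalDerivatives R Δ b ↔ ∀ s, IsFormalUpTo p s E := by
  classical
  constructor
  · clear hE
    intro h s i _
    induction h using Submodule.span_induction with
    | mem D hD =>
      obtain ⟨j, F, -, rfl⟩ := hD
      intro k
      change (p : R) ^ i ∣ (((p : ℤ) ^ i • k) j : R) * F _
      rw [Pi.smul_apply, smul_eq_mul]
      push_cast
      rw [mul_assoc]
      exact Dvd.intro _ rfl
    | zero => exact fun k => dvd_zero _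
    | add D D' _ _ h h' => exact fun k => dvd_add (h k) (h' k)
    | smul r D _ h => exact fun k => (h k).mul_left r
  · intro h
    -- Each monomial is a derivative in a single direction: if `k = p^s k'` and `p` does not divide
    -- `k'_i`, then `k'_i` is a unit and `E k = p^s c` is a multiple of `k_i`. At `k = 0` all powers
    -- of `p` divide the coefficient, so it vanishes.
    have key : ∀ k, E k ≠ 0 → ∃ (i : Fin n) (c : R), E k = (k i : R) * c := by
      intro k hk0
      by_cases hk : k = 0
      · refine absurd (eq_zero_of_forall_pow_dvd p fun s => ?_) hk0
        have := h s s le_rfl 0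
        rwa [smul_zero, ← hk] at this
      · obtain ⟨s, k', i, e, hi⟩ := exists_eq_pow_smul hp hk
        obtain ⟨c, hc⟩ := h s s le_rfl k'
        obtain ⟨v, hv⟩ := isUnit_intCast (R := R) p hp hi
        refine ⟨i, ↑v⁻¹ * c, ?_⟩
        rw [← e] at hc
        rw [hc, e, Pi.smul_apply, smul_eq_mul]
        push_cast
        rw [← hv, mul_assoc, Units.mul_inv_cancel_left]
    choose i c hic using key
    -- The monomials are sorted by their chosen direction, so `n` derivatives suffice even when the
    -- support is infinite.
    set F : Fin n → Series n R := fun j k =>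
      if hk : E k ≠ 0 then if i k hk = j then c k hk else 0 else 0 with hF
    have hFm : ∀ j, F j ∈ formalSeries R Δ b := fun j k hk => hE k fun h0 => hk (by simp [hF, h0])
    have hsum : E = ∑ j, theta R j (F j) := by
      funext k
      rw [Finset.sum_apply]
      change E k = ∑ j, (k j : R) * F j k
      by_cases hk : E k ≠ 0
      · rw [Finset.sum_eq_single (i k hk)]
        · rw [hF]
          change _ = _ * (dite _ _ _)
          rw [dif_pos hk, if_pos rfl]
          exact hic k hk
        · intro j _ hj
          rw [hF]
          change _ * (dite _ _ _) = _
          rw [dif_pos hk, if_neg hj.symm, mul_zero]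
        · exact fun h => absurd (Finset.mem_univ _) h
      · push Not at hk
        rw [hk, Finset.sum_eq_zero]
        intro j _
        simp [hF, hk]
    rw [hsum]
    exact Submodule.sum_mem _ fun j _ => Submodule.subset_span ⟨j, F j, hFm j, rfl⟩

/-! ### Approximation of elements of the completion by chains -/

/-- The element of `Ω_g(μ)` represented by a chain. -/
def chainOmega (g : Laurent n R) (μ : Set (Fin n → ℝ)) : chains R μ →ₗ[R] Omega g μ :=
  (chainForm g).restrict fun _ hw => chainForm_mem g hw

theorem chainOmega_surjective (g : Laurent n R) (μ : Set (Fin n → ℝ)) :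
    Function.Surjective (chainOmega g μ) := by
  rintro ⟨ω, hω⟩
  obtain ⟨w, hw, e⟩ := exists_chainForm_eq g hω
  exact ⟨⟨w, hw⟩, Subtype.ext e⟩

section Approx

variable {p : ℕ} {g : Laurent n R} {μ : Set (Fin n → ℝ)}

/-- The chain `w` represents `x` modulo `p ^ s`. -/
def Approx (x : OmegaHat p g μ) (s : ℕ) (w : Chain n R) : Prop :=
  ∃ hw : w ∈ chains R μ, x.val s = Submodule.Quotient.mk (chainOmega g μ ⟨w, hw⟩)

theorem exists_approx (x : OmegaHat p g μ) (s : ℕ) : ∃ w, Approx x s w := by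
  obtain ⟨ω, hω⟩ := Submodule.Quotient.mk_surjective _ (x.val s)
  obtain ⟨w, rfl⟩ := chainOmega_surjective g μ ω
  exact ⟨w.1, w.2, hω.symm⟩

theorem Approx.mem {x : OmegaHat p g μ} {s : ℕ} {w : Chain n R} (h : Approx x s w) :
    w ∈ chains R μ := h.1

theorem Approx.sub {x y : OmegaHat p g μ} {s : ℕ} {w v : Chain n R} (h : Approx x s w)
    (h' : Approx y s v) : Approx (x - y) s (w - v) := by
  obtain ⟨hw, e⟩ := h
  obtain ⟨hv, e'⟩ := h'
  exact ⟨Submodule.sub_mem _ hw hv, by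
    rw [AdicCompletion.val_sub_apply, e, e', ← Submodule.Quotient.mk_sub, ← map_sub]; rfl⟩

theorem approx_of {w : Chain n R} (hw : w ∈ chains R μ) (s : ℕ) :
    Approx (AdicCompletion.of (Ideal.span {(p : R)}) (Omega g μ) (chainOmega g μ ⟨w, hw⟩)) s w :=
  ⟨hw, rfl⟩

/-- Transport of additive operators from chains to the completion. -/
theorem exists_approx_of_operator {g' : Laurent n R} {μ' : Set (Fin n → ℝ)}
    (A : ℕ → Chain n R → Chain n R)
    (hmem : ∀ s, ∀ w ∈ chains R μ, A s w ∈ chains R μ')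
    (hadd : ∀ s w w', A s (w + w') = A s w + A s w')
    (hsmul : ∀ s w, A s ((p : R) ^ s • w) = (p : R) ^ s • A s w)
    (hstab : ∀ s, ∀ w ∈ chains R μ, ∀ i, (p : R) ^ s ∣ (A (s + 1) w - A s w) i)
    (x : OmegaHat p g μ) :
    ∃ y : OmegaHat p g' μ', ∀ s, ∃ w, Approx x s w ∧ Approx y s (A s w) := by
  -- The element `x` is lifted to a Cauchy sequence of chains, to whose `s`-th term `A s` is
  -- applied. Additivity and compatibility with `p^s` suffice for the image to be Cauchy, so
  -- derivations, which are not `R`-linear, are covered.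
  obtain ⟨z, rfl⟩ := AdicCompletion.map_surjective (M := chains R μ) (N := Omega g μ)
    (f := chainOmega g μ) (Ideal.span {(p : R)}) (chainOmega_surjective g μ) x
  obtain ⟨a, rfl⟩ := AdicCompletion.mk_surjective _ _ z
  refine ⟨AdicCompletion.mk _ _ (AdicCompletion.AdicCauchySequence.mk _ _
    (fun s => chainOmega g' μ' ⟨A s (a s), hmem s _ (a s).2⟩) fun s => ?_), fun s =>
      ⟨(a s).1, ⟨(a s).2, rfl⟩, ⟨hmem s _ (a s).2, rfl⟩⟩⟩
  have h1 := (a.property (Nat.le_succ s)).symm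
  rw [SModEq.sub_mem] at h1
  obtain ⟨d, hd⟩ := (mem_span_pow_smul_top p (M := chains R μ)).1 h1
  have hd' : (a (s + 1)).1 = (a s).1 + (p : R) ^ s • d.1 := by
    have := congrArg Subtype.val hd
    change (a (s + 1)).1 - (a s).1 = (p : R) ^ s • d.1 at this
    rw [← this]; abel
  obtain ⟨e, he, he'⟩ := exists_smul_chain
    (Submodule.sub_mem _ (hmem (s + 1) _ (a (s + 1)).2) (hmem s _ (a (s + 1)).2))
    (hstab s _ (a (s + 1)).2)
  refine SModEq.symm ?_
  rw [SModEq.sub_mem]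
  refine (mem_span_pow_smul_top p (M := Omega g' μ')).2
    ⟨chainOmega g' μ' (⟨e, he⟩ + ⟨A s d.1, hmem s _ d.2⟩), ?_⟩
  rw [← map_sub, ← map_smul]
  congr 1
  apply Subtype.ext
  change A (s + 1) (a (s + 1)).1 - A s (a s).1 = (p : R) ^ s • (e + A s d.1)
  have e1 : A s (a (s + 1)).1 = A s (a s).1 + (p : R) ^ s • A s d.1 := by
    rw [hd', hadd, hsmul]
  rw [smul_add, ← he', e1]
  abel

variable [IsAdicComplete (Ideal.span {(p : R)}) R]

theorem Approx.expansionHat {x : OmegaHat p g μ} {s : ℕ} {w : Chain n R} (h : Approx x s w)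
    (b k : Fin n → ℤ) : (p : R) ^ s ∣ expansionHat p g b μ x k - chainSeries g b w k := by
  obtain ⟨hw, e⟩ := h
  set τ : Omega g μ →ₗ[R] R :=
    coeffAt R k ∘ₗ (expansion g b).restrictScalars R ∘ₗ (Omega g μ).subtype with hτ
  set r := UnitRoot.expansionHat p g b μ x k with hr
  have h1 : AdicCompletion.of (Ideal.span {(p : R)}) R r =
      AdicCompletion.map (Ideal.span {(p : R)}) τ x :=
    AdicCompletion.of_ofLinearEquiv_symm _ _
  have h2 : (AdicCompletion.of (Ideal.span {(p : R)}) R r).val s =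
      (AdicCompletion.map (Ideal.span {(p : R)}) τ x).val s := by rw [h1]
  rw [AdicCompletion.map_val_apply, e] at h2
  have h3 : (Submodule.Quotient.mk r : R ⧸ (Ideal.span {(p : R)} ^ s • ⊤ : Submodule R R)) =
      Submodule.Quotient.mk (chainSeries g b w k) := h2
  rw [Submodule.Quotient.eq, mem_span_pow] at h3
  exact h3

theorem Approx.isFormalUpTo_iff {x : OmegaHat p g μ} {s : ℕ} {w : Chain n R} (h : Approx x s w)
    (b : Fin n → ℤ) :
    IsFormalUpTo p s (UnitRoot.expansionHat p g b μ x) ↔ IsFormalUpTo p s (chainSeries g b w) := by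
  refine forall₂_congr fun i hi => forall_congr' fun k => ?_
  have h1 := (pow_dvd_pow (p : R) hi).trans (h.expansionHat b ((p : ℤ) ^ i • k))
  exact (dvd_iff_dvd_of_dvd_sub h1)

theorem expansionHat_mem {b : Fin n → ℤ} (hb : IsVertex g b) (hu : IsUnit (g.coeff b))
    (hμ : μ ⊆ newtonPolytope g) (x : OmegaHat p g μ) :
    expansionHat p g b μ x ∈ formalSeries R (newtonPolytope g) b := by
  intro k hk
  by_contra hk'
  refine hk (eq_zero_of_forall_pow_dvd p fun s => ?_)
  obtain ⟨w, hw⟩ := exists_approx x s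
  have h1 := hw.expansionHat b k
  have h2 : chainSeries g b w k = 0 := by
    by_contra h0
    exact hk' (chainSeries_mem hb hu (chains_mono hμ hw.mem) k h0)
  rwa [h2, sub_zero] at h1

theorem mem_U_iff (hp : p.Prime) {b : Fin n → ℤ} (hb : IsVertex g b) (hu : IsUnit (g.coeff b))
    (hμ : μ ⊆ newtonPolytope g) (x : OmegaHat p g μ) :
    x ∈ U p g b μ ↔ ∀ s, IsFormalUpTo p s (expansionHat p g b μ x) :=
  mem_formalDerivatives_iff hp (expansionHat_mem hb hu hμ x)

/-- An element of the completion which is approximated by chains with expansions `E` has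
expansion `E`. -/
theorem expansionHat_eq {b : Fin n → ℤ} {x : OmegaHat p g μ} {E : Series n R}
    (h : ∀ s, ∃ w, Approx x s w ∧ ∀ k, (p : R) ^ s ∣ chainSeries g b w k - E k) :
    expansionHat p g b μ x = E := by
  funext k
  rw [← sub_eq_zero]
  refine eq_zero_of_forall_pow_dvd p fun s => ?_
  obtain ⟨w, hw, hk⟩ := h s
  rw [← sub_add_sub_cancel _ (chainSeries g b w k)]
  exact dvd_add (hw.expansionHat b k) (hk k)

variable [IsDomain R] [CharZero R] {σ : R →+* R}

/-- The vertex `b` is absent from the right-hand side, so `U` does not depend on it and can be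
compared with `U` for a face. Truncation at `s` is enough, since its error is divisible by
`p^(s+1)`. -/
theorem mem_U_iff_cartierPow (hp : p.Prime) (hp2 : 2 < p) (hσ : IsFrobeniusLift p σ)
    (hg : UnitVertices g) (hμ : μ ⊆ newtonPolytope g) {b : Fin n → ℤ} (hb : IsVertex g b)
    (x : OmegaHat p g μ) :
    x ∈ U p g b μ ↔ ∀ s w, Approx x s w → ∀ i ≤ s, ∀ j, (p : R) ^ i ∣ cartierPow hp σ g s i w j := by
  rw [mem_U_iff hp hb (hg b hb) hμ]
  have key : ∀ s w, Approx x s w → (IsFormalUpTo p s (expansionHat p g b μ x) ↔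
      ∀ i ≤ s, ∀ j, (p : R) ^ i ∣ cartierPow hp σ g s i w j) := fun s w hw =>
    (hw.isFormalUpTo_iff b).trans
      (UnitRoot.isFormalUpTo_iff hp hp2 hσ hg hb (Nat.le_succ s) (chains_mono hμ hw.mem))
  constructor
  · exact fun h s w hw => (key s w hw).1 (h s)
  · intro h s
    obtain ⟨w, hw⟩ := exists_approx x s
    exact (key s w hw).2 (h s w hw)

/-! ### The basis of `Q_g(μ)` -/

section Basis

variable [Fintype (Lat μ)]

/-- The combinations of the `ω_u` in the completion, for lattice points `u` of `μ`. -/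
def latHat (p : ℕ) (g : Laurent n R) (a : Lat μ → R) : OmegaHat p g μ :=
  AdicCompletion.of _ _ (chainOmega g μ ⟨latChain a, latChain_mem a⟩)

variable [DecidableEq (Lat μ)]

theorem latHat_mem_U (hp : p.Prime) (hp2 : 2 < p) (hσ : IsFrobeniusLift p σ)
    (hg : UnitVertices g) (hμ : Absorbs (newtonPolytope g) μ) {b : Fin n → ℤ} (hb : IsVertex g b)
    (h : IsUnit (hasseWittOn p g μ)) {a : Lat μ → R} (ha : latHat p g a ∈ U p g b μ) : a = 0 := by
  funext u
  refine eq_zero_of_forall_pow_dvd p fun s => ?_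
  exact pow_dvd_of_latChain hp hp2 hσ hg hμ h
    ((mem_U_iff_cartierPow hp hp2 hσ hg hμ.1 hb _).1 ha s _ (approx_of _ s)) u

/-- Coordinates exist modulo each `p^s` and are unique modulo `p^s`. The approximations therefore
form a Cauchy sequence, and its limit gives the coordinates of `x`. -/
theorem exists_latHat_sub_mem_U (hp : p.Prime) (hp2 : 2 < p) (hσ : IsFrobeniusLift p σ)
    (hg : UnitVertices g) (hμ : Absorbs (newtonPolytope g) μ) {b : Fin n → ℤ} (hb : IsVertex g b)
    (h : IsUnit (hasseWittOn p g μ)) (x : OmegaHat p g μ) :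
    ∃ a : Lat μ → R, x - latHat p g a ∈ U p g b μ := by
  have happ : ∀ (a : Lat μ → R) s, Approx (latHat p g a) s (latChain a) := fun a s => approx_of _ s
  have hiff : ∀ s w (a : Lat μ → R), Approx x s w →
      (IsFormalUpTo p s (expansionHat p g b μ (x - latHat p g a)) ↔
        ∀ i ≤ s, ∀ j, (p : R) ^ i ∣ cartierPow hp σ g s i (w - latChain a) j) := fun s w a hw =>
    ((hw.sub (happ a s)).isFormalUpTo_iff b).trans
      (UnitRoot.isFormalUpTo_iff hp hp2 hσ hg hb (Nat.le_succ s)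
        (chains_mono hμ.1 (hw.sub (happ a s)).mem))
  have hex : ∀ s, ∃ a : Lat μ → R, IsFormalUpTo p s (expansionHat p g b μ (x - latHat p g a)) := by
    intro s
    obtain ⟨w, hw⟩ := exists_approx x s
    obtain ⟨a, ha⟩ := exists_latChain_sub hp hp2 hσ hg hμ h s s hw.mem
    exact ⟨a, (hiff s w a hw).2 ha⟩
  have huniq : ∀ s (a a' : Lat μ → R), IsFormalUpTo p s (expansionHat p g b μ (x - latHat p g a)) →
      IsFormalUpTo p s (expansionHat p g b μ (x - latHat p g a')) →
        ∀ u, (p : R) ^ s ∣ a u - a' u := by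
    intro s a a' h1 h2 u
    obtain ⟨w, hw⟩ := exists_approx x s
    refine pow_dvd_of_latChain hp hp2 hσ hg hμ h (a := a - a') (K := s) (fun i hi j => ?_) u
    have h3 := dvd_sub ((hiff s w a' hw).1 h2 i hi j) ((hiff s w a hw).1 h1 i hi j)
    rw [← Finsupp.sub_apply, ← map_sub, sub_sub_sub_cancel_left, ← map_sub] at h3
    exact h3
  choose a ha using hex
  have hlim : ∀ u, ∃ L, ∀ s, (p : R) ^ s ∣ L - a s u := fun u =>
    exists_limit p fun s => huniq s _ _ (fun i hi => ha (s + 1) i (by omega)) (ha s) u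
  choose L hL using hlim
  refine ⟨L, (mem_U_iff hp hb (hg b hb) hμ.1 _).2 fun s => ?_⟩
  obtain ⟨w, hw⟩ := exists_approx x s
  rw [hiff s w L hw]
  intro i hi j
  choose d hd using fun u => hL u s
  -- The limit differs from the `s`-th approximation by a multiple of `p^s`, which is harmless for
  -- the conditions with `i ≤ s`.
  have e : w - latChain L = (w - latChain (a s)) - (p : R) ^ s • latChain d := by
    have : L = a s + (p : R) ^ s • d := by
      funext u
      rw [Pi.add_apply, Pi.smul_apply, smul_eq_mul, ← hd u]; ring
    rw [this, map_add, map_smul]; abel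
  rw [e, map_sub, map_smul, Finsupp.sub_apply, Finsupp.smul_apply, smul_eq_mul]
  exact dvd_sub ((hiff s w (a s) hw).1 (ha s) i hi j) ((pow_dvd_pow _ hi).mul_right _)

end Basis

end Approx

end UnitRoot

namespace UnitRoot

variable {n : ℕ} {R : Type*} [CommRing R]

/-! ### Restriction to a face -/

section FaceRestriction

/-- The numerator of the rational function represented by a chain, with denominator `g ^ N`. -/
def chainNumerator (g : Laurent n R) (N : ℕ) : Chain n R →ₗ[R] Laurent n R :=
  Finsupp.linearCombination R fun i =>
    ((i.1 - 1).factorial : R) • (AddMonoidAlgebra.single i.2 1 * g ^ (N - i.1))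

theorem pow_smul_chainForm (g : Laurent n R) {N : ℕ} {w : Chain n R} (hN : ∀ i, w i ≠ 0 → i.1 ≤ N) :
    g ^ N • chainForm g w = algebraMap _ _ (chainNumerator g N w) := by
  rw [chainForm, chainNumerator, Finsupp.linearCombination_apply, Finsupp.linearCombination_apply,
    Finsupp.sum, Finsupp.sum, Finset.smul_sum, map_sum]
  refine Finset.sum_congr rfl fun i hi => ?_
  have h := hN i (Finsupp.mem_support_iff.1 hi)
  have e : g ^ N = g ^ (N - i.1) * g ^ i.1 := by rw [← pow_add, Nat.sub_add_cancel h]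
  have e2 : ∀ (r : R) (P : Laurent n R), algebraMap (Laurent n R) (Localization.Away g) (r • P) =
      r • algebraMap _ _ P := fun r P =>
    (Algebra.linearMap (Laurent n R) (Localization.Away g)).map_smul_of_tower r P
  rw [smul_comm, e, mul_smul, pow_smul_omega, e2, e2, map_mul, mul_comm, smul_comm, ← e2, Algebra.smul_def,
    e2, mul_smul_comm, map_pow]
  simp only [Algebra.smul_def]
  ring

variable {Δ η : Set (Fin n → ℝ)}

theorem IsInit.sum {ι : Type*} {N : ℕ} {P P' : ι → Laurent n R} (s : Finset ι)
    (h : ∀ i ∈ s, IsInit Δ η N (P i) (P' i)) : IsInit Δ η N (∑ i ∈ s, P i) (∑ i ∈ s, P' i) := by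
  classical
  induction s using Finset.induction_on with
  | empty => exact IsInit.zero
  | insert i s hi ih =>
    rw [Finset.sum_insert hi, Finset.sum_insert hi]
    exact (h i (Finset.mem_insert_self i s)).add (ih fun j hj => h j (Finset.mem_insert_of_mem hj))

theorem isInit_chainNumerator (hΔ : Convex ℝ Δ) (hη : IsExtreme ℝ Δ η) (hη' : Convex ℝ η)
    (hne : η.Nonempty) {g h : Laurent n R} (hg : IsInit Δ η 1 g h) {N : ℕ} {w : Chain n R}
    (hw : w ∈ chains R Δ) (hN : ∀ i, w i ≠ 0 → i.1 ≤ N) :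
    IsInit Δ η N (chainNumerator g N w) (chainNumerator h N (faceChain η w)) := by
  classical
  have hsub : (faceChain η w).support ⊆ w.support := by
    intro i hi
    rw [Finsupp.mem_support_iff, faceChain_apply] at hi
    exact Finsupp.mem_support_iff.2 fun h0 => hi (by rw [h0, ite_self])
  rw [chainNumerator, chainNumerator, Finsupp.linearCombination_apply,
    Finsupp.linearCombination_apply, Finsupp.sum_of_support_subset _ hsub _ (by simp), Finsupp.sum]
  refine IsInit.sum _ fun i hi => ?_
  have hi := Finsupp.mem_support_iff.1 hi
  have hpow := hg.pow hΔ hη hη' hne (N - i.1)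
  rw [mul_one] at hpow
  have e : i.1 + (N - i.1) = N := Nat.add_sub_cancel' (hN i hi)
  rw [faceChain_apply]
  split_ifs with hd
  · have := (((IsInit.single hη.1 hd 1).mul hΔ hη hη' hpow).smul ((i.1 - 1).factorial : R)).smul (w i)
    rwa [e] at this
  · have := (((IsInit.single_zero (mem_chains.1 hw i hi).2 hd 1).mul hΔ hη hη' hpow).smul
      ((i.1 - 1).factorial : R)).smul (w i)
    rw [e] at this
    simpa using this

/-- A rational function has many representations as a chain, so restriction to a face must respect
the relations. Over a common denominator a relation says that a numerator vanishes; the numerator of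
the restricted chain is the initial part of that one, hence vanishes too. -/
theorem chainForm_faceChain_eq_zero {η : Set (Fin n → ℝ)} {g h : Laurent n R}
    (hη : IsFace (newtonPolytope g) η) (hgh : IsInit (newtonPolytope g) η 1 g h)
    {b : Fin n → ℤ} (hb : IsVertex g b) (hu : IsUnit (g.coeff b)) {w : Chain n R}
    (hw : w ∈ chains R (newtonPolytope g)) (h0 : chainForm g w = 0) :
    chainForm h (faceChain η w) = 0 := by
  classical
  have hN : ∀ i, w i ≠ 0 → i.1 ≤ w.support.sup Prod.fst := fun i hi =>
    Finset.le_sup (f := Prod.fst) (Finsupp.mem_support_iff.2 hi)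
  have h1 := pow_smul_chainForm g hN
  rw [h0, smul_zero] at h1
  have h2 := congrArg (expansion g b) h1
  rw [map_zero, expansion_algebraMap hb hu] at h2
  -- The expansion of a Laurent polynomial has the same coefficients as the polynomial, so vanishing
  -- in the localization gives vanishing of the numerator.
  have h3 : chainNumerator g (w.support.sup Prod.fst) w = 0 := by
    ext k
    rw [← smul_one_apply, ← h2]
    rfl
  have hc := convex_newtonPolytope g
  have h4 := isInit_chainNumerator hc hη.1.isExtreme (hη.convex hc) hη.2 hgh hw hN
  rw [h3] at h4
  have h5 := pow_smul_chainForm h (N := w.support.sup Prod.fst) (w := faceChain η w) fun i hi =>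
    hN i fun hi' => hi (by rw [faceChain_apply, hi', ite_self])
  rw [h4.eq_zero, map_zero] at h5
  have h6 := congrArg (fun z => IsLocalization.Away.invSelf h ^ (w.support.sup Prod.fst) * z) h5
  rwa [Algebra.smul_def, map_pow, ← mul_assoc, ← mul_pow, mul_comm (IsLocalization.Away.invSelf h),
    IsLocalization.Away.mul_invSelf, one_pow, one_mul, mul_zero] at h6

theorem exists_linearMap_of_surjective {M N P : Type*} [AddCommGroup M] [Module R M]
    [AddCommGroup N] [Module R N] [AddCommGroup P] [Module R P] {q : M →ₗ[R] N}
    (hq : Function.Surjective q) (T : M →ₗ[R] P) (h : ∀ x, q x = 0 → T x = 0) :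
    ∃ ρ : N →ₗ[R] P, ∀ x, ρ (q x) = T x := by
  refine ⟨(LinearMap.ker q).liftQ T (fun x hx => h x hx) ∘ₗ
    (q.quotKerEquivOfSurjective hq).symm.toLinearMap, fun x => ?_⟩
  have : (q.quotKerEquivOfSurjective hq).symm (q x) = Submodule.Quotient.mk x :=
    (LinearEquiv.symm_apply_eq _).2 rfl
  rw [LinearMap.comp_apply, LinearEquiv.coe_coe, this]
  rfl

/-- The restriction to a face, on completions. -/
theorem exists_faceHat (p : ℕ) {η : Set (Fin n → ℝ)} {g h : Laurent n R}
    (hη : IsFace (newtonPolytope g) η) (hgh : IsInit (newtonPolytope g) η 1 g h)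
    {b : Fin n → ℤ} (hb : IsVertex g b) (hu : IsUnit (g.coeff b)) {μ μ' : Set (Fin n → ℝ)}
    (hμ : μ ⊆ newtonPolytope g) (hμ' : μ ∩ η ⊆ μ') :
    ∃ ρ : OmegaHat p g μ →ₗ[R] OmegaHat p h μ',
      ∀ x s w, Approx x s w → Approx (ρ x) s (faceChain η w) := by
  have hmem : ∀ w ∈ chains R μ, faceChain η w ∈ chains R μ' := fun w hw =>
    chains_mono hμ' (faceChain_mem hw)
  obtain ⟨ρ, hρ⟩ := exists_linearMap_of_surjective (M := chains R μ)
    (chainOmega_surjective g μ)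
    (chainOmega h μ' ∘ₗ (faceChain η).restrict hmem) fun w hw => Subtype.ext <| by
      exact chainForm_faceChain_eq_zero hη hgh hb hu (chains_mono hμ w.2) (congrArg Subtype.val hw)
  refine ⟨(AdicCompletion.map (Ideal.span {(p : R)}) ρ).restrictScalars R, ?_⟩
  rintro x s w ⟨hw, e⟩
  refine ⟨hmem w hw, ?_⟩
  change (AdicCompletion.map (Ideal.span {(p : R)}) ρ x).val s = _
  rw [AdicCompletion.map_val_apply, e]
  exact congrArg Submodule.Quotient.mk (hρ ⟨w, hw⟩)

end FaceRestriction

/-! ### The connection on chains -/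

section Connection

variable (δ : Derivation ℤ R R)

/-- A derivation applied to the coefficients of a Laurent polynomial. -/
def derivLaurent (g : Laurent n R) : Laurent n R :=
  AddMonoidAlgebra.ofCoeff (g.coeff.mapRange δ (map_zero δ))

theorem coeff_derivLaurent (g : Laurent n R) (a : Fin n → ℤ) :
    (derivLaurent δ g).coeff a = δ (g.coeff a) :=
  Finsupp.mapRange_apply (hf := map_zero δ)

theorem derivLaurent_add (g h : Laurent n R) :
    derivLaurent δ (g + h) = derivLaurent δ g + derivLaurent δ h := by
  ext a
  simp [coeff_derivLaurent]

theorem derivLaurent_single (a : Fin n → ℤ) (c : R) :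
    derivLaurent δ (AddMonoidAlgebra.single a c) = AddMonoidAlgebra.single a (δ c) := by
  classical
  ext k
  rw [coeff_derivLaurent, AddMonoidAlgebra.coeff_single, AddMonoidAlgebra.coeff_single,
    Finsupp.single_apply, Finsupp.single_apply]
  split_ifs <;> simp

theorem derivSeries_add (E F : Series n R) :
    derivSeries δ (E + F) = derivSeries δ E + derivSeries δ F :=
  funext fun _ => map_add δ _ _

theorem derivSeries_smul (g : Laurent n R) (E : Series n R) :
    derivSeries δ (g • E) = derivLaurent δ g • E + g • derivSeries δ E := by
  induction g using AddMonoidAlgebra.induction_linear with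
  | zero =>
    have : derivLaurent δ (0 : Laurent n R) = 0 := by ext a; simp [coeff_derivLaurent]
    rw [this, zero_smul, zero_smul, zero_add]
    exact funext fun _ => map_zero δ
  | add P Q hP hQ => rw [add_smul, derivSeries_add, hP, hQ, derivLaurent_add, add_smul, add_smul]; abel
  | single a c =>
    funext k
    rw [derivLaurent_single]
    change δ ((AddMonoidAlgebra.single a c • E) k) = (_ • E) k + (_ • derivSeries δ E) k
    rw [single_smul_apply, single_smul_apply, single_smul_apply, Derivation.leibniz]
    change c * _ + E _ * _ = _ * _ + c * δ _
    ring

/-- This is the Leibniz rule for `g^m`, multiplied by `g` so that the exponent `m - 1` does not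
occur. -/
theorem smul_derivSeries_pow_smul (g : Laurent n R) (m : ℕ) (E : Series n R) :
    g • derivSeries δ (g ^ m • E) =
      ((m : Laurent n R) * g ^ m * derivLaurent δ g) • E + g ^ (m + 1) • derivSeries δ E := by
  induction m with
  | zero => simp
  | succ m ih =>
    rw [pow_succ', mul_smul, derivSeries_smul, smul_add, ih, smul_add, smul_smul, smul_smul,
      smul_smul, smul_smul, ← add_assoc, ← add_smul]
    congr 2
    · push_cast; ring
    · ring

theorem derivSeries_smul_one (g : Laurent n R) :
    derivSeries δ (g • (Series.one : Series n R)) = derivLaurent δ g • Series.one := by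
  have : derivSeries δ (Series.one : Series n R) = 0 := by
    funext k
    change δ (if k = 0 then 1 else 0) = 0
    split_ifs <;> simp
  rw [derivSeries_smul, this, smul_zero, add_zero]

/-- The action of a derivation on chains. -/
def derivChain (g : Laurent n R) : Chain n R →+ Chain n R :=
  Finsupp.liftAddHom fun i =>
    (Finsupp.singleAddHom i).comp (δ : R →+ R) -
      ((level (i.1 + 1)).toAddMonoidHom.comp
        ((AddMonoidHom.mulRight (derivLaurent δ g)).comp (AddMonoidAlgebra.singleAddHom i.2)))

/-- The derivative of `1/g^m` brings out a factor `-m`, which turns `(m-1)!` into the factorial `m!`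
contained in symbols of pole order `m + 1`. Hence no numerical coefficient remains. -/
theorem derivChain_single (g : Laurent n R) (m : ℕ) (u : Fin n → ℤ) (c : R) :
    derivChain δ g (Finsupp.single (m, u) c) = Finsupp.single (m, u) (δ c) -
      level (m + 1) (AddMonoidAlgebra.single u c * derivLaurent δ g) :=
  Finsupp.liftAddHom_apply_single _ _ _

theorem derivChain_smul (g : Laurent n R) (s p : ℕ) (w : Chain n R) :
    derivChain δ g ((p : R) ^ s • w) = (p : R) ^ s • derivChain δ g w := by
  rw [← Nat.cast_pow, Nat.cast_smul_eq_nsmul, Nat.cast_smul_eq_nsmul, map_nsmul]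

theorem SuppIn.derivLaurent {Δ : Set (Fin n → ℝ)} {N : ℕ} {P : Laurent n R} (hP : SuppIn N Δ P) :
    SuppIn N Δ (derivLaurent δ P) := fun a ha =>
  hP a fun h => ha (by rw [coeff_derivLaurent, h, map_zero])

theorem IsInit.derivLaurent {Δ η : Set (Fin n → ℝ)} {N : ℕ} {P P' : Laurent n R}
    (hP : IsInit Δ η N P P') : IsInit Δ η N (derivLaurent δ P) (derivLaurent δ P') :=
  ⟨hP.supp.derivLaurent δ, hP.supp'.derivLaurent δ, fun a ha => by
    rw [coeff_derivLaurent, coeff_derivLaurent, hP.coeff_eq a ha]⟩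

theorem derivChain_mem {Δ μ : Set (Fin n → ℝ)} (hμ : Absorbs Δ μ) {g : Laurent n R}
    (hg : SuppIn 1 Δ g) {w : Chain n R} (hw : w ∈ chains R μ) : derivChain δ g w ∈ chains R μ := by
  refine chains_induction (C := fun w => derivChain δ g w ∈ chains R μ) ?_ ?_ ?_ hw
  · rw [map_zero]; exact Submodule.zero_mem _
  · intro w w' h h'
    rw [map_add]
    exact Submodule.add_mem _ h h'
  · intro m u c hm hu
    rw [derivChain_single]
    exact Submodule.sub_mem _ (single_mem_chains hm hu _)
      (level_mem (by omega) ((suppIn_single hu c).mul_absorbs hμ hm (hg.derivLaurent δ)))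

theorem faceChain_derivChain {Δ η : Set (Fin n → ℝ)} (hΔ : Convex ℝ Δ) (hη : IsExtreme ℝ Δ η)
    (hη' : Convex ℝ η) {g h : Laurent n R} (hg : IsInit Δ η 1 g h) {w : Chain n R}
    (hw : w ∈ chains R Δ) : faceChain η (derivChain δ g w) = derivChain δ h (faceChain η w) := by
  refine chains_induction
    (C := fun w => faceChain η (derivChain δ g w) = derivChain δ h (faceChain η w)) ?_ ?_ ?_ hw
  · rw [map_zero, map_zero, map_zero]
  · intro w w' h1 h2
    rw [map_add, map_add, h1, h2, map_add, map_add]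
  · intro m u c hm hu
    rw [derivChain_single, map_sub]
    by_cases h0 : InDil m η u
    · rw [faceChain_single_of_mem h0, faceChain_single_of_mem h0, derivChain_single,
        faceChain_level ((IsInit.single hη.1 h0 c).mul hΔ hη hη' (hg.derivLaurent δ))]
    · rw [faceChain_single_of_notMem h0, faceChain_single_of_notMem h0, map_zero,
        faceChain_level ((IsInit.single_zero hu h0 c).mul hΔ hη hη' (hg.derivLaurent δ)), zero_mul,
        map_zero, sub_zero]

/-- Multiplication by `g^(m+1)` reduces the identity on a symbol to one of Laurent polynomials
acting on the series `1`. -/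
theorem chainSeries_derivChain {g : Laurent n R} {b : Fin n → ℤ} (hb : IsVertex g b)
    (hu : IsUnit (g.coeff b)) {w : Chain n R} (hw : w ∈ chains R (newtonPolytope g)) :
    chainSeries g b (derivChain δ g w) = derivSeries δ (chainSeries g b w) := by
  refine chains_induction
    (C := fun w => chainSeries g b (derivChain δ g w) = derivSeries δ (chainSeries g b w)) ?_ ?_ ?_ hw
  · rw [map_zero, map_zero]
    exact funext fun _ => (map_zero δ).symm
  · intro w w' h1 h2
    rw [map_add, map_add, map_add, derivSeries_add, h1, h2]
  · intro m u c hm hmu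
    have hs := single_mem_chains hm hmu c
    have hmem := derivChain_mem δ (absorbs_self (convex_newtonPolytope g)) (suppIn_newtonPolytope g) hs
    rw [← sub_eq_zero]
    set D := chainSeries g b (derivChain δ g (Finsupp.single (m, u) c)) -
      derivSeries δ (chainSeries g b (Finsupp.single (m, u) c)) with hD
    have hDm : D ∈ formalSeries R (newtonPolytope g) b :=
      Submodule.sub_mem _ (chainSeries_mem hb hu hmem) fun k hk =>
        chainSeries_mem hb hu hs k fun h0 => hk (by change δ _ = 0; rw [h0, map_zero])
    have hz : g ^ (m + 1) • D = 0 := by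
      have h1 := pow_smul_chainSeries_level hb hu m (AddMonoidAlgebra.single u c)
      have h2 := pow_smul_chainSeries_level hb hu m (AddMonoidAlgebra.single u (δ c))
      have h3 := pow_smul_chainSeries_level hb hu (m + 1)
        (AddMonoidAlgebra.single u c * derivLaurent δ g)
      have h4 := smul_derivSeries_pow_smul δ g m (chainSeries g b (Finsupp.single (m, u) c))
      rw [level_single] at h1 h2
      have h5 : derivLaurent δ (((m - 1).factorial : R) • AddMonoidAlgebra.single u c) =
          ((m - 1).factorial : R) • AddMonoidAlgebra.single u (δ c) := by
        rw [AddMonoidAlgebra.smul_single, AddMonoidAlgebra.smul_single, derivLaurent_single,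
          smul_eq_mul, smul_eq_mul, Derivation.leibniz, Derivation.map_natCast, smul_zero, add_zero,
          smul_eq_mul]
      rw [h1, ← smul_assoc, derivSeries_smul_one, h5] at h4
      have hfac : ((m + 1 - 1).factorial : Laurent n R) = m * ((m - 1).factorial : Laurent n R) := by
        rw [Nat.add_sub_cancel, ← Nat.mul_factorial_pred (by omega : m ≠ 0), Nat.cast_mul]
      have hsm : ∀ (k : ℕ) (P : Laurent n R), (k : R) • P = (k : Laurent n R) * P := fun k P => by
        rw [Nat.cast_smul_eq_nsmul, nsmul_eq_mul]
      have h6 := eq_sub_of_add_eq' h4.symm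
      rw [← smul_assoc, hsm] at h1 h2 h3
      rw [hsm] at h6
      rw [hfac] at h3
      rw [hD, derivChain_single, map_sub, smul_sub, smul_sub, h6, h3, pow_succ', mul_smul, h2,
        show (m : Laurent n R) * g ^ m * derivLaurent δ g = (m : Laurent n R) * derivLaurent δ g * g ^ m
          by ring, mul_smul _ (g ^ m), h1]
      simp only [← mul_smul, ← sub_smul]
      rw [← zero_smul (Laurent n R) (Series.one : Series n R)]
      congr 1
      ring
    funext k
    -- Divisibility by `0` is vanishing, so the divisibility test with `r = 0` is the injectivity of
    -- multiplication by `g^(m+1)`.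
    exact zero_dvd_iff.1 (dvd_of_dvd_pow_smul hb hu hDm (m + 1) (fun k => by rw [hz]; rfl) k)

end Connection

end UnitRoot

namespace UnitRoot

variable {n : ℕ} {R : Type*} [CommRing R]

/-! ### Comparison of elements of the completion -/

section Compare

variable {p : ℕ} {g : Laurent n R} {μ : Set (Fin n → ℝ)}

theorem eq_of_approx {x y : OmegaHat p g μ} (h : ∀ s, ∃ w, Approx x s w ∧ Approx y s w) :
    x = y := by
  refine AdicCompletion.ext fun s => ?_
  obtain ⟨w, ⟨hw, e⟩, ⟨hw', e'⟩⟩ := h s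
  rw [e, e']

theorem approx_zero (s : ℕ) : Approx (0 : OmegaHat p g μ) s 0 :=
  ⟨Submodule.zero_mem _, by
    rw [AdicCompletion.val_zero_apply]
    exact (congrArg Submodule.Quotient.mk (map_zero (chainOmega g μ))).symm⟩

theorem approx_omega {u : Fin n → ℤ} (hu : toReal u ∈ μ) (s : ℕ) :
    Approx (AdicCompletion.of (Ideal.span {(p : R)}) _ ⟨omega g 1 u, omega_mem g hu⟩) s
      (Finsupp.single (1, u) 1) := by
  refine ⟨single_mem_chains le_rfl (inDil_one.2 hu) 1, congrArg Submodule.Quotient.mk ?_⟩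
  refine Subtype.ext ?_
  change omega g 1 u = chainForm g (Finsupp.single (1, u) 1)
  rw [chainForm_single, one_smul]

theorem Approx.incl {μ' : Set (Fin n → ℝ)} (h : μ ⊆ μ') {x : OmegaHat p g μ} {s : ℕ} {w : Chain n R}
    (hx : Approx x s w) : Approx (OmegaHat.incl p g h x) s w := by
  obtain ⟨hw, e⟩ := hx
  refine ⟨chains_mono h hw, ?_⟩
  change (AdicCompletion.map (Ideal.span {(p : R)}) _ x).val s = _
  rw [AdicCompletion.map_val_apply, e]
  rfl

/-- `y` is obtained from `x` by applying the operators `A s` to chains which represent `x` modulo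
`p ^ s`. -/
def IsImage {g' : Laurent n R} {μ' : Set (Fin n → ℝ)} (A : ℕ → Chain n R → Chain n R)
    (x : OmegaHat p g μ) (y : OmegaHat p g' μ') : Prop :=
  ∀ s, ∃ w, Approx x s w ∧ Approx y s (A s w)

end Compare

/-! ### Operators on the quotients -/

section Operators

variable {p : ℕ} (δ : Derivation ℤ R R)

theorem pow_dvd_derivation {s : ℕ} {r : R} (h : (p : R) ^ s ∣ r) : (p : R) ^ s ∣ δ r := by
  obtain ⟨c, rfl⟩ := h
  rw [Derivation.leibniz, ← Nat.cast_pow, Derivation.map_natCast, smul_zero, add_zero, smul_eq_mul]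
  exact Dvd.intro _ rfl

theorem exists_isImage_derivChain {g : Laurent n R} {μ : Set (Fin n → ℝ)}
    (hμ : Absorbs (newtonPolytope g) μ) (x : OmegaHat p g μ) :
    ∃ y : OmegaHat p g μ, IsImage (fun _ => derivChain δ g) x y :=
  exists_approx_of_operator _ (fun _ _ hw => derivChain_mem δ hμ (suppIn_newtonPolytope g) hw)
    (fun _ => map_add _) (fun _ _ => derivChain_smul δ g _ _ _)
    (fun _ _ _ _ => by rw [sub_self]; exact dvd_zero _) x

variable [IsAdicComplete (Ideal.span {(p : R)}) R]

/-- A lift `y` of `Θ` applied to the expansion of `x` need not be unique. Lifts for two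
representatives of one class differ by an element whose expansion is `Θ` of a formal derivative,
hence by an element of `U`. Only additivity is asked of `Θ`, so that derivations are allowed. -/
theorem exists_addMonoidHom_Q {g g' : Laurent n R} {b b' : Fin n → ℤ} {μ μ' : Set (Fin n → ℝ)}
    (Θ : Series n R →+ Series n R)
    (hU : ∀ (x : OmegaHat p g μ) (y : OmegaHat p g' μ'),
      expansionHat p g' b' μ' y = Θ (expansionHat p g b μ x) → x ∈ U p g b μ → y ∈ U p g' b' μ')
    (hex : ∀ x : OmegaHat p g μ, ∃ y : OmegaHat p g' μ',
      expansionHat p g' b' μ' y = Θ (expansionHat p g b μ x)) :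
    ∃ T : Q p g b μ →+ Q p g' b' μ', ∀ x y,
      expansionHat p g' b' μ' y = Θ (expansionHat p g b μ x) →
        T (Q.mk p g b μ x) = Q.mk p g' b' μ' y := by
  choose Y hY using hex
  have hmk := Q.mk_surjective p g b μ
  set r := Function.surjInv hmk with hr
  have key : ∀ x y, expansionHat p g' b' μ' y = Θ (expansionHat p g b μ x) →
      Q.mk p g' b' μ' (Y (r (Q.mk p g b μ x))) = Q.mk p g' b' μ' y := by
    intro x y hxy
    rw [← sub_eq_zero, ← map_sub, Q.mk_eq_zero]
    refine hU (r (Q.mk p g b μ x) - x) _ ?_ ?_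
    · rw [map_sub, map_sub, map_sub, hY, hxy]
    · rw [← Q.mk_eq_zero, map_sub, hr, Function.surjInv_eq hmk, sub_self]
  refine ⟨{ toFun := fun q => Q.mk p g' b' μ' (Y (r q)), map_zero' := ?_, map_add' := ?_ }, key⟩
  · have := key 0 0 (by rw [map_zero, map_zero, map_zero])
    rwa [map_zero, map_zero] at this
  · intro q q'
    have := key (r q + r q') (Y (r q) + Y (r q')) (by
      rw [map_add, map_add, map_add, hY, hY])
    rwa [map_add, map_add, hr, Function.surjInv_eq hmk, Function.surjInv_eq hmk] at this

/-- The action of a derivation on series. -/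
def derivSeriesHom : Series n R →+ Series n R where
  toFun := derivSeries δ
  map_zero' := funext fun _ => map_zero δ
  map_add' := derivSeries_add δ

/-- The Cartier operator on series. -/
def cartierSeriesHom (n : ℕ) (R : Type*) [CommRing R] (p : ℕ) : Series n R →+ Series n R where
  toFun := cartierSeries p
  map_zero' := rfl
  map_add' _ _ := rfl

theorem IsImage.expansionHat_deriv {g : Laurent n R} {μ : Set (Fin n → ℝ)}
    (hμ : μ ⊆ newtonPolytope g) {b : Fin n → ℤ} (hb : IsVertex g b) (hu : IsUnit (g.coeff b))
    {x y : OmegaHat p g μ} (h : IsImage (fun _ => derivChain δ g) x y) :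
    expansionHat p g b μ y = derivSeries δ (expansionHat p g b μ x) := by
  refine expansionHat_eq fun s => ?_
  obtain ⟨w, hw, hw'⟩ := h s
  refine ⟨_, hw', fun k => ?_⟩
  rw [chainSeries_derivChain δ hb hu (chains_mono hμ hw.mem), ← neg_sub, dvd_neg]
  change _ ∣ δ _ - δ _
  rw [← map_sub]
  exact pow_dvd_derivation δ (hw.expansionHat b k)

/-- The connection on `Q_g(μ)`. -/
theorem exists_connection (hp : p.Prime) {g : Laurent n R} (hg : UnitVertices g) {μ : Set (Fin n → ℝ)}
    (hμ : Absorbs (newtonPolytope g) μ) {b : Fin n → ℤ} (hb : IsVertex g b) :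
    ∃ D : Q p g b μ →+ Q p g b μ, IsConnection p δ g b μ D ∧ ∀ x y,
      expansionHat p g b μ y = derivSeries δ (expansionHat p g b μ x) →
        D (Q.mk p g b μ x) = Q.mk p g b μ y := by
  have hex : ∀ x : OmegaHat p g μ, ∃ y : OmegaHat p g μ,
      expansionHat p g b μ y = derivSeriesHom δ (expansionHat p g b μ x) := fun x => by
    obtain ⟨y, hy⟩ := exists_isImage_derivChain δ hμ x
    exact ⟨y, hy.expansionHat_deriv δ hμ.1 hb (hg b hb)⟩
  obtain ⟨D, hD⟩ := exists_addMonoidHom_Q (derivSeriesHom δ) (fun x y hxy hx => by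
    rw [mem_U_iff hp hb (hg b hb) hμ.1] at hx ⊢
    rw [hxy]
    exact fun s i hi k => pow_dvd_derivation δ (hx s i hi k)) hex
  exact ⟨D, fun x => (hex x).imp fun y hy => ⟨hy, hD x y hy⟩, hD⟩

variable [IsDomain R] [CharZero R] {σ : R →+* R}

/-- Truncating at `2s` compensates for the halved rate of convergence on chains: consecutive
truncations then agree modulo `p^s`. -/
theorem exists_isImage_cartierChain (hp : p.Prime) (hp2 : 2 < p) (hσ : IsFrobeniusLift p σ)
    {g : Laurent n R} {μ : Set (Fin n → ℝ)} (hμ : Absorbs (newtonPolytope g) μ)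
    (x : OmegaHat p g μ) :
    ∃ y : OmegaHat p (twist σ g) μ, IsImage (fun s => cartierChain hp σ g (2 * s)) x y :=
  exists_approx_of_operator (fun s => cartierChain hp σ g (2 * s))
    (fun s w hw =>
      cartierChain_mem hp hσ (convex_newtonPolytope g) hμ (suppIn_newtonPolytope g) (2 * s) hw)
    (fun s w w' => map_add (cartierChain hp σ g (2 * s)) w w')
    (fun s w => map_smul (cartierChain hp σ g (2 * s)) ((p : R) ^ s) w)
    (fun s w _ i => pow_dvd_cartierChain_sub hp hp2 g (by omega) (by omega) w i) x

theorem IsImage.expansionHat_cartier (hp : p.Prime) (hp2 : 2 < p) (hσ : IsFrobeniusLift p σ)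
    {g : Laurent n R} (hg : UnitVertices g) {μ : Set (Fin n → ℝ)}
    (hμ : μ ⊆ newtonPolytope g) {b : Fin n → ℤ} (hb : IsVertex g b) {x : OmegaHat p g μ}
    {y : OmegaHat p (twist σ g) μ} (h : IsImage (fun s => cartierChain hp σ g (2 * s)) x y) :
    expansionHat p (twist σ g) b μ y = cartierSeries p (expansionHat p g b μ x) := by
  refine expansionHat_eq fun s => ?_
  obtain ⟨w, hw, hw'⟩ := h s
  refine ⟨_, hw', fun k => ?_⟩
  have h1 := (pow_dvd_pow (p : R) (by omega : s ≤ 2 * s + 1)).trans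
    (pow_dvd_cartierSeries_sub hp hp2 hσ hg hb (2 * s) (chains_mono hμ hw.mem) k)
  have h2 := hw.expansionHat b ((p : ℤ) • k)
  rw [← dvd_neg]
  have e : -(chainSeries (twist σ g) b (cartierChain hp σ g (2 * s) w) k -
      cartierSeries p (UnitRoot.expansionHat p g b μ x) k) =
      (cartierSeries p (chainSeries g b w) -
        chainSeries (twist σ g) b (cartierChain hp σ g (2 * s) w)) k +
      (UnitRoot.expansionHat p g b μ x ((p : ℤ) • k) - chainSeries g b w ((p : ℤ) • k)) := by
    change -(_ - UnitRoot.expansionHat p g b μ x ((p : ℤ) • k)) =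
      (chainSeries g b w ((p : ℤ) • k) - _) + _
    ring
  rw [e]
  exact dvd_add h1 h2

/-- The Cartier operator on `Q_g(μ)`. -/
theorem exists_cartier (hp : p.Prime) (hp2 : 2 < p) (hσ : IsFrobeniusLift p σ)
    {g : Laurent n R} (hg : UnitVertices g) {μ : Set (Fin n → ℝ)}
    (hμ : Absorbs (newtonPolytope g) μ) {b : Fin n → ℤ} (hb : IsVertex g b) :
    ∃ T : Q p g b μ →ₗ[R] Q p (twist σ g) b μ, IsCartier p σ g b μ T ∧ ∀ x y,
      expansionHat p (twist σ g) b μ y = cartierSeries p (expansionHat p g b μ x) →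
        T (Q.mk p g b μ x) = Q.mk p (twist σ g) b μ y := by
  have hN := newtonPolytope_twist hg σ
  have hg' := hg.twist σ
  have hb' : IsVertex (twist σ g) b := by unfold IsVertex; rwa [hN]
  have hex : ∀ x : OmegaHat p g μ, ∃ y : OmegaHat p (twist σ g) μ,
      expansionHat p (twist σ g) b μ y = cartierSeriesHom n R p (expansionHat p g b μ x) := fun x => by
    obtain ⟨y, hy⟩ := exists_isImage_cartierChain hp hp2 hσ hμ x
    exact ⟨y, hy.expansionHat_cartier hp hp2 hσ hg hμ.1 hb⟩
  obtain ⟨T, hT⟩ := exists_addMonoidHom_Q (cartierSeriesHom n R p) (fun x y hxy hx => by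
    rw [mem_U_iff hp hb (hg b hb) hμ.1] at hx
    rw [mem_U_iff hp hb' (hg' b hb') (hN ▸ hμ.1), hxy]
    intro s i hi k
    -- The coefficient at `p^i k` of the Cartier image is the coefficient at `p^(i+1) k` of the
    -- original series, so it is divisible by even one more power of `p`.
    have := hx (s + 1) (i + 1) (by omega) k
    rw [pow_succ' (p : ℤ), mul_smul] at this
    exact (pow_dvd_pow _ (Nat.le_succ i)).trans this) hex
  refine ⟨{ T with map_smul' := ?_ }, fun x => (hex x).imp fun y hy => ⟨hy, hT x y hy⟩, hT⟩
  intro r q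
  obtain ⟨x, rfl⟩ := Q.mk_surjective p g b μ q
  obtain ⟨y, hy⟩ := hex x
  have h1 := hT (r • x) (r • y) (by rw [map_smul, map_smul, hy]; rfl)
  have h2 := hT x y hy
  rw [LinearMap.map_smul, LinearMap.map_smul, ← h2] at h1
  exact h1

end Operators

end UnitRoot

namespace UnitRoot

variable {n : ℕ} {R : Type*} [CommRing R]

/-! ### Chains on lattice points and faces -/

section LatticeChains

variable {μ μ' : Set (Fin n → ℝ)} [Fintype (Lat μ)] [Fintype (Lat μ')]

theorem latChain_apply_of_notMem (a : Lat μ → R) {u : Fin n → ℤ} (hu : toReal u ∉ μ) :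
    latChain a (1, u) = 0 := by
  by_contra h
  exact hu (inDil_one.1 (mem_chains.1 (latChain_mem a) (1, u) h).2)

theorem latChain_inclusion (h : μ' ⊆ μ) (a : Lat μ → R) (ha : ∀ u : Lat μ, toReal u.1 ∉ μ' → a u = 0) :
    latChain (fun u : Lat μ' => a ⟨u.1, h u.2⟩) = latChain a := by
  ext ⟨m, u⟩
  by_cases hm : m = 1
  · subst hm
    by_cases hu : toReal u ∈ μ'
    · rw [latChain_apply_mk _ (⟨u, hu⟩ : Lat μ'), latChain_apply_mk _ (⟨u, h hu⟩ : Lat μ)]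
    · rw [latChain_apply_of_notMem _ hu]
      by_cases hu' : toReal u ∈ μ
      · rw [latChain_apply_mk _ (⟨u, hu'⟩ : Lat μ), ha _ hu]
      · rw [latChain_apply_of_notMem _ hu']
  · rw [latChain_apply_of_ne _ hm, latChain_apply_of_ne _ hm]

theorem faceChain_latChain {η : Set (Fin n → ℝ)} (h : μ' = μ ∩ η) (a : Lat μ → R) :
    faceChain η (latChain a) = latChain (fun u : Lat μ' => a ⟨u.1, (h.subset u.2).1⟩) := by
  classical
  ext ⟨m, u⟩
  rw [faceChain_apply]
  by_cases hm : m = 1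
  · subst hm
    simp only [inDil_one]
    by_cases hu : toReal u ∈ μ
    · split_ifs with hη
      · rw [latChain_apply_mk _ (⟨u, hu⟩ : Lat μ),
          latChain_apply_mk _ (⟨u, h.superset ⟨hu, hη⟩⟩ : Lat μ')]
      · rw [latChain_apply_of_notMem _ fun hu' => hη (h.subset hu').2]
    · rw [latChain_apply_of_notMem _ hu,
        latChain_apply_of_notMem _ fun hu' => hu (h.subset hu').1, ite_self]
  · rw [latChain_apply_of_ne _ hm, latChain_apply_of_ne _ hm, ite_self]

end LatticeChains

/-! ### The decomposition -/

section FaceMap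

variable {p : ℕ} {g h : Laurent n R} {η μ μ' : Set (Fin n → ℝ)}

/-- `ρ` is the restriction to the face `η`. -/
def IsFaceMap (η : Set (Fin n → ℝ)) (ρ : OmegaHat p g μ →ₗ[R] OmegaHat p h μ') : Prop :=
  ∀ x s w, Approx x s w → Approx (ρ x) s (faceChain η w)

theorem IsFaceMap.incl_eq_zero {ρ : OmegaHat p g μ →ₗ[R] OmegaHat p h μ'} (hρ : IsFaceMap η ρ)
    {ν : Set (Fin n → ℝ)} (hν : ν ⊆ μ) (hνη : ν ∩ η = ∅) (x : OmegaHat p g ν) :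
    ρ (OmegaHat.incl p g hν x) = 0 := by
  refine eq_of_approx fun s => ?_
  obtain ⟨w, hw⟩ := exists_approx x s
  have h0 : faceChain η w = 0 := by
    ext i
    by_contra h0
    obtain ⟨-, y, hy, -⟩ := mem_chains.1 (faceChain_mem hw.mem) i h0
    rw [hνη] at hy
    exact hy
  exact ⟨0, h0 ▸ hρ _ s w (hw.incl hν), approx_zero s⟩

theorem IsFaceMap.latHat [Fintype (Lat μ)] [Fintype (Lat μ')]
    {ρ : OmegaHat p g μ →ₗ[R] OmegaHat p h μ'} (hρ : IsFaceMap η ρ) (hμ : μ' = μ ∩ η)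
    (a : Lat μ → R) :
    ρ (latHat p g a) =
      latHat p h (fun u : Lat μ' => a ⟨u.1, (hμ.subset u.2).1⟩) :=
  eq_of_approx fun s =>
    ⟨_, hρ _ s _ (approx_of (latChain_mem a) s), by
      rw [faceChain_latChain hμ a]; exact approx_of _ s⟩

/-- Operators computed on representing chains commute with restriction to the face as soon as they
do so on chains. Both the connection and the Cartier operator are treated this way. -/
theorem IsFaceMap.isImage {g' h' : Laurent n R} {ρ : OmegaHat p g μ →ₗ[R] OmegaHat p h μ'}
    {ρ' : OmegaHat p g' μ →ₗ[R] OmegaHat p h' μ'} (hρ : IsFaceMap η ρ) (hρ' : IsFaceMap η ρ')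
    {A B : ℕ → Chain n R → Chain n R}
    (hAB : ∀ s, ∀ w ∈ chains R μ, faceChain η (A s w) = B s (faceChain η w))
    {x : OmegaHat p g μ} {y : OmegaHat p g' μ} (hxy : IsImage A x y) : IsImage B (ρ x) (ρ' y) := by
  intro s
  obtain ⟨w, hw, hw'⟩ := hxy s
  exact ⟨_, hρ x s w hw, hAB s w hw.mem ▸ hρ' y s _ hw'⟩

variable [IsAdicComplete (Ideal.span {(p : R)}) R] [IsDomain R] [CharZero R] {σ : R →+* R}

/-- The vertices `b` and `v` are unrelated, and `b` need not lie on `η`, so expansions cannot be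
compared directly. Instead, being a formal derivative is read off from the Cartier iterates on
chains, and these commute with restriction to the face. -/
theorem IsFaceMap.mem_U {ρ : OmegaHat p g μ →ₗ[R] OmegaHat p h μ'} (hρ : IsFaceMap η ρ)
    (hp : p.Prime) (hp2 : 2 < p) (hσ : IsFrobeniusLift p σ)
    (hg : UnitVertices g) (hh : UnitVertices h) (hη : IsFace (newtonPolytope g) η)
    (hgh : IsInit (newtonPolytope g) η 1 g h) (hμ : μ ⊆ newtonPolytope g)
    (hμ' : μ' ⊆ newtonPolytope h) {b v : Fin n → ℤ} (hb : IsVertex g b) (hv : IsVertex h v)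
    {x : OmegaHat p g μ} (hx : x ∈ U p g b μ) : ρ x ∈ U p h v μ' := by
  classical
  rw [mem_U_iff_cartierPow hp hp2 hσ hg hμ hb] at hx
  rw [mem_U_iff hp hv (hh v hv) hμ']
  intro s
  obtain ⟨w, hw⟩ := exists_approx x s
  have hw' := hρ x s w hw
  refine (hw'.isFormalUpTo_iff v).2 ((isFormalUpTo_iff hp hp2 hσ hh hv (Nat.le_succ s)
    (chains_mono hμ' hw'.mem)).2 fun i hi j => ?_)
  rw [← faceChain_cartierPow hp hσ hg hη hgh s i (chains_mono hμ hw.mem), faceChain_apply]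
  split_ifs
  · exact hx s w hw i hi j
  · exact dvd_zero _

end FaceMap

section Decomposition

variable {p : ℕ} [IsAdicComplete (Ideal.span {(p : R)}) R] [IsDomain R] [CharZero R] {σ : R →+* R}

theorem exists_linearMap_Q {R : Type*} [CommRing R] {p : ℕ}
    [IsAdicComplete (Ideal.span {(p : R)}) R] {g : Laurent n R} {b : Fin n → ℤ}
    {μ : Set (Fin n → ℝ)} {P : Type*} [AddCommGroup P] [Module R P] (T : OmegaHat p g μ →ₗ[R] P)
    (hT : ∀ x ∈ U p g b μ, T x = 0) :
    ∃ c : Q p g b μ →ₗ[R] P, ∀ x, c (Q.mk p g b μ x) = T x :=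
  ⟨(U p g b μ).liftQ T hT, fun _ => rfl⟩

/-- The decomposition, for a Laurent polynomial `g` with the same Newton polytope as `f`. -/
theorem exists_decomposition (hp : p.Prime) (hp2 : 2 < p) (hσ : IsFrobeniusLift p σ)
    {f : Laurent n R} {l : ℕ} (hl : 1 ≤ l) {g : Laurent n R} {h : Face f l → Laurent n R}
    {b : Fin n → ℤ} {v : Face f l → Fin n → ℤ} (hg : UnitVertices g) (hh : ∀ η, UnitVertices (h η))
    (hN : newtonPolytope g = newtonPolytope f)
    (hNh : ∀ η, newtonPolytope (h η) = newtonPolytope (restrict f η.1))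
    (hgh : ∀ η, IsInit (newtonPolytope f) η.1 1 g (h η)) (hb : IsVertex g b)
    (hv : ∀ η, IsVertex (h η) (v η)) [DecidableEq (Lat (mu f l))]
    [∀ η : Face f l, DecidableEq (Lat (interiorOf (restrict f η.1)))]
    (hW : IsUnit (hasseWittOn p g (mu f l)))
    (hWh : ∀ η, IsUnit (hasseWittOn p (h η) (interiorOf (restrict f η.1))))
    (ρ : ∀ η : Face f l, OmegaHat p g (mu f l) →ₗ[R] OmegaHat p (h η) (interiorOf (restrict f η.1)))
    (hρ : ∀ η, IsFaceMap η.1 (ρ η)) :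
    ∃ e : Decomposition p f l g h b v, IsStandard p f l e ∧
      ∀ x η, e.component (Q.mk p g b (mu f l) x) η =
        Q.mk p (h η) (v η) (interiorOf (restrict f η.1)) (ρ η x) := by
  classical
  have habs : Absorbs (newtonPolytope g) (mu f l) :=
    by rw [hN]; exact absorbs_faceFiltration (convex_newtonPolytope f) l
  have habs' : ∀ η : Face f l, Absorbs (newtonPolytope (h η)) (interiorOf (restrict f η.1)) :=
    fun η => by rw [hNh η]; exact absorbs_faceFiltration (convex_newtonPolytope _) 0
  have hint : ∀ η : Face f l, interiorOf (restrict f η.1) = mu f l ∩ η.1 := interiorOf_restrict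
  have hincl := mu_mono f (Nat.sub_le l 1)
  have hU : ∀ (η : Face f l) x, x ∈ U p g b (mu f l) →
      ρ η x ∈ U p (h η) (v η) (interiorOf (restrict f η.1)) := fun η x hx =>
    (hρ η).mem_U hp hp2 hσ hg (hh η) (by rw [hN]; exact η.2.1) (by rw [hN]; exact hgh η) habs.1 (habs' η).1 hb (hv η) hx
  have hc : ∀ η : Face f l, ∃ c : Q p g b (mu f l) →ₗ[R]
      Q p (h η) (v η) (interiorOf (restrict f η.1)), ∀ x, c (Q.mk p g b (mu f l) x) =
        Q.mk p (h η) (v η) (interiorOf (restrict f η.1)) (ρ η x) := by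
    intro η
    have hT : ∀ x ∈ U p g b (mu f l),
        (Q.mk p (h η) (v η) (interiorOf (restrict f η.1)) ∘ₗ ρ η) x = 0 := fun x hx =>
      (Q.mk_eq_zero p (h η) (v η) (interiorOf (restrict f η.1)) (ρ η x)).2 (hU η x hx)
    obtain ⟨c, hc⟩ := exists_linearMap_Q _ hT
    exact ⟨c, hc⟩
  choose c hc using hc
  have hcincl : ∀ q η, c η (Q.incl p g b hincl q) = 0 := by
    intro q η
    obtain ⟨x, rfl⟩ := Q.mk_surjective p g b _ q
    have h1 := hc η (OmegaHat.incl p g hincl x)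
    rw [(hρ η).incl_eq_zero hincl (mu_inter_face hl η), map_zero] at h1
    exact h1
  have hker : LinearMap.range (Q.incl p g b hincl) ≤ LinearMap.ker (LinearMap.pi c) := by
    rintro _ ⟨q, rfl⟩
    rw [LinearMap.mem_ker]
    exact funext fun η => hcincl q η
  set C := (LinearMap.range (Q.incl p g b hincl)).liftQ (LinearMap.pi c) hker with hC
  have hCmk : ∀ x η, C (Submodule.Quotient.mk (Q.mk p g b (mu f l) x)) η =
      Q.mk p (h η) (v η) (interiorOf (restrict f η.1)) (ρ η x) := fun x η => hc η x
  -- If `x` has coordinates `a` modulo `U`, its image at `η` has as coordinates those `a u` with `u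
  -- ∈ η°`. Independence there makes them vanish, so `a` is supported on `μ^{(l-1)}` and the class
  -- comes from `Q_g(μ^{(l-1)})`.
  have hinj : Function.Injective C := by
    refine (injective_iff_map_eq_zero C).2 fun z hz => ?_
    obtain ⟨q, rfl⟩ := Submodule.Quotient.mk_surjective _ z
    obtain ⟨x, rfl⟩ := Q.mk_surjective p g b _ q
    obtain ⟨a, ha⟩ := exists_latHat_sub_mem_U hp hp2 hσ hg habs hb hW x
    have hzero : ∀ u : Lat (mu f l), toReal u.1 ∉ mu f (l - 1) → a u = 0 := by
      intro u hu
      obtain ⟨η, hη⟩ := exists_face u.2 hu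
      have h1 : ρ η x ∈ U p (h η) (v η) (interiorOf (restrict f η.1)) := by
        rw [← Q.mk_eq_zero, ← hCmk, hz]; rfl
      have h2 := Submodule.sub_mem _ h1 (hU η _ ha)
      rw [map_sub, sub_sub_cancel, (hρ η).latHat (hint η)] at h2
      exact congrFun (latHat_mem_U hp hp2 hσ (hh η) (habs' η) (hv η) (hWh η) h2)
        ⟨u.1, (hint η).superset ⟨u.2, hη⟩⟩
    refine (Submodule.Quotient.mk_eq_zero _).2
      ⟨Q.mk p g b _ (latHat p g fun u : Lat (mu f (l - 1)) => a ⟨u.1, hincl u.2⟩), ?_⟩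
    have h3 : OmegaHat.incl p g hincl (latHat p g fun u : Lat (mu f (l - 1)) => a ⟨u.1, hincl u.2⟩) =
        latHat p g a := eq_of_approx fun s =>
      ⟨_, (approx_of (latChain_mem _) s).incl hincl, by
        rw [latChain_inclusion hincl a hzero]; exact approx_of _ s⟩
    change Q.mk p g b (mu f l) (OmegaHat.incl p g hincl _) = _
    rw [h3, eq_comm, ← sub_eq_zero, ← map_sub, Q.mk_eq_zero]
    exact ha
  have hsurj : Function.Surjective C := by
    intro q
    choose x hx using fun η => Q.mk_surjective p (h η) (v η) (interiorOf (restrict f η.1)) (q η)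
    choose a ha using fun η =>
      exists_latHat_sub_mem_U hp hp2 hσ (hh η) (habs' η) (hv η) (hWh η) (x η)
    -- A lattice point of `μ^{(l)}` lies on at most one face of codimension `l`, so coordinates
    -- prescribed on the faces glue. On `μ^{(l-1)}`, which meets none of these faces, the value is
    -- `0`.
    set A : Lat (mu f l) → R := fun u => if hu : ∃ η : Face f l, toReal u.1 ∈ η.1
      then a hu.choose ⟨u.1, (hint _).superset ⟨u.2, hu.choose_spec⟩⟩ else 0 with hA
    refine ⟨Submodule.Quotient.mk (Q.mk p g b _ (latHat p g A)), funext fun η => ?_⟩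
    have hAη : (fun u : Lat (interiorOf (restrict f η.1)) =>
        A ⟨u.1, ((hint η).subset u.2).1⟩) = a η := by
      funext u
      have hu : toReal u.1 ∈ mu f l ∩ η.1 := (hint η).subset u.2
      have hex : ∃ η : Face f l, toReal u.1 ∈ η.1 := ⟨η, hu.2⟩
      have e : hex.choose = η := Face.eq_of_mem hu.1 hex.choose_spec hu.2
      -- The face picked by choice equals `η`, but the type of the coordinates depends on it;
      -- substituting an arbitrary `ζ` performs the transport.
      have key : ∀ (ζ : Face f l) (hζ : toReal u.1 ∈ interiorOf (restrict f ζ.1)), ζ = η →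
          a ζ ⟨u.1, hζ⟩ = a η u := by
        rintro ζ hζ rfl; rfl
      rw [hA]
      dsimp only
      rw [dif_pos hex]
      exact key _ _ e
    rw [hCmk, (hρ η).latHat (hint η), hAη, ← hx, eq_comm, ← sub_eq_zero, ← map_sub, Q.mk_eq_zero]
    exact ha η
  have := Fintype.ofFinite (Face f l)
  set e : Decomposition p f l g h b v := LinearEquiv.ofBijective C ⟨hinj, hsurj⟩ ≪≫ₗ
    (DirectSum.linearEquivFunOnFintype R (Face f l)
      fun η => Q p (h η) (v η) (interiorOf (restrict f η.1))).symm with he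
  have hcomp : ∀ x η, e.component (Q.mk p g b (mu f l) x) η =
      Q.mk p (h η) (v η) (interiorOf (restrict f η.1)) (ρ η x) := fun x η => hCmk x η
  refine ⟨e, fun η u hu hu' => ?_, hcomp⟩
  refine DFinsupp.ext fun ζ => ?_
  change e.component (Q.mk p g b (mu f l) _) ζ = _
  rw [hcomp]
  by_cases hζ : ζ = η
  · subst hζ
    have huζ : toReal u ∈ ζ.1 := ((hint ζ).subset hu).2
    rw [DirectSum.lof_apply, omegaClass]
    refine congrArg _ (eq_of_approx fun s => ⟨_, hρ ζ _ s _ (approx_omega hu' s), ?_⟩)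
    rw [faceChain_single_of_mem (inDil_one.2 huζ)]
    exact approx_omega hu s
  · have huη : toReal u ∈ η.1 := ((hint η).subset hu).2
    have h0 : faceChain ζ.1 (Finsupp.single (1, u) (1 : R)) = 0 :=
      faceChain_single_of_notMem
        (fun hd => hζ (Face.eq_of_mem hu' (inDil_one.1 hd) huη)) 1
    rw [DirectSum.lof_eq_of, DirectSum.of_eq_of_ne _ _ _ hζ]
    have : ρ ζ (AdicCompletion.of _ _ ⟨omega g 1 u, omega_mem g hu'⟩) = 0 :=
      eq_of_approx fun s => ⟨0, by rw [← h0]; exact hρ ζ _ s _ (approx_omega hu' s), approx_zero s⟩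
    rw [this, map_zero]

end Decomposition

end UnitRoot

namespace UnitRoot

variable {n : ℕ} {R : Type*} [CommRing R]

theorem IsVertex.twist [Nontrivial R] {g : Laurent n R} (hg : UnitVertices g) {b : Fin n → ℤ} (hb : IsVertex g b)
    (σ : R →+* R) : IsVertex (twist σ g) b := by
  unfold IsVertex
  rwa [newtonPolytope_twist hg σ]

theorem isUnit_hasseWittOn_twist {p : ℕ} {σ : R →+* R} {μ : Set (Fin n → ℝ)} [Fintype (Lat μ)]
    [DecidableEq (Lat μ)] {g : Laurent n R} (h : IsUnit (hasseWittOn p g μ)) :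
    IsUnit (hasseWittOn p (twist σ g) μ) :=
  isUnit_hasseWittOn_iterate h 1

end UnitRoot
end

/-! ### Assembly of the theorem -/

open UnitRoot in
theorem theorem6p1 {n : ℕ} {R : Type*} [CommRing R] [IsDomain R] [CharZero R]
    (p : ℕ) (hp : p.Prime) (hp2 : 2 < p) [IsAdicComplete (Ideal.span {(p : R)}) R]
    (hσ : ∃ σ : R →+* R, IsFrobeniusLift p σ)
    (f : Laurent n R) (hf : ∀ b, IsVertex f b → IsUnit (f.coeff b))
    (l : ℕ) (hl : 1 ≤ l) (hl' : l ≤ polyDim (newtonPolytope f)) :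
    (IsUnit (hasseWitt p f l) ↔
      IsUnit (hasseWitt p f (l - 1)) ∧
        ∀ η : Face f l, IsUnit (hasseWitt p (restrict f η.1) 0)) ∧
    (IsUnit (hasseWitt p f l) →
      ∀ (b : Fin n → ℤ), IsVertex f b →
      ∀ (v : Face f l → Fin n → ℤ), (∀ η, IsVertex (restrict f η.1) (v η)) →
      ∃ e : Decomposition p f l f (fun η => restrict f η.1) b v, IsStandard p f l e ∧
        -- compatibility with the connection
        (∀ δ : Derivation ℤ R R,
          ∃ (D : Q p f b (mu f l) →+ Q p f b (mu f l))
            (D' : ∀ η : Face f l,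
              Q p (restrict f η.1) (v η) (interiorOf (restrict f η.1)) →+
                Q p (restrict f η.1) (v η) (interiorOf (restrict f η.1))),
            IsConnection p δ f b (mu f l) D ∧
            (∀ η : Face f l, IsConnection p δ (restrict f η.1) (v η) (interiorOf (restrict f η.1)) (D' η)) ∧
            ∀ (q : Q p f b (mu f l)) (η : Face f l), Decomposition.component e (D q) η = D' η (Decomposition.component e q η)) ∧
        -- compatibility with the Cartier operators
        (∀ σ : R →+* R, IsFrobeniusLift p σ →
          ∃ (e' : Decomposition p f l (twist σ f) (fun η => twist σ (restrict f η.1)) b v)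
            (T : Q p f b (mu f l) →ₗ[R] Q p (twist σ f) b (mu f l))
            (T' : ∀ η : Face f l,
              Q p (restrict f η.1) (v η) (interiorOf (restrict f η.1)) →ₗ[R]
                Q p (twist σ (restrict f η.1)) (v η) (interiorOf (restrict f η.1))),
            IsStandard p f l e' ∧
            IsCartier p σ f b (mu f l) T ∧
            (∀ η : Face f l, IsCartier p σ (restrict f η.1) (v η) (interiorOf (restrict f η.1)) (T' η)) ∧
            ∀ (q : Q p f b (mu f l)) (η : Face f l), Decomposition.component e' (T q) η =
              T' η (Decomposition.component e q η))) := by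
  have hiff := isUnit_hasseWitt_iff hp.one_lt.le f hl
  refine ⟨hiff, fun hW b hb v hv => ?_⟩
  obtain ⟨σ₀, hσ₀⟩ := hσ
  have hWη := (hiff.1 hW).2
  have hfη : ∀ η : Face f l, UnitVertices (restrict f η.1) := fun η =>
    UnitVertices.restrict hf η.2.1
  have hinit : ∀ η : Face f l, IsInit (newtonPolytope f) η.1 1 f (restrict f η.1) := fun η =>
    isInit_restrict η.2.1
  have hc := convex_newtonPolytope f
  have habs : Absorbs (newtonPolytope f) (mu f l) := absorbs_faceFiltration hc l
  have habs' : ∀ η : Face f l,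
      Absorbs (newtonPolytope (restrict f η.1)) (interiorOf (restrict f η.1)) := fun η =>
    absorbs_faceFiltration (convex_newtonPolytope _) 0
  have hint : ∀ η : Face f l, mu f l ∩ η.1 ⊆ interiorOf (restrict f η.1) := fun η =>
    (interiorOf_restrict η).superset
  have hρ : ∀ η : Face f l, ∃ ρ : OmegaHat p f (mu f l) →ₗ[R]
      OmegaHat p (restrict f η.1) (interiorOf (restrict f η.1)), IsFaceMap η.1 ρ := fun η =>
    exists_faceHat p η.2.1 (hinit η) hb (hf b hb) habs.1 (hint η)
  choose ρ hρ using hρ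
  -- The components of `e` come from the restriction maps `ρ`, which involve no Frobenius lift. The
  -- lift `σ₀` only serves to prove that they are well defined on the quotients and bijective, so
  -- the same `e` works for every `δ` and every `σ`.
  obtain ⟨e, he, hcomp⟩ := exists_decomposition hp hp2 hσ₀ hl hf hfη rfl (fun _ => rfl) hinit hb hv
    hW hWη ρ hρ
  refine ⟨e, he, fun δ => ?_, fun σ hσ => ?_⟩
  · obtain ⟨D, hD, hDmk⟩ := exists_connection δ hp hf habs hb
    choose D' hD' hDmk' using fun η : Face f l =>
      exists_connection δ hp (hfη η) (habs' η) (hv η)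
    refine ⟨D, D', hD, hD', fun q η => ?_⟩
    obtain ⟨x, rfl⟩ := Q.mk_surjective p f b (mu f l) q
    obtain ⟨y, hy⟩ := exists_isImage_derivChain δ habs x
    have hy' : IsImage (fun _ => derivChain δ (restrict f η.1)) (ρ η x) (ρ η y) :=
      (hρ η).isImage (hρ η) (fun _ w hw => faceChain_derivChain δ hc η.2.1.1.isExtreme
        (η.2.1.convex hc) (hinit η) (chains_mono habs.1 hw)) hy
    -- The connection maps are evaluated on the lifts `y` and `ρ η y`, both computed on chains, so
    -- commutation reduces to that of `faceChain` with `derivChain`.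
    rw [hDmk x y (hy.expansionHat_deriv δ habs.1 hb (hf b hb)), hcomp, hcomp,
      hDmk' η _ _ (hy'.expansionHat_deriv δ (habs' η).1 (hv η) (hfη η _ (hv η)))]
  · have hN := newtonPolytope_twist hf σ
    have hb' := IsVertex.twist hf hb σ
    have hρ' : ∀ η : Face f l, ∃ ρ' : OmegaHat p (twist σ f) (mu f l) →ₗ[R]
        OmegaHat p (twist σ (restrict f η.1)) (interiorOf (restrict f η.1)), IsFaceMap η.1 ρ' :=
      fun η => exists_faceHat p (by rw [hN]; exact η.2.1) (by rw [hN]; exact (hinit η).twist σ) hb'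
        (UnitVertices.twist hf σ b hb') (by rw [hN]; exact habs.1) (hint η)
    choose ρ' hρ' using hρ'
    -- The twist keeps the Newton polytopes, the vertices and the initial parts, and applies `σ` to
    -- the Hasse–Witt matrices. All hypotheses of the decomposition therefore pass from `f` to
    -- `f^σ`.
    obtain ⟨e', he', hcomp'⟩ := exists_decomposition hp hp2 hσ hl (UnitVertices.twist hf σ)
      (fun η => (hfη η).twist σ) hN (fun η => newtonPolytope_twist (hfη η) σ)
      (fun η => (hinit η).twist σ) hb' (fun η => (hv η).twist (hfη η) σ)
      (isUnit_hasseWittOn_twist hW) (fun η => isUnit_hasseWittOn_twist (hWη η)) ρ' hρ'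
    obtain ⟨T, hT, hTmk⟩ := exists_cartier hp hp2 hσ hf habs hb
    choose T' hT' hTmk' using fun η : Face f l =>
      exists_cartier hp hp2 hσ (hfη η) (habs' η) (hv η)
    refine ⟨e', T, T', he', hT, hT', fun q η => ?_⟩
    obtain ⟨x, rfl⟩ := Q.mk_surjective p f b (mu f l) q
    obtain ⟨y, hy⟩ := exists_isImage_cartierChain hp hp2 hσ habs x
    have hy' : IsImage (fun s => cartierChain hp σ (restrict f η.1) (2 * s)) (ρ η x) (ρ' η y) :=
      (hρ η).isImage (hρ' η) (fun s w hw => faceChain_cartierChain hp hσ hc η.2.1.1.isExtreme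
        (η.2.1.convex hc) η.2.1.2 (hinit η) (2 * s) (chains_mono habs.1 hw)) hy
    rw [hTmk x y (hy.expansionHat_cartier hp hp2 hσ hf habs.1 hb), hcomp, hcomp',
      hTmk' η _ _ (hy'.expansionHat_cartier hp hp2 hσ (hfη η) (habs' η).1 (hv η))]
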